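/- Let $d\in\{2,3\}$ and let $\Omega\subset\mathbb{R}^d$ be a bounded polyhedral domain, i.e. a bounded, open, connected set whose closure is a finite union of convex polytopes, such that $\Omega$ is the interior of $\overline\Omega$ and every boundary point has arbitrarily small neighbourhoods $U$ with $U\cap\Omega$ connected (every polyhedral Lipschitz domain is of this kind). Let $\mathcal{T}$ be a conforming triangulation of $\overline\Omega$ into closed $d$-simplices, $\mathcal{N}$ the set of all its nodes (vertices of elements, including those on $\partial\Omega$), $V_{\mathcal T}$ the space of functions that are continuous on $\overline\Omega$ and affine on each $T\in\mathcal{T}$, and $\{\phi_x\}_{x\in\mathcal{N}}$ its nodal basis. For $x\in\mathcal{N}$ let $\omega_x$ be the union of all elements containing $x$, for $T\in\mathcal{T}$ let $D_T$ be the union of all elements that intersect $T$, and put $h_T=|T|^{1/d}$ and $h_F=|F|^{1/(d-1)}$ for a $(d-1)$-dimensional face $F$ of an element. For $v\in L^1(\Omega)$ define $$\Pi_{\mathcal T} v=\sum_{x\in\mathcal{N}}\frac{1}{|\omega_x|}\Big(\int_{\omega_x}v\,dx\Big)\phi_x .$$ (i) $\Pi_{\mathcal T} v\in V_{\mathcal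 T}$ for all $v\in L^1(\Omega)$; and if $c_0\le v\le c_1$ a.e. in $\Omega$, then $\Pi_{\mathcal T} v\in V_{\mathcal T}\cap\{\sigma\in H^1(\Omega): c_0\le\sigma\le c_1\text{ a.e. in }\Omega\}$. (ii) There is a constant $c$, independent of $r$, $v$, $T$, $F$ and of the mesh size, such that for all $r\in[1,\infty]$, all $T\in\mathcal{T}$ and all $(d-1)$-dimensional faces $F\subset\partial T$, $$\|\Pi_{\mathcal T} v\|_{L^r(T)}\le c\,\|v\|_{L^r(D_T)}\qquad\text{for all } v\in L^r(\Omega),$$ and for all $v\in W^{1,r}(\Omega)$ $$\|\nabla\Pi_{\mathcal T} v\|_{L^r(T)}\le c\,\|\nabla v\|_{L^r(D_T)},\qquad \|v-\Pi_{\mathcal T} v\|_{L^r(T)}\le c\,h_T\|\nabla v\|_{L^r(D_T)},\qquad \|v-\Pi_{\mathcal T} v\|_{L^r(F)}\le c\,h_F^{1-1/r}\|\nabla v\|_{L^r(D_T)},$$ where on $F$ the function $v$ is understood as its (existing) trace and $1/r=0$ for $r=\infty$. The dependence of the constant is as follows. For every $\gamma$ there is one $c=c(d,\gamma)$ that serves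 for all such $\Omega$ and all such $\mathcal{T}$ with $\operatorname{diam}(T)\le\gamma h_T$ for every $T\in\mathcal{T}$. Moreover, for every $\Omega$ and every conforming triangulation $\mathcal{T}_0$ of $\overline\Omega$ there is one $c$ that serves for all conforming triangulations $\mathcal{T}$ of $\overline\Omega$ obtained from $\mathcal{T}_0$ by successive bisection, starting from any ordering of the vertices and any types of the elements of $\mathcal{T}_0$. Here a simplex with ordered vertices $(z_0,\dots,z_d)$ and type $t\in\{0,\dots,d-1\}$ is bisected at the midpoint $\bar z$ of $z_0z_d$ into $(z_0,\bar z,z_1,\dots,z_t,z_{t+1},\dots,z_{d-1})$ and $(z_d,\bar z,z_1,\dots,z_t,z_{d-1},\dots,z_{t+1})$, both of type $(t+1)\bmod d$ (newest vertex bisection for $d=2$). -/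

import Mathlib

open MeasureTheory Topology Filter
open scoped NNReal ENNReal ContDiff

noncomputable section

namespace Clement

/-- Euclidean space `ℝ^d`. -/
abbrev E (d : ℕ) := EuclideanSpace ℝ (Fin d)

/-! ### Domains and meshes -/

/-- Bounded polyhedral domains: `Ω` is a bounded, open, connected set whose closure is a finite
union of convex polytopes, and `Ω` lies locally on one side of its boundary, i.e. it has no slits
(`Ω` is the interior of its closure) and near each boundary point it has only one local component.
Every polyhedral Lipschitz domain has these properties. -/
structure IsPolyhedralDomain {d : ℕ} (Ω : Set (E d)) : Prop where
  isOpen : IsOpen Ω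
  isConnected : IsConnected Ω
  isBounded : Bornology.IsBounded Ω
  polyhedral : ∃ Q : Finset (Finset (E d)), closure Ω = ⋃ P ∈ Q, convexHull ℝ (P : Set (E d))
  interior_closure : interior (closure Ω) = Ω
  one_sided : ∀ x ∈ frontier Ω, ∀ ε > 0,
    ∃ U ∈ 𝓝 x, U ⊆ Metric.ball x ε ∧ IsPreconnected (U ∩ Ω)

/-- The closed convex hull of a finite set of points (a closed simplex, an edge, a face, …). -/
def hull {d : ℕ} (T : Finset (E d)) : Set (E d) := convexHull ℝ (T : Set (E d))

/-- A conforming simplicial triangulation of `closure Ω`. An element (a closed `d`-simplex) is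
given by its set of `d + 1` vertices; two elements meet exactly in the convex hull of their common
vertices. -/
structure IsTriangulation {d : ℕ} (Ω : Set (E d)) (𝒯 : Finset (Finset (E d))) : Prop where
  card_eq : ∀ T ∈ 𝒯, T.card = d + 1
  affineIndependent : ∀ T ∈ 𝒯, AffineIndependent ℝ ((↑) : T → E d)
  conforming : ∀ S ∈ 𝒯, ∀ T ∈ 𝒯,
    hull S ∩ hull T = convexHull ℝ ((S : Set (E d)) ∩ (T : Set (E d)))
  iUnion_eq : ⋃ T ∈ 𝒯, hull T = closure Ω

/-- The size `h_T = |T|^{1/d}` of an element. -/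
def hElem {d : ℕ} (T : Finset (E d)) : ℝ := (volume (hull T)).toReal ^ (1 / (d : ℝ))

/-- The size `h_F = |F|^{1/(d-1)}` of a face, `|F|` being its `(d-1)`-dimensional measure. -/
def hFace {d : ℕ} (F : Finset (E d)) : ℝ :=
  ((μHE[d - 1] : Measure (E d)) (hull F)).toReal ^ (1 / ((d : ℝ) - 1))

/-- The mesh `𝒯` is shape regular with parameter `γ`. -/
def IsShapeRegular {d : ℕ} (γ : ℝ) (𝒯 : Finset (Finset (E d))) : Prop :=
  ∀ T ∈ 𝒯, Metric.diam (hull T) ≤ γ * hElem T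

/-- The union of all elements of `𝒯` that meet the set `A`. -/
def patch {d : ℕ} (𝒯 : Finset (Finset (E d))) (A : Set (E d)) : Set (E d) :=
  ⋃ T ∈ 𝒯, ⋃ _ : (hull T ∩ A).Nonempty, hull T

/-- The set of all nodes (vertices of elements) of the mesh. -/
def nodes {d : ℕ} (𝒯 : Finset (Finset (E d))) : Finset (E d) := by
  classical exact 𝒯.biUnion id

/-! ### Bisection -/

/-- A simplex with ordered vertices `z_0, …, z_d` and a type `t ∈ {0, …, d-1}`. -/
@[ext]
structure TaggedSimplex (d : ℕ) where
  vert : Fin (d + 1) → E d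
  tag : Fin d

namespace TaggedSimplex

variable {d : ℕ}

/-- The untagged simplex. -/
def vertices (K : TaggedSimplex d) : Finset (E d) := by
  classical exact Finset.univ.image K.vert

/-- The midpoint of the refinement edge, which joins the first and the last vertex. -/
def mid (K : TaggedSimplex d) : E d := midpoint ℝ (K.vert 0) (K.vert (Fin.last d))

/-- The type `t + 1 mod d`. -/
def nextTag (K : TaggedSimplex d) : Fin d :=
  ⟨((K.tag : ℕ) + 1) % d, Nat.mod_lt _ (Nat.zero_lt_of_lt K.tag.isLt)⟩

/-- The child `(z_0, z̄, z_1, …, z_t, z_{t+1}, …, z_{d-1})` of type `t + 1 mod d`. -/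
def child₁ (K : TaggedSimplex d) : TaggedSimplex d where
  vert i :=
    if (i : ℕ) = 0 then K.vert 0
    else if (i : ℕ) = 1 then K.mid
    else K.vert (Fin.ofNat (d + 1) (i - 1))
  tag := K.nextTag

/-- The child `(z_d, z̄, z_1, …, z_t, z_{d-1}, …, z_{t+1})` of type `t + 1 mod d`. -/
def child₂ (K : TaggedSimplex d) : TaggedSimplex d where
  vert i :=
    if (i : ℕ) = 0 then K.vert (Fin.last d)
    else if (i : ℕ) = 1 then K.mid
    else if (i : ℕ) ≤ K.tag + 1 then K.vert (Fin.ofNat (d + 1) (i - 1))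
    else K.vert (Fin.ofNat (d + 1) (d + K.tag + 1 - i))
  tag := K.nextTag

end TaggedSimplex

open scoped Classical in
/-- The collections of tagged simplices obtained from `𝒮₀` by successive use of bisection (in each
step one simplex is replaced by its two children). -/
inductive Bisected {d : ℕ} (𝒮₀ : Finset (TaggedSimplex d)) : Finset (TaggedSimplex d) → Prop
  | refl : Bisected 𝒮₀ 𝒮₀
  | bisect {𝒮 : Finset (TaggedSimplex d)} (K : TaggedSimplex d) :
      Bisected 𝒮₀ 𝒮 → K ∈ 𝒮 → Bisected 𝒮₀ (insert K.child₁ (insert K.child₂ (𝒮.erase K)))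

open scoped Classical in
/-- The class of all conforming triangulations of `closure Ω` obtained from `𝒯₀` by successive
bisection, for any initial ordering of the vertices and any initial types of the elements. -/
def bisectionMeshes {d : ℕ} (Ω : Set (E d)) (𝒯₀ : Finset (Finset (E d))) :
    Set (Finset (Finset (E d))) :=
  {𝒯 | IsTriangulation Ω 𝒯 ∧
    ∃ label : Finset (E d) → TaggedSimplex d, (∀ T ∈ 𝒯₀, (label T).vertices = T) ∧
      ∃ 𝒮, Bisected (𝒯₀.image label) 𝒮 ∧ 𝒯 = 𝒮.image TaggedSimplex.vertices}

/-! ### Continuous piecewise linear functions and the interpolation operator -/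

/-- The space of functions that are continuous on `closure Ω` and affine on each element.
(Only the restrictions to `closure Ω` matter.) -/
def feSpace {d : ℕ} (Ω : Set (E d)) (𝒯 : Finset (Finset (E d))) : Set (E d → ℝ) :=
  {f | ContinuousOn f (closure Ω) ∧ ∀ T ∈ 𝒯, ∃ A : E d →ᵃ[ℝ] ℝ, Set.EqOn f A (hull T)}

/-- `w` is the system of barycentric coordinates of `y` in the element with vertex set `T`,
extended by zero to all other points. -/
def IsBarycentric {d : ℕ} (T : Finset (E d)) (y : E d) (w : E d → ℝ) : Prop :=
  (∀ z ∈ T, 0 ≤ w z) ∧ (∀ z ∉ T, w z = 0) ∧ ∑ z ∈ T, w z = 1 ∧ ∑ z ∈ T, w z • z = y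

open scoped Classical in
/-- The nodal basis function `φ_x`: its value at a point `y` of the mesh is the barycentric
coordinate of `y` belonging to `x` in an element containing `y` (in a conforming mesh the element
does not matter). Outside of the mesh the value is irrelevant and set to `0`. -/
def nodalBasis {d : ℕ} (𝒯 : Finset (Finset (E d))) (x y : E d) : ℝ :=
  if h : ∃ w : E d → ℝ, ∃ T ∈ 𝒯, IsBarycentric T y w then h.choose x else 0

/-- The interpolation operator `Π v = ∑_x (|ω_x|⁻¹ ∫_{ω_x} v) φ_x`, the sum being over all nodes. -/
def interp {d : ℕ} (𝒯 : Finset (Finset (E d))) (v : E d → ℝ) (y : E d) : ℝ :=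
  ∑ x ∈ nodes 𝒯, (⨍ z in patch 𝒯 {x}, v z) * nodalBasis 𝒯 x y

/-! ### Sobolev functions and traces -/

/-- `g` is the weak gradient of `v` in the open set `Ω`. -/
def HasWeakGradient {d : ℕ} (Ω : Set (E d)) (v : E d → ℝ) (g : E d → E d) : Prop :=
  ∀ φ : E d → ℝ, ContDiff ℝ ∞ φ → HasCompactSupport φ → tsupport φ ⊆ Ω → ∀ i : Fin d,
    ∫ x in Ω, v x * fderiv ℝ φ x (EuclideanSpace.single i 1) = -∫ x in Ω, g x i * φ x

/-- `v` belongs to `W^{1,r}(Ω)` and has the weak gradient `g`. -/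
def IsSobolev {d : ℕ} (Ω : Set (E d)) (r : ℝ≥0∞) (v : E d → ℝ) (g : E d → E d) : Prop :=
  MemLp v r (volume.restrict Ω) ∧ MemLp g r (volume.restrict Ω) ∧ HasWeakGradient Ω v g

/-- The admissible set of all `σ ∈ H^1(Ω)` with `c₀ ≤ σ ≤ c₁` almost everywhere. -/
def admissible {d : ℕ} (Ω : Set (E d)) (c₀ c₁ : ℝ) : Set (E d → ℝ) :=
  {σ | (∃ g, IsSobolev Ω 2 σ g) ∧ ∀ᵐ x ∂volume.restrict Ω, c₀ ≤ σ x ∧ σ x ≤ c₁}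

/-- `τ` is the trace on the face `F` of the element `T` of a function `v ∈ W^{1,1}(T)` with weak
gradient `g`: the trace operator is the continuous extension to `W^{1,1}(T)`, with values in
`L^1(F)`, of the restriction of continuously differentiable functions to `F`. -/
def IsTrace {d : ℕ} (T F : Finset (E d)) (v : E d → ℝ) (g : E d → E d) (τ : E d → ℝ) : Prop :=
  MemLp τ 1 ((μHE[d - 1] : Measure (E d)).restrict (hull F)) ∧
  ∃ u : ℕ → E d → ℝ, (∀ n, ContDiff ℝ 1 (u n)) ∧
    Tendsto (fun n => eLpNorm (u n - v) 1 (volume.restrict (hull T))) atTop (𝓝 0) ∧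
    Tendsto (fun n => eLpNorm (gradient (u n) - g) 1 (volume.restrict (hull T))) atTop (𝓝 0) ∧
    Tendsto (fun n => eLpNorm (u n - τ) 1 ((μHE[d - 1] : Measure (E d)).restrict (hull F)))
      atTop (𝓝 0)

/-- The local stability and error estimates of the interpolation operator, with the constant `c`:
for all `r ∈ [1, ∞]`, all elements `T` and all faces `F` of `T`. -/
def LocalEstimates {d : ℕ} (Ω : Set (E d)) (𝒯 : Finset (Finset (E d))) (c : ℝ≥0) : Prop :=
  ∀ r : ℝ≥0∞, 1 ≤ r → ∀ T ∈ 𝒯,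
    (∀ v : E d → ℝ, MemLp v r (volume.restrict Ω) →
      eLpNorm (interp 𝒯 v) r (volume.restrict (hull T)) ≤
        c * eLpNorm v r (volume.restrict (patch 𝒯 (hull T)))) ∧
    (∀ (v : E d → ℝ) (g : E d → E d), IsSobolev Ω r v g →
      eLpNorm (gradient (interp 𝒯 v)) r (volume.restrict (hull T)) ≤
        c * eLpNorm g r (volume.restrict (patch 𝒯 (hull T))) ∧
      eLpNorm (v - interp 𝒯 v) r (volume.restrict (hull T)) ≤
        c * ENNReal.ofReal (hElem T) * eLpNorm g r (volume.restrict (patch 𝒯 (hull T))) ∧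
      ∀ F ⊆ T, F.card = d →
        (∃ τ, IsTrace T F v g τ) ∧
        ∀ τ, IsTrace T F v g τ →
          eLpNorm (τ - interp 𝒯 v) r ((μHE[d - 1] : Measure (E d)).restrict (hull F)) ≤
            c * ENNReal.ofReal (hFace F ^ (1 - (r⁻¹).toReal)) *
              eLpNorm g r (volume.restrict (patch 𝒯 (hull T))))

end Clement

end

/-!
The operator averages over patches, so each claim about it on an element `T` reduces to elements
that meet `T`; shape regularity makes these boundedly many and of comparable size.

*Local inequalities.* For smooth `u`, the difference between `u x` and a mean value of `u` is an
average of the gradient along segments issuing from `x` (for the Poincaré inequality on a compact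
convex set), or along the segments joining a face to the opposite vertex (for the trace
inequality). The maps `segMap` and `coneMap` that parametrize these segments push the product
measure forward to a measure with bounded density (`map_segMap_le`, `map_coneMap_le`), and an
averaging operator with this property is bounded between `L^r` spaces for all `r ∈ [1, ∞]` at once,
with a constant independent of `r` (`eLpNorm_lintegral_comp_le`). This gives
`eLpNorm_sub_setAverage_le` and `eLpNorm_trace_sub_le`. The passage from smooth to Sobolev functions
rests on approximation by dilation and convolution on sets that are strictly star-shaped
(`exists_isC1Approx`). Simplices are of this kind, and so are unions of two simplices with a common
face, which makes the traces from both sides of that face agree.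

*Comparison of mean values.* For two elements with a common face, the trace inequality bounds the
difference of their mean values by mean values of the gradient (`Adjacent.enorm_average_sub_le`).
Since the domain lies on one side of its boundary in the sense that small neighbourhoods of a
boundary point meet it in a connected set, and since faces of codimension at least two cannot
disconnect an open connected set, any two elements with a common node are joined by a chain of
neighbours around that node (`nodeGraph_preconnected`). Shape regularity bounds the length of the
chain (`card_filter_mem_le`) and makes its elements comparable in size (`hElem_le_sizeRatio_mul`).
Hence the mean value on `ω_x` differs from the one on `T ∋ x` by at most a multiple of `h_T` times
a mean of the gradient on `D_T` (`enorm_average_patch_sub_le_localGrad`). On `T`, the interpolant is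
the affine combination of the mean values on `ω_x` for the vertices `x` of `T`; subtracting the mean
value on `T` yields the estimates of part (ii) on all shape regular meshes
(`exists_localEstimates`).

*Part (i).* On each element the interpolant is a convex combination of mean values
(`interp_mem_Icc`). A continuous piecewise affine function is Lipschitz near each point of the
domain, so integration by parts for Lipschitz functions identifies its elementwise gradient as its
weak gradient (`isSobolev_of_mem_feSpace`).

*Bisection.* The edges of an ordered and typed simplex are combinations, with coefficients of modulus
at most one, of a frame of `d` vectors (`TaggedSimplex.HasFrame`). Bisection permutes the frame vectors
up to sign and advances the type, and after `d` steps the frame is halved. The edges are therefore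
controlled by the size of the frame, while the volume halves at each step
(`IsSimplex.volume_bisect`); the ratio `diam T / h_T` stays bounded along any sequence of bisections
(`exists_isShapeRegular_bisectionMeshes`), and the second assertion about the constant follows from
the first.
-/

noncomputable section

namespace Clement

variable {d : ℕ}

/-! ### Averaging operators along a family of maps -/

section Averaging

variable {X Y Z : Type*} [MeasurableSpace X] [MeasurableSpace Y] [MeasurableSpace Z]

/-- An averaging operator `f ↦ ∫ f (Φ (·, y)) dP(y)` is bounded from `L^r(ν)` to `L^r(μ)`, for all
`r ∈ [1, ∞]`, as soon as `Φ` pushes `μ × P` forward to a measure dominated by `C • ν`. -/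
theorem eLpNorm_lintegral_comp_le {μ : Measure X} {P : Measure Y} {ν : Measure Z} [SFinite μ]
    [IsProbabilityMeasure P] {Φ : X × Y → Z} (hΦ : Measurable Φ) {C : ℝ≥0∞}
    (hC : (μ.prod P).map Φ ≤ C • ν) {f : Z → ℝ≥0∞} (hf : AEMeasurable f ν)
    {r : ℝ≥0∞} (hr : 1 ≤ r) :
    eLpNorm (fun x => ∫⁻ y, f (Φ (x, y)) ∂P) r μ ≤ C ^ (r⁻¹).toReal * eLpNorm f r ν := by
  have hac : (μ.prod P).map Φ ≪ ν :=
    (Measure.absolutelyContinuous_of_le hC).trans Measure.smul_absolutelyContinuous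
  have hf' : AEMeasurable f ((μ.prod P).map Φ) := hf.mono_ac hac
  have hfΦ : AEMeasurable (fun p => f (Φ p)) (μ.prod P) := hf'.comp_measurable hΦ
  rcases eq_or_ne r ⊤ with rfl | hr'
  · simp only [ENNReal.inv_top, ENNReal.toReal_zero, ENNReal.rpow_zero, one_mul,
      eLpNorm_exponent_top]
    have h1 : ∀ᵐ p ∂μ.prod P, f (Φ p) ≤ eLpNormEssSup f ν := by
      refine ae_of_ae_map hΦ.aemeasurable (p := fun z => f z ≤ eLpNormEssSup f ν) (hac.ae_le ?_)
      filter_upwards [enorm_ae_le_eLpNormEssSup f ν] with z hz using by simpa using hz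
    refine essSup_le_of_ae_le _ ?_
    filter_upwards [Measure.ae_ae_of_ae_prod h1] with x hx
    calc ‖∫⁻ y, f (Φ (x, y)) ∂P‖ₑ = ∫⁻ y, f (Φ (x, y)) ∂P := by simp
      _ ≤ ∫⁻ _, eLpNormEssSup f ν ∂P := lintegral_mono_ae hx
      _ = eLpNormEssSup f ν := by simp
  · have hr0 : r ≠ 0 := (zero_lt_one.trans_le hr).ne'
    have hrpos : 0 < r.toReal := ENNReal.toReal_pos hr0 hr'
    rw [eLpNorm_eq_lintegral_rpow_enorm_toReal hr0 hr', eLpNorm_eq_lintegral_rpow_enorm_toReal hr0 hr',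
      ENNReal.toReal_inv, ← one_div, ← ENNReal.mul_rpow_of_nonneg _ _ (by positivity)]
    refine ENNReal.rpow_le_rpow ?_ (by positivity)
    have hsec : ∀ᵐ x ∂μ, AEMeasurable (fun y => f (Φ (x, y))) P := by
      filter_upwards [hfΦ.aestronglyMeasurable.prodMk_left] with x hx using hx.aemeasurable
    have hJ : ∀ᵐ x ∂μ, ‖∫⁻ y, f (Φ (x, y)) ∂P‖ₑ ^ r.toReal ≤ ∫⁻ y, f (Φ (x, y)) ^ r.toReal ∂P := by
      filter_upwards [hsec] with x hx
      have := eLpNorm_le_eLpNorm_of_exponent_le hr hx.aestronglyMeasurable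
      rw [eLpNorm_one_eq_lintegral_enorm, eLpNorm_eq_lintegral_rpow_enorm_toReal hr0 hr'] at this
      simp only [enorm_eq_self] at this ⊢
      calc (∫⁻ y, f (Φ (x, y)) ∂P) ^ r.toReal
          ≤ ((∫⁻ y, f (Φ (x, y)) ^ r.toReal ∂P) ^ (1 / r.toReal)) ^ r.toReal := by gcongr
        _ = _ := by rw [← ENNReal.rpow_mul, one_div_mul_cancel hrpos.ne', ENNReal.rpow_one]
    calc ∫⁻ x, ‖∫⁻ y, f (Φ (x, y)) ∂P‖ₑ ^ r.toReal ∂μ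
        ≤ ∫⁻ x, ∫⁻ y, f (Φ (x, y)) ^ r.toReal ∂P ∂μ := lintegral_mono_ae hJ
      _ = ∫⁻ p, f (Φ p) ^ r.toReal ∂μ.prod P := (lintegral_prod _ (hfΦ.pow_const _)).symm
      _ = ∫⁻ z, f z ^ r.toReal ∂(μ.prod P).map Φ :=
          (lintegral_map' (hf'.pow_const _) hΦ.aemeasurable).symm
      _ ≤ ∫⁻ z, f z ^ r.toReal ∂(C • ν) := lintegral_mono' hC le_rfl
      _ = C * ∫⁻ z, ‖f z‖ₑ ^ r.toReal ∂ν := by simp [lintegral_smul_measure]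

/-- An inequality that holds up to errors tending to `0` in `L¹` holds almost everywhere. -/
theorem ae_le_of_ae_le_add_of_tendsto_zero {μ : Measure X} {A B : X → ℝ≥0∞} (hA : AEMeasurable A μ)
    (hB : AEMeasurable B μ) {R : ℕ → X → ℝ≥0∞} (h : ∀ n, ∀ᵐ x ∂μ, A x ≤ B x + R n x)
    (hR : Tendsto (fun n => ∫⁻ x, R n x ∂μ) atTop (𝓝 0)) : ∀ᵐ x ∂μ, A x ≤ B x := by
  have h0 : ∫⁻ x, (A x - B x) ∂μ = 0 := by
    refine le_antisymm (ge_of_tendsto hR (Eventually.of_forall fun n => ?_)) zero_le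
    refine lintegral_mono_ae ?_
    filter_upwards [h n] with x hx using tsub_le_iff_left.2 hx
  have h0 := (lintegral_eq_zero_iff' (f := fun x => A x - B x) (hA.sub hB)).1 h0
  filter_upwards [h0] with x hx using tsub_eq_zero_iff_le.1 hx

/-- A pointwise bound by an averaging operator survives limits: `u n → V` in `L¹(μ)`, while the
averaged functions satisfy `F n ≤ F + R n` with `R n → 0` in `L¹(ν)`. -/
theorem ae_enorm_le_lintegral_comp_of_tendsto {μ : Measure X} {P : Measure Y} {ν : Measure Z}
    [SFinite μ] [IsProbabilityMeasure P] {Φ : X × Y → Z} (hΦ : Measurable Φ) {C : ℝ≥0∞}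
    (hCt : C ≠ ⊤) (hC : (μ.prod P).map Φ ≤ C • ν) {u : ℕ → X → ℝ} {V : X → ℝ}
    (hV : AEMeasurable V μ)
    (huV : Tendsto (fun n => ∫⁻ x, ‖u n x - V x‖ₑ ∂μ) atTop (𝓝 0))
    {F : Z → ℝ≥0∞} {Fn R : ℕ → Z → ℝ≥0∞} (hF : AEMeasurable F ν) (hR : ∀ n, AEMeasurable (R n) ν)
    (hbound : ∀ n, ∀ᵐ x ∂μ, ‖u n x‖ₑ ≤ ∫⁻ y, Fn n (Φ (x, y)) ∂P)
    (hFR : ∀ n z, Fn n z ≤ F z + R n z)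
    (hR0 : Tendsto (fun n => ∫⁻ z, R n z ∂ν) atTop (𝓝 0)) :
    ∀ᵐ x ∂μ, ‖V x‖ₑ ≤ ∫⁻ y, F (Φ (x, y)) ∂P := by
  have hac : (μ.prod P).map Φ ≪ ν :=
    (Measure.absolutelyContinuous_of_le hC).trans Measure.smul_absolutelyContinuous
  have hm : ∀ f : Z → ℝ≥0∞, AEMeasurable f ν → AEMeasurable (fun p => f (Φ p)) (μ.prod P) :=
    fun f hf => (hf.mono_ac hac).comp_measurable hΦ
  refine ae_le_of_ae_le_add_of_tendsto_zero hV.enorm (hm F hF).lintegral_prod_right'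
    (R := fun n x => (∫⁻ y, R n (Φ (x, y)) ∂P) + ‖u n x - V x‖ₑ) (fun n => ?_) ?_
  · have hsec : ∀ᵐ x ∂μ, AEMeasurable (fun y => F (Φ (x, y))) P := by
      filter_upwards [(hm F hF).aestronglyMeasurable.prodMk_left] with x hx using hx.aemeasurable
    filter_upwards [hbound n, hsec] with x hx hx'
    calc ‖V x‖ₑ = ‖u n x - (u n x - V x)‖ₑ := by simp
      _ ≤ ‖u n x‖ₑ + ‖u n x - V x‖ₑ := enorm_sub_le
      _ ≤ (∫⁻ y, (F (Φ (x, y)) + R n (Φ (x, y))) ∂P) + ‖u n x - V x‖ₑ := by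
          gcongr; exact hx.trans (lintegral_mono fun y => hFR n _)
      _ = _ := by rw [lintegral_add_left' hx', add_assoc]
  · have h1 : ∀ n, ∫⁻ x, ((∫⁻ y, R n (Φ (x, y)) ∂P) + ‖u n x - V x‖ₑ) ∂μ ≤
        C * (∫⁻ z, R n z ∂ν) + ∫⁻ x, ‖u n x - V x‖ₑ ∂μ := fun n => by
      rw [lintegral_add_left' (hm _ (hR n)).lintegral_prod_right']
      gcongr
      have := eLpNorm_lintegral_comp_le hΦ hC (hR n) le_rfl
      simpa [eLpNorm_one_eq_lintegral_enorm] using this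
    refine tendsto_of_tendsto_of_tendsto_of_le_of_le tendsto_const_nhds ?_ (fun _ => zero_le) h1
    simpa using (ENNReal.Tendsto.const_mul hR0 (Or.inr hCt)).add huV

end Averaging

/-! ### Simplices and barycentric coordinates -/


/-- `T` is the vertex set of a nondegenerate `d`-simplex. -/
def IsSimplex (T : Finset (E d)) : Prop :=
  T.card = d + 1 ∧ AffineIndependent ℝ ((↑) : T → E d)

theorem affineMap_sum_smul {V : Type*} [AddCommGroup V] [Module ℝ V] (A : V →ᵃ[ℝ] ℝ)
    (s : Finset V) (w : V → ℝ) (hw : ∑ z ∈ s, w z = 1) :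
    A (∑ z ∈ s, w z • z) = ∑ z ∈ s, w z * A z := by
  have h : ∀ y, A y = A.linear y + A 0 := fun y => by
    simpa using A.map_vadd 0 y
  rw [h, map_sum]
  simp_rw [map_smul, smul_eq_mul]
  calc ∑ z ∈ s, w z * A.linear z + A 0 = ∑ z ∈ s, w z * A.linear z + (∑ z ∈ s, w z) * A 0 := by
        rw [hw, one_mul]
    _ = ∑ z ∈ s, w z * A z := by
        rw [Finset.sum_mul, ← Finset.sum_add_distrib]
        exact Finset.sum_congr rfl fun z _ => by rw [h z]; ring

theorem convex_hull' (T : Finset (E d)) : Convex ℝ (hull T) := convex_convexHull ℝ _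

theorem isCompact_hull (T : Finset (E d)) : IsCompact (hull T) :=
  T.finite_toSet.isCompact_convexHull ℝ

theorem isClosed_hull (T : Finset (E d)) : IsClosed (hull T) := (isCompact_hull T).isClosed

theorem measurableSet_hull (T : Finset (E d)) : MeasurableSet (hull T) :=
  (isClosed_hull T).measurableSet

theorem subset_hull (T : Finset (E d)) {z : E d} (hz : z ∈ T) : z ∈ hull T :=
  subset_convexHull ℝ _ hz

theorem hull_mono {S T : Finset (E d)} (h : S ⊆ T) : hull S ⊆ hull T :=
  convexHull_mono (by exact_mod_cast h)

theorem volume_hull_lt_top (T : Finset (E d)) : volume (hull T) < ⊤ :=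
  (isCompact_hull T).measure_lt_top

theorem mem_hull_iff_exists {S : Finset (E d)} {y : E d} :
    y ∈ hull S ↔ ∃ w : E d → ℝ, (∀ z ∈ S, 0 ≤ w z) ∧ ∑ z ∈ S, w z = 1 ∧ ∑ z ∈ S, w z • z = y :=
  Finset.mem_convexHull'

/-- At most `d` points do not affinely span the space. -/
theorem affineSpan_ne_top_of_card_le {S : Finset (E d)} (hS : S.card ≤ d) :
    affineSpan ℝ (S : Set (E d)) ≠ ⊤ := by
  intro h
  have h1 : Module.finrank ℝ (vectorSpan ℝ (S : Set (E d))) = d := by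
    rw [← direction_affineSpan, h, AffineSubspace.direction_top]; simp
  rcases S.eq_empty_or_nonempty with rfl | hne
  · simp at h
  · obtain ⟨m, hm⟩ : ∃ m, S.card = m + 1 := ⟨S.card - 1, by have := hne.card_pos; omega⟩
    have := finrank_vectorSpan_image_finset_le ℝ (id : E d → E d) S (n := m) hm
    have h2 : Module.finrank ℝ (vectorSpan ℝ (S : Set (E d))) ≤ m := by rwa [Finset.image_id] at this
    omega

theorem volume_hull_eq_zero_of_card_le {S : Finset (E d)} (hS : S.card ≤ d) :
    volume (hull S) = 0 :=
  measure_mono_null (convexHull_subset_affineSpan _)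
    (Measure.addHaar_affineSubspace _ _ (affineSpan_ne_top_of_card_le hS))

namespace IsSimplex

variable {T : Finset (E d)} (hT : IsSimplex T)
include hT

/-- The vertices of a simplex as an affine basis. -/
def basis : AffineBasis T ℝ (E d) where
  toFun := (↑)
  ind' := hT.2
  tot' := by
    have := hT.2.affineSpan_eq_top_iff_card_eq_finrank_add_one
    rw [this]
    simp [hT.1]

open scoped Classical in
/-- The barycentric coordinate belonging to the vertex `z` (zero if `z` is not a vertex). -/
def coord (z : E d) : E d →ᵃ[ℝ] ℝ := if hz : z ∈ T then hT.basis.coord ⟨z, hz⟩ else 0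

theorem coord_of_mem {z : E d} (hz : z ∈ T) : hT.coord z = hT.basis.coord ⟨z, hz⟩ := by
  simp [coord, hz]

theorem coord_of_notMem {z : E d} (hz : z ∉ T) : hT.coord z = 0 := by
  simp [coord, hz]

theorem coord_self {z : E d} (hz : z ∈ T) : hT.coord z z = 1 := by
  rw [hT.coord_of_mem hz]
  exact hT.basis.coord_apply_eq ⟨z, hz⟩

theorem coord_ne {z z' : E d} (hz' : z' ∈ T) (h : z ≠ z') : hT.coord z z' = 0 := by
  by_cases hz : z ∈ T
  · rw [hT.coord_of_mem hz]
    exact hT.basis.coord_apply_ne (i := ⟨z, hz⟩) (j := ⟨z', hz'⟩) (by simpa using h)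
  · simp [hT.coord_of_notMem hz]

theorem sum_coord (y : E d) : ∑ z ∈ T, hT.coord z y = 1 := by
  rw [← hT.basis.sum_coord_apply_eq_one y, ← Finset.sum_coe_sort]
  exact Finset.sum_congr rfl fun z _ => by rw [hT.coord_of_mem z.2]

theorem sum_coord_smul (y : E d) : ∑ z ∈ T, hT.coord z y • z = y := by
  conv_rhs => rw [← hT.basis.linear_combination_coord_eq_self y]
  rw [← Finset.sum_coe_sort]
  exact Finset.sum_congr rfl fun z _ => by rw [hT.coord_of_mem z.2]; rfl

theorem range_basis : Set.range hT.basis = (T : Set (E d)) := by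
  ext z
  exact ⟨fun ⟨i, hi⟩ => hi ▸ i.2, fun hz => ⟨⟨z, hz⟩, rfl⟩⟩

theorem mem_hull_iff {y : E d} : y ∈ hull T ↔ ∀ z ∈ T, 0 ≤ hT.coord z y := by
  rw [hull, ← hT.range_basis, AffineBasis.convexHull_eq_nonneg_coord]
  refine ⟨fun h z hz => by rw [hT.coord_of_mem hz]; exact h _, fun h i => ?_⟩
  rw [← hT.coord_of_mem]; exact h _ i.2

theorem mem_interior_hull_iff {y : E d} : y ∈ interior (hull T) ↔ ∀ z ∈ T, 0 < hT.coord z y := by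
  rw [hull, ← hT.range_basis, AffineBasis.interior_convexHull]
  refine ⟨fun h z hz => by rw [hT.coord_of_mem hz]; exact h _, fun h i => ?_⟩
  rw [← hT.coord_of_mem]; exact h _ i.2

theorem coord_nonneg {y : E d} (hy : y ∈ hull T) (z : E d) : 0 ≤ hT.coord z y := by
  by_cases hz : z ∈ T
  · exact hT.mem_hull_iff.1 hy z hz
  · simp [hT.coord_of_notMem hz]

theorem coord_le_one {y : E d} (hy : y ∈ hull T) (z : E d) : hT.coord z y ≤ 1 := by
  by_cases hz : z ∈ T
  · rw [← hT.sum_coord y]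
    exact Finset.single_le_sum (f := fun z => hT.coord z y) (fun z _ => hT.coord_nonneg hy z) hz
  · simp [hT.coord_of_notMem hz]

/-- Uniqueness of barycentric coordinates. -/
theorem coord_eq_of_sum {y : E d} {w : E d → ℝ} (h1 : ∑ z ∈ T, w z = 1)
    (h2 : ∑ z ∈ T, w z • z = y) {z : E d} (hz : z ∈ T) : hT.coord z y = w z := by
  rw [← h2, affineMap_sum_smul _ _ _ h1, Finset.sum_eq_single z]
  · rw [hT.coord_self hz, mul_one]
  · intro z' hz' hne
    rw [hT.coord_ne hz' hne.symm, mul_zero]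
  · exact fun h => (h hz).elim

theorem eq_coord_of_isBarycentric {y : E d} {w : E d → ℝ} (hw : IsBarycentric T y w) (z : E d) :
    w z = hT.coord z y := by
  by_cases hz : z ∈ T
  · exact (hT.coord_eq_of_sum hw.2.2.1 hw.2.2.2 hz).symm
  · rw [hw.2.1 z hz, hT.coord_of_notMem hz]; rfl

theorem isBarycentric_coord {y : E d} (hy : y ∈ hull T) :
    IsBarycentric T y (fun z => hT.coord z y) :=
  ⟨fun z _ => hT.coord_nonneg hy z, fun z hz => by simp [hT.coord_of_notMem hz], hT.sum_coord y,
    hT.sum_coord_smul y⟩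

/-- The convex hull of some of the vertices is the part of the simplex where the barycentric
coordinates of the other vertices vanish. -/
theorem mem_hull_subset_iff {S : Finset (E d)} (hS : S ⊆ T) {y : E d} :
    y ∈ hull S ↔ y ∈ hull T ∧ ∀ z, z ∉ S → hT.coord z y = 0 := by
  classical
  constructor
  · refine fun h => ⟨hull_mono hS h, fun z hz => ?_⟩
    obtain ⟨w, hw0, hw1, hw2⟩ := mem_hull_iff_exists.1 h
    rw [← hw2, affineMap_sum_smul _ _ _ hw1]
    exact Finset.sum_eq_zero fun z' hz' => by
      rw [hT.coord_ne (hS hz') (by rintro rfl; exact hz hz'), mul_zero]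
  · rintro ⟨h, h0⟩
    refine mem_hull_iff_exists.2 ⟨fun z => hT.coord z y, fun z _ => hT.coord_nonneg h z, ?_, ?_⟩
    · rw [← hT.sum_coord y]
      exact Finset.sum_subset hS fun z _ hz => h0 z hz
    · conv_rhs => rw [← hT.sum_coord_smul y]
      exact Finset.sum_subset hS fun z _ hz => by simp [h0 z hz]

theorem nonempty : T.Nonempty := Finset.card_pos.1 (by rw [hT.1]; omega)

theorem interior_nonempty : (interior (hull T)).Nonempty := by
  have := hT.basis.centroid_mem_interior_convexHull
  rw [hT.range_basis] at this
  exact ⟨_, this⟩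

theorem closure_interior : closure (interior (hull T)) = hull T :=
  (convex_hull' T).closure_interior_eq_closure_of_nonempty_interior hT.interior_nonempty
    |>.trans (isClosed_hull T).closure_eq

theorem volume_pos : 0 < volume (hull T) :=
  (isOpen_interior.measure_pos _ hT.interior_nonempty).trans_le (measure_mono interior_subset)

theorem volume_toReal_pos : 0 < (volume (hull T)).toReal :=
  ENNReal.toReal_pos hT.volume_pos.ne' (volume_hull_lt_top T).ne

theorem hElem_pos : 0 < hElem T := Real.rpow_pos_of_pos hT.volume_toReal_pos _

end IsSimplex

theorem hElem_pow {T : Finset (E d)} (hd : d ≠ 0) : hElem T ^ d = (volume (hull T)).toReal := by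
  rw [hElem, ← Real.rpow_natCast, ← Real.rpow_mul ENNReal.toReal_nonneg,
    one_div_mul_cancel (by exact_mod_cast hd), Real.rpow_one]

/-! ### Approximation of Sobolev functions by smooth functions on star-shaped sets -/

open scoped Convolution
open ContinuousLinearMap (lsmul)

section Mollification

variable {F : Type*} [NormedAddCommGroup F] [NormedSpace ℝ F]

theorem lintegral_comp_smul_add {f : E d → ℝ≥0∞} (hf : AEMeasurable f volume) {l : ℝ}
    (hl : 1 / 2 ≤ l) (c : E d) :
    ∫⁻ x, f (l • x + c) ≤ 2 ^ d * ∫⁻ x, f x := by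
  have hl0 : l ≠ 0 := by linarith
  have h1 : Measure.map (fun x : E d => l • x) volume = ENNReal.ofReal |(l ^ d)⁻¹| • volume := by
    have := Measure.map_addHaar_smul (volume : Measure (E d)) hl0
    simpa using this
  have hc : Measure.QuasiMeasurePreserving (fun x : E d => x + c) volume volume :=
    (measurePreserving_add_right volume c).quasiMeasurePreserving
  have hfc : AEMeasurable (fun x => f (x + c)) volume := hf.comp_quasiMeasurePreserving hc
  calc ∫⁻ x, f (l • x + c) = ∫⁻ x, f (x + c) ∂(Measure.map (fun x : E d => l • x) volume) := by
        rw [lintegral_map' _ (by fun_prop)]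
        rw [h1]
        exact hfc.mono_ac Measure.smul_absolutelyContinuous
    _ = ENNReal.ofReal |(l ^ d)⁻¹| * ∫⁻ x, f x := by
        rw [h1, lintegral_smul_measure, lintegral_add_right_eq_self, smul_eq_mul]
    _ ≤ 2 ^ d * ∫⁻ x, f x := by
        gcongr
        rw [show (2 : ℝ≥0∞) ^ d = ENNReal.ofReal (2 ^ d) by
          rw [ENNReal.ofReal_pow (by norm_num)]; simp]
        refine ENNReal.ofReal_le_ofReal ?_
        rw [abs_of_nonneg (by positivity), ← inv_pow]
        gcongr
        rw [inv_le_comm₀ (by linarith) (by norm_num)]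
        linarith

/-- Mollification followed by a dilation is bounded in `L¹`. -/
theorem lintegral_convolution_comp_le (ψ : ContDiffBump (0 : E d)) {q : E d → F}
    (hq : AEStronglyMeasurable q volume) (b : E d) {l : ℝ} (hl : 1 / 2 ≤ l) :
    ∫⁻ x, ‖(ψ.normed volume ⋆[lsmul ℝ ℝ, volume] q) (b + l • (x - b))‖ₑ ≤
      2 ^ d * ∫⁻ x, ‖q x‖ₑ := by
  have hmp : Measure.QuasiMeasurePreserving
      (fun p : E d × E d => b + l • (p.1 - b) - p.2) (volume.prod volume) volume := by
    have h1 : Measure.QuasiMeasurePreserving (fun x : E d => l • x) volume volume := by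
      refine ⟨by fun_prop, ?_⟩
      rw [Measure.map_addHaar_smul volume (by linarith : l ≠ 0)]
      exact Measure.smul_absolutelyContinuous
    have h2 : Measure.QuasiMeasurePreserving (fun x : E d => b + l • (x - b)) volume volume := by
      have e : (fun x : E d => b + l • (x - b)) = fun x => l • x + (b - l • b) := by
        funext x; rw [smul_sub]; abel
      rw [e]
      exact ((measurePreserving_add_right volume _).quasiMeasurePreserving).comp h1
    refine ⟨by fun_prop, ?_⟩
    refine Measure.AbsolutelyContinuous.mk fun s hs h0 => ?_
    rw [Measure.map_apply (by fun_prop) hs]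
    refine (Measure.measure_prod_null (hs.preimage (by fun_prop))).2 ?_
    refine Eventually.of_forall fun x => ?_
    exact (Measure.measurePreserving_sub_left volume (b + l • (x - b))).measure_preimage hs.nullMeasurableSet
      |>.trans h0
  have hqm : AEMeasurable (fun p : E d × E d => ‖q (b + l • (p.1 - b) - p.2)‖ₑ)
      (volume.prod volume) := (hq.comp_quasiMeasurePreserving hmp).enorm
  have hψm : Measurable fun t : E d => ‖ψ.normed volume t‖ₑ :=
    (ψ.continuous_normed).measurable.enorm
  calc ∫⁻ x, ‖(ψ.normed volume ⋆[lsmul ℝ ℝ, volume] q) (b + l • (x - b))‖ₑ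
      ≤ ∫⁻ x, ∫⁻ t, ‖ψ.normed volume t‖ₑ * ‖q (b + l • (x - b) - t)‖ₑ := by
        refine lintegral_mono fun x => ?_
        rw [convolution_def]
        refine (enorm_integral_le_lintegral_enorm _).trans (lintegral_mono fun t => ?_)
        simp [enorm_smul]
    _ = ∫⁻ t, ∫⁻ x, ‖ψ.normed volume t‖ₑ * ‖q (b + l • (x - b) - t)‖ₑ := by
        refine lintegral_lintegral_swap ?_
        exact (hψm.comp measurable_snd).aemeasurable.mul hqm
    _ ≤ ∫⁻ t, ‖ψ.normed volume t‖ₑ * (2 ^ d * ∫⁻ x, ‖q x‖ₑ) := by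
        refine lintegral_mono fun t => ?_
        rw [lintegral_const_mul' _ _ (by simp)]
        gcongr
        have := lintegral_comp_smul_add hq.enorm hl (b - l • b - t)
        refine le_of_eq_of_le ?_ this
        refine lintegral_congr fun x => ?_
        congr 3
        rw [smul_sub]; abel
    _ = 2 ^ d * ∫⁻ x, ‖q x‖ₑ := by
        rw [lintegral_mul_const _ hψm]
        have : ∫⁻ t, ‖ψ.normed volume t‖ₑ = 1 := by
          have h := ψ.integral_normed (μ := (volume : Measure (E d)))
          rw [integral_eq_lintegral_of_nonneg_ae
            (Eventually.of_forall fun x => ψ.nonneg_normed x)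
            ψ.continuous_normed.aestronglyMeasurable] at h
          rw [← ENNReal.toReal_eq_one_iff, ← h]
          congr 1
          refine lintegral_congr fun x => ?_
          rw [Real.enorm_eq_ofReal (ψ.nonneg_normed x)]
        rw [this, one_mul]

/-- Mollification followed by a dilation with centre `b` tends to the identity in `L¹(K)` when the
radius of the mollifier tends to `0` and the dilation factor to `1`. -/
theorem exists_convolution_comp_close [CompleteSpace F] {K : Set (E d)} (hK : IsCompact K) (b : E d)
    {f : E d → F} (hf : Integrable f volume) {ε : ℝ≥0∞} (hε : ε ≠ 0) :
    ∃ l₀ < (1 : ℝ), 1 / 2 ≤ l₀ ∧ ∃ δ₀ > (0 : ℝ), ∀ l, l₀ ≤ l → l < 1 → ∀ ψ : ContDiffBump (0 : E d),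
      ψ.rOut ≤ δ₀ →
      ∫⁻ x in K, ‖(ψ.normed volume ⋆[lsmul ℝ ℝ, volume] f) (b + l • (x - b)) - f x‖ₑ ≤ ε := by
  wlog hεt : ε ≠ ⊤
  · obtain rfl : ε = ⊤ := not_not.1 hεt
    exact ⟨1 / 2, by norm_num, le_rfl, 1, one_pos, by simp⟩
  obtain ⟨e, he, heε⟩ : ∃ e : ℝ≥0∞, e ≠ 0 ∧ 2 ^ d * e + (e + e) ≤ ε := by
    refine ⟨ε / (2 ^ d + 2), ENNReal.div_ne_zero.2 ⟨hε, by simp⟩, le_of_eq ?_⟩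
    rw [← two_mul, ← add_mul, ENNReal.mul_div_cancel (by simp) (by simp)]
  obtain ⟨W, hWs, hWf, hWc, hWm⟩ := (memLp_one_iff_integrable.2 hf).exists_hasCompactSupport_eLpNorm_sub_le
    ENNReal.one_ne_top he
  rw [eLpNorm_one_eq_lintegral_enorm] at hWf
  obtain ⟨s, hs, hsK⟩ : ∃ s : ℝ, 0 < s ∧ ENNReal.ofReal s * volume K ≤ e := by
    obtain ⟨s, hs, h⟩ := ENNReal.exists_nnreal_pos_mul_lt (a := volume K) hK.measure_lt_top.ne he
    exact ⟨s, by simpa using hs, by simpa using h.le⟩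
  have huc : UniformContinuous W := hWs.uniformContinuous_of_continuous hWc
  obtain ⟨δ, hδ, hδW⟩ := Metric.uniformContinuous_iff.1 huc s hs
  obtain ⟨M, hM⟩ := hK.isBounded.subset_closedBall b
  have hM' : ∀ x ∈ K, ‖x - b‖ ≤ max M 1 := fun x hx => by
    have := hM hx
    rw [Metric.mem_closedBall, dist_eq_norm] at this
    exact this.trans (le_max_left _ _)
  set N := max M 1 with hN
  have hN1 : 1 ≤ N := le_max_right _ _
  refine ⟨max (1 / 2) (1 - δ / (4 * N)), max_lt (by norm_num) (by
      have : 0 < δ / (4 * N) := by positivity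
      linarith), le_max_left _ _, δ / 2, by positivity, fun l hl hl1 ψ hψ => ?_⟩
  have hl2 : 1 / 2 ≤ l := (le_max_left _ _).trans hl
  have hlδ : (1 - l) * N ≤ δ / 4 := by
    have h1 : 1 - δ / (4 * N) ≤ l := (le_max_right _ _).trans hl
    have h2 : 1 - l ≤ δ / (4 * N) := by linarith
    calc (1 - l) * N ≤ δ / (4 * N) * N := by gcongr
      _ = δ / 4 := by field_simp
  have hWi : Integrable W volume := memLp_one_iff_integrable.1 hWm
  have hqi : Integrable (f - W) volume := hf.sub hWi
  have hpt : ∀ x ∈ K, ‖(ψ.normed volume ⋆[lsmul ℝ ℝ, volume] f) (b + l • (x - b)) - f x‖ₑ ≤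
      ‖(ψ.normed volume ⋆[lsmul ℝ ℝ, volume] (f - W)) (b + l • (x - b))‖ₑ +
        (ENNReal.ofReal s + ‖(f - W) x‖ₑ) := fun x hx => by
    set z := b + l • (x - b) with hz
    have hex : ∀ h : E d → F, Integrable h volume →
        ConvolutionExistsAt (ψ.normed volume) h z (lsmul ℝ ℝ) volume := fun h hh =>
      (ψ.hasCompactSupport_normed (μ := volume)).convolutionExists_left _ ψ.continuous_normed
        hh.locallyIntegrable z
    have hsplit : (ψ.normed volume ⋆[lsmul ℝ ℝ, volume] f) z =
        (ψ.normed volume ⋆[lsmul ℝ ℝ, volume] (f - W)) z +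
        (ψ.normed volume ⋆[lsmul ℝ ℝ, volume] W) z := by
      rw [← ConvolutionExistsAt.distrib_add (hex _ hqi) (hex _ hWi), sub_add_cancel]
    have hclose : dist ((ψ.normed volume ⋆[lsmul ℝ ℝ, volume] W) z) (W x) ≤ s := by
      refine dist_convolution_le hs.le (R := ψ.rOut) ψ.support_normed_eq.subset ψ.nonneg_normed
        ψ.integral_normed hWc.aestronglyMeasurable fun y hy => (hδW ?_).le
      have h1 : dist z x ≤ δ / 4 := by
        rw [dist_eq_norm, show z - x = -((1 - l) • (x - b)) by
          rw [hz, sub_smul, one_smul]; abel, norm_neg, norm_smul, Real.norm_eq_abs,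
          abs_of_pos (by linarith)]
        refine le_trans ?_ hlδ
        gcongr
        exact hM' x hx
      calc dist y x ≤ dist y z + dist z x := dist_triangle _ _ _
        _ < δ := by have := Metric.mem_ball.1 hy; linarith
    rw [hsplit]
    calc _ = ‖(ψ.normed volume ⋆[lsmul ℝ ℝ, volume] (f - W)) z +
          (((ψ.normed volume ⋆[lsmul ℝ ℝ, volume] W) z - W x) - (f - W) x)‖ₑ := by
          congr 1; simp only [Pi.sub_apply]; abel
      _ ≤ _ := by
          refine (enorm_add_le _ _).trans ?_
          gcongr
          refine enorm_sub_le.trans ?_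
          gcongr
          rw [← ofReal_norm, ← dist_eq_norm]
          exact ENNReal.ofReal_le_ofReal hclose
  calc ∫⁻ x in K, ‖(ψ.normed volume ⋆[lsmul ℝ ℝ, volume] f) (b + l • (x - b)) - f x‖ₑ
      ≤ ∫⁻ x in K, (‖(ψ.normed volume ⋆[lsmul ℝ ℝ, volume] (f - W)) (b + l • (x - b))‖ₑ +
        (ENNReal.ofReal s + ‖(f - W) x‖ₑ)) := by
        refine setLIntegral_mono' hK.measurableSet hpt
    _ = (∫⁻ x in K, ‖(ψ.normed volume ⋆[lsmul ℝ ℝ, volume] (f - W)) (b + l • (x - b))‖ₑ) +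
        (ENNReal.ofReal s * volume K + ∫⁻ x in K, ‖(f - W) x‖ₑ) := by
        rw [lintegral_add_right' _
          (by exact (aemeasurable_const.add hqi.aestronglyMeasurable.enorm.restrict)),
          lintegral_add_left measurable_const]
        simp
    _ ≤ 2 ^ d * e + (e + e) := by
        gcongr
        · refine (setLIntegral_le_lintegral _ _).trans
            ((lintegral_convolution_comp_le ψ hqi.aestronglyMeasurable b hl2).trans ?_)
          gcongr
        · exact (setLIntegral_le_lintegral _ _).trans hWf
    _ ≤ ε := heε

theorem gradient_apply_eq_fderiv (u : E d → ℝ) (x : E d) (i : Fin d) :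
    gradient u x i = fderiv ℝ u x (EuclideanSpace.single i 1) := by
  have : inner ℝ (gradient u x) (EuclideanSpace.single i (1 : ℝ)) =
      fderiv ℝ u x (EuclideanSpace.single i 1) := by
    rw [gradient, InnerProductSpace.toDual_symm_apply]
  rw [← this, EuclideanSpace.inner_single_right]
  simp

theorem gradient_eq_of_forall_fderiv {u : E d → ℝ} {x g : E d}
    (h : ∀ i, fderiv ℝ u x (EuclideanSpace.single i 1) = g i) : gradient u x = g := by
  ext i
  rw [gradient_apply_eq_fderiv, h]

/-- At points whose distance from the complement of the open set `O` exceeds the radius of the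
mollifier, the gradient of the mollification is the mollification of the weak gradient. -/
theorem fderiv_convolution_eq {O : Set (E d)} (hO : IsOpen O) {v : E d → ℝ} {g : E d → E d}
    (hv : IntegrableOn v O) (hg : IntegrableOn g O) (hw : HasWeakGradient O v g)
    (ψ : ContDiffBump (0 : E d)) {z : E d} (hz : Metric.closedBall z ψ.rOut ⊆ O) (i : Fin d) :
    fderiv ℝ (ψ.normed volume ⋆[lsmul ℝ ℝ, volume] (O.indicator v)) z (EuclideanSpace.single i 1) =
      (ψ.normed volume ⋆[lsmul ℝ ℝ, volume] (O.indicator g)) z i := by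
  have hV : Integrable (O.indicator v) volume := (integrable_indicator_iff hO.measurableSet).2 hv
  have hG : Integrable (O.indicator g) volume := (integrable_indicator_iff hO.measurableSet).2 hg
  have hcs := ψ.hasCompactSupport_normed (μ := (volume : Measure (E d)))
  have hψ1 : ContDiff ℝ 1 (ψ.normed volume) := ψ.contDiff_normed
  have hfd := (hcs.hasFDerivAt_convolution_left (lsmul ℝ ℝ) hψ1 hV.locallyIntegrable z).fderiv
  set φ : E d → ℝ := fun w => ψ.normed volume (z - w) with hφ
  have hφd : ∀ w, fderiv ℝ φ w (EuclideanSpace.single i 1) =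
      -fderiv ℝ (ψ.normed volume) (z - w) (EuclideanSpace.single i 1) := fun w => by
    have h1 : HasFDerivAt φ ((fderiv ℝ (ψ.normed volume) (z - w)).comp
        (-ContinuousLinearMap.id ℝ (E d))) w := by
      refine HasFDerivAt.comp w
        ((hψ1.differentiable one_ne_zero) (z - w)).hasFDerivAt ?_
      exact (hasFDerivAt_id w).const_sub z
    rw [h1.fderiv]; simp
  have hsupp : tsupport φ ⊆ Metric.closedBall z ψ.rOut := by
    refine closure_minimal (fun w hw' => ?_) Metric.isClosed_closedBall
    have : z - w ∈ Function.support (ψ.normed volume) := hw'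
    rw [ψ.support_normed_eq, mem_ball_zero_iff] at this
    rw [Metric.mem_closedBall, dist_comm, dist_eq_norm]
    exact this.le
  have hφc : HasCompactSupport φ :=
    HasCompactSupport.of_support_subset_isCompact (isCompact_closedBall z ψ.rOut)
      ((subset_tsupport _).trans hsupp)
  have hφs : ContDiff ℝ ∞ φ := ψ.contDiff_normed.comp (contDiff_const.sub contDiff_id)
  have key := hw φ hφs hφc (hsupp.trans hz) i
  have hint : Integrable (fun t => (ContinuousLinearMap.precompL (E d) (lsmul ℝ ℝ))
      (fderiv ℝ (ψ.normed volume) t) (O.indicator v (z - t))) volume :=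
    (hcs.fderiv (𝕜 := ℝ)).convolutionExists_left _ (hψ1.continuous_fderiv one_ne_zero)
      hV.locallyIntegrable z
  have hintG : Integrable (fun t => (lsmul ℝ ℝ) (ψ.normed volume t) (O.indicator g (z - t)))
      volume :=
    hcs.convolutionExists_left _ ψ.continuous_normed hG.locallyIntegrable z
  calc fderiv ℝ (ψ.normed volume ⋆[lsmul ℝ ℝ, volume] (O.indicator v)) z
        (EuclideanSpace.single i 1)
      = ∫ t, fderiv ℝ (ψ.normed volume) t (EuclideanSpace.single i 1) *
          O.indicator v (z - t) := by
        rw [hfd, convolution_def, ContinuousLinearMap.integral_apply hint]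
        refine integral_congr_ae (Eventually.of_forall fun t => ?_)
        simp [ContinuousLinearMap.precompL_apply]
    _ = ∫ w, fderiv ℝ (ψ.normed volume) (z - w) (EuclideanSpace.single i 1) *
          O.indicator v w := by
        rw [← integral_sub_left_eq_self _ volume z]
        simp
    _ = -∫ w in O, v w * fderiv ℝ φ w (EuclideanSpace.single i 1) := by
        rw [← integral_neg, ← integral_indicator hO.measurableSet]
        refine integral_congr_ae (Eventually.of_forall fun w => ?_)
        by_cases hwO : w ∈ O
        · simp only [Set.indicator_of_mem hwO, hφd]; ring
        · simp [Set.indicator_of_notMem hwO]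
    _ = ∫ w in O, g w i * φ w := by rw [key, neg_neg]
    _ = ∫ t, ψ.normed volume t * (O.indicator g (z - t)) i := by
        rw [← integral_indicator hO.measurableSet, ← integral_sub_left_eq_self _ volume z]
        refine integral_congr_ae (Eventually.of_forall fun t => ?_)
        by_cases ht : z - t ∈ O
        · simp only [Set.indicator_of_mem ht, hφ]; rw [sub_sub_cancel]; ring
        · simp [Set.indicator_of_notMem ht]
    _ = (ψ.normed volume ⋆[lsmul ℝ ℝ, volume] (O.indicator g)) z i := by
        rw [convolution_def]
        have := ((EuclideanSpace.proj i : E d →L[ℝ] ℝ)).integral_comp_comm hintG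
        simpa using this

end Mollification

/-- The functions `u n` are continuously differentiable on the whole space and converge to `v`,
together with their gradients (to `g`), in `L¹(K)`. -/
structure IsC1Approx (K : Set (E d)) (v : E d → ℝ) (g : E d → E d) (u : ℕ → E d → ℝ) : Prop where
  contDiff : ∀ n, ContDiff ℝ 1 (u n)
  tendsto : Tendsto (fun n => ∫⁻ x in K, ‖u n x - v x‖ₑ) atTop (𝓝 0)
  tendsto_gradient : Tendsto (fun n => ∫⁻ x in K, ‖gradient (u n) x - g x‖ₑ) atTop (𝓝 0)

theorem IsC1Approx.mono {K L : Set (E d)} {v : E d → ℝ} {g : E d → E d} {u : ℕ → E d → ℝ}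
    (h : IsC1Approx K v g u) (hL : L ⊆ K) : IsC1Approx L v g u where
  contDiff := h.contDiff
  tendsto := tendsto_of_tendsto_of_tendsto_of_le_of_le tendsto_const_nhds h.tendsto
    (fun _ => zero_le) fun _ => lintegral_mono_set hL
  tendsto_gradient := tendsto_of_tendsto_of_tendsto_of_le_of_le tendsto_const_nhds
    h.tendsto_gradient (fun _ => zero_le) fun _ => lintegral_mono_set hL

/-- Density of smooth functions in `W^{1,1}(K)` for a compact set `K` that is strictly star-shaped
with respect to a point `b`: mollify, and dilate by a factor `l < 1` such that the mollifier does not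
see the boundary of `K`. -/
theorem exists_isC1Approx {K : Set (E d)} (hK : IsCompact K) (hfr : volume (K \ interior K) = 0)
    {b : E d} (hstar : ∀ x ∈ K, ∀ l ∈ Set.Ioo (0 : ℝ) 1, b + l • (x - b) ∈ interior K)
    {v : E d → ℝ} {g : E d → E d} (hv : IntegrableOn v K) (hg : IntegrableOn g K)
    (hw : HasWeakGradient (interior K) v g) : ∃ u, IsC1Approx K v g u := by
  set O := interior K with hOdef
  have hO : IsOpen O := isOpen_interior
  have hOK : O ⊆ K := interior_subset
  have hvO := hv.mono_set hOK
  have hgO := hg.mono_set hOK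
  have hV : Integrable (O.indicator v) volume := (integrable_indicator_iff hO.measurableSet).2 hvO
  have hG : Integrable (O.indicator g) volume := (integrable_indicator_iff hO.measurableSet).2 hgO
  have haeO : ∀ᵐ x ∂volume.restrict K, x ∈ O := by
    rw [ae_restrict_iff' hK.measurableSet, ae_iff]
    refine measure_mono_null (fun x hx => ?_) hfr
    simpa using hx
  have main : ∀ n : ℕ, ∃ u : E d → ℝ, ContDiff ℝ 1 u ∧
      ∫⁻ x in K, ‖u x - v x‖ₑ ≤ ((n : ℝ≥0∞) + 1)⁻¹ ∧
      ∫⁻ x in K, ‖gradient u x - g x‖ₑ ≤ ((n : ℝ≥0∞) + 1)⁻¹ := by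
    intro n
    set ε := ((n : ℝ≥0∞) + 1)⁻¹ with hεdef
    have hε : ε ≠ 0 := by simp [hεdef]
    have hε2 : ε / 2 ≠ 0 := by simp [hε]
    obtain ⟨l₁, hl₁, hl₁', δ₁, hδ₁, H₁⟩ := exists_convolution_comp_close hK b hV hε
    obtain ⟨l₂, hl₂, hl₂', δ₂, hδ₂, H₂⟩ := exists_convolution_comp_close hK b hG hε2
    have hGt : ∫⁻ x, ‖O.indicator g x‖ₑ ≠ ⊤ := hG.2.ne
    obtain ⟨s, hs, hsG⟩ := ENNReal.exists_nnreal_pos_mul_lt hGt hε2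
    obtain ⟨l, hl, hl1⟩ : ∃ l, max (max l₁ l₂) (1 - s) < l ∧ l < 1 :=
      exists_between (max_lt (max_lt hl₁ hl₂) (by simpa using hs))
    simp only [max_lt_iff] at hl
    have hl0 : 0 < l := by linarith [hl.1.1]
    -- the dilated set is compactly contained in the interior
    have hc : IsCompact ((fun x => b + l • (x - b)) '' K) := hK.image (by fun_prop)
    have hsub : (fun x => b + l • (x - b)) '' K ⊆ O := by
      rintro _ ⟨x, hx, rfl⟩
      exact hstar x hx l ⟨hl0, hl1⟩
    obtain ⟨δ₃, hδ₃, hδO⟩ := hc.exists_cthickening_subset_open hO hsub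
    have hδ : 0 < min (min δ₁ δ₂) δ₃ := by positivity
    obtain ⟨ψ, hψ⟩ : ∃ ψ : ContDiffBump (0 : E d), ψ.rOut = min (min δ₁ δ₂) δ₃ :=
      ⟨⟨min (min δ₁ δ₂) δ₃ / 2, min (min δ₁ δ₂) δ₃, by positivity, by linarith⟩, rfl⟩
    have hball : ∀ x ∈ K, Metric.closedBall (b + l • (x - b)) ψ.rOut ⊆ O := by
      intro x hx
      have hmem : b + l • (x - b) ∈ (fun x => b + l • (x - b)) '' K := ⟨x, hx, rfl⟩
      have hle : ψ.rOut ≤ δ₃ := hψ.trans_le (min_le_right _ _)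
      exact (Metric.closedBall_subset_cthickening hmem ψ.rOut).trans
        ((Metric.cthickening_mono hle _).trans hδO)
    set U := (ψ.normed volume ⋆[lsmul ℝ ℝ, volume] (O.indicator v)) with hU
    have hUc : ContDiff ℝ 1 U :=
      (ψ.hasCompactSupport_normed (μ := volume)).contDiff_convolution_left _ ψ.contDiff_normed
        hV.locallyIntegrable
    refine ⟨fun x => U (b + l • (x - b)), hUc.comp (by fun_prop), ?_, ?_⟩
    · refine le_trans (le_of_eq (lintegral_congr_ae ?_)) (H₁ l hl.1.1.le hl1 ψ
        (by rw [hψ]; exact (min_le_left _ _).trans (min_le_left _ _)))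
      filter_upwards [haeO] with x hx
      rw [Set.indicator_of_mem hx]
    · have hgrad : ∀ x ∈ K, gradient (fun x => U (b + l • (x - b))) x =
          l • (ψ.normed volume ⋆[lsmul ℝ ℝ, volume] (O.indicator g)) (b + l • (x - b)) := by
        intro x hx
        refine gradient_eq_of_forall_fderiv fun i => ?_
        have hlin : HasFDerivAt (fun x : E d => b + l • (x - b))
            (l • ContinuousLinearMap.id ℝ (E d)) x :=
          (((hasFDerivAt_id x).sub_const b).const_smul l).const_add b
        have hUd : HasFDerivAt U (fderiv ℝ U (b + l • (x - b))) (b + l • (x - b)) :=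
          ((hUc.differentiable one_ne_zero) _).hasFDerivAt
        have := (hUd.comp x hlin).fderiv
        rw [show (fun x => U (b + l • (x - b))) = U ∘ fun x => b + l • (x - b) from rfl, this]
        simp only [ContinuousLinearMap.comp_apply, smul_apply,
          ContinuousLinearMap.id_apply, map_smul, smul_eq_mul, PiLp.smul_apply]
        rw [hU, fderiv_convolution_eq hO hvO hgO hw ψ (hball x hx) i]
      calc ∫⁻ x in K, ‖gradient (fun x => U (b + l • (x - b))) x - g x‖ₑ
          ≤ ∫⁻ x in K, (‖(ψ.normed volume ⋆[lsmul ℝ ℝ, volume] (O.indicator g)) (b + l • (x - b)) -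
              O.indicator g x‖ₑ + s * ‖O.indicator g x‖ₑ) := by
            refine lintegral_mono_ae ?_
            filter_upwards [haeO, ae_restrict_mem hK.measurableSet] with x hx hxK
            rw [hgrad x hxK]
            simp only [Set.indicator_of_mem hx]
            set A := (ψ.normed volume ⋆[lsmul ℝ ℝ, volume] (O.indicator g)) (b + l • (x - b))
            calc ‖l • A - g x‖ₑ = ‖l • (A - g x) - (1 - l) • g x‖ₑ := by
                  congr 1; rw [smul_sub, sub_smul, one_smul]; abel
              _ ≤ ‖l • (A - g x)‖ₑ + ‖(1 - l) • g x‖ₑ := enorm_sub_le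
              _ = ‖l‖ₑ * ‖A - g x‖ₑ + ‖1 - l‖ₑ * ‖g x‖ₑ := by rw [enorm_smul, enorm_smul]
              _ ≤ 1 * ‖A - g x‖ₑ + s * ‖g x‖ₑ := by
                  gcongr
                  · rw [Real.enorm_eq_ofReal hl0.le]
                    simpa using hl1.le
                  · rw [Real.enorm_eq_ofReal (by linarith), ENNReal.ofReal_le_iff_le_toReal (by simp)]
                    simp only [ENNReal.coe_toReal]; linarith [hl.2]
              _ = _ := by rw [one_mul]
        _ ≤ ε / 2 + ε / 2 := by
            rw [lintegral_add_right' _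
              (by exact (hG.aestronglyMeasurable.enorm.restrict.const_mul _))]
            gcongr
            · exact H₂ l hl.1.2.le hl1 ψ (by rw [hψ]; exact (min_le_left _ _).trans (min_le_right _ _))
            · rw [lintegral_const_mul' _ _ (by simp)]
              refine le_trans ?_ hsG.le
              gcongr
              exact Measure.restrict_le_self
        _ = ε := ENNReal.add_halves _
  choose u hu1 hu2 hu3 using main
  have h0 : Tendsto (fun n : ℕ => ((n : ℝ≥0∞) + 1)⁻¹) atTop (𝓝 0) := by
    have := (tendsto_add_atTop_iff_nat 1).2 ENNReal.tendsto_inv_nat_nhds_zero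
    simpa using this
  exact ⟨u, hu1,
    tendsto_of_tendsto_of_tendsto_of_le_of_le tendsto_const_nhds h0 (fun _ => zero_le) hu2,
    tendsto_of_tendsto_of_tendsto_of_le_of_le tendsto_const_nhds h0 (fun _ => zero_le) hu3⟩

/-! ### Averages and the Poincaré inequality on convex sets -/

theorem toReal_inv_nonneg (r : ℝ≥0∞) : 0 ≤ (r⁻¹).toReal := ENNReal.toReal_nonneg

theorem toReal_inv_le_one {r : ℝ≥0∞} (hr : 1 ≤ r) : (r⁻¹).toReal ≤ 1 := by
  have : r⁻¹ ≤ 1 := ENNReal.inv_le_one.2 hr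
  simpa using ENNReal.toReal_mono ENNReal.one_ne_top this

theorem eLpNorm_const_mul_enorm {X F : Type*} [MeasurableSpace X] {μ : Measure X}
    [NormedAddCommGroup F] [NormedSpace ℝ F] {D : ℝ≥0∞} (hD : D ≠ ⊤) (g : X → F) (r : ℝ≥0∞) :
    eLpNorm (fun z => D * ‖g z‖ₑ) r μ = D * eLpNorm g r μ := by
  have h := eLpNorm_const_smul (μ := μ) (p := r) D.toReal g
  rw [Real.enorm_eq_ofReal ENNReal.toReal_nonneg, ENNReal.ofReal_toReal hD] at h
  rw [← h]
  refine eLpNorm_congr_enorm_ae (Eventually.of_forall fun z => ?_)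
  simp [enorm_smul, Real.enorm_eq_ofReal ENNReal.toReal_nonneg, ENNReal.ofReal_toReal hD]

section Average

variable {X : Type*} [MeasurableSpace X] {μ : Measure X} {s : Set X}

theorem enorm_setAverage_le (f : X → ℝ) : ‖⨍ x in s, f x ∂μ‖ₑ ≤ (μ s)⁻¹ * ∫⁻ x in s, ‖f x‖ₑ ∂μ := by
  rw [setAverage_eq, enorm_smul]
  gcongr
  · rw [measureReal_def, Real.enorm_eq_ofReal (by positivity)]
    rcases eq_or_ne (μ s) 0 with h | h
    · simp [h]
    rcases eq_or_ne (μ s) ⊤ with h' | h'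
    · simp [h']
    rw [← ENNReal.toReal_inv, ENNReal.ofReal_toReal (ENNReal.inv_ne_top.2 h)]
  · exact enorm_integral_le_lintegral_enorm _

theorem setAverage_sub {f g : X → ℝ} (hf : IntegrableOn f s μ) (hg : IntegrableOn g s μ) :
    ⨍ x in s, (f x - g x) ∂μ = (⨍ x in s, f x ∂μ) - ⨍ x in s, g x ∂μ := by
  simp only [setAverage_eq]
  rw [integral_sub hf hg, smul_sub]

theorem setAverage_sub_const {f : X → ℝ} (hs : μ s ≠ 0) (hs' : μ s ≠ ⊤) (hf : IntegrableOn f s μ)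
    (c : ℝ) : ⨍ x in s, (f x - c) ∂μ = (⨍ x in s, f x ∂μ) - c := by
  rw [setAverage_sub hf (integrableOn_const hs'), setAverage_const hs hs']

/-- Hölder's inequality for the mean of a function. -/
theorem lintegral_enorm_le_eLpNorm {F : Type*} [NormedAddCommGroup F] {f : X → F}
    (hf : AEStronglyMeasurable f (μ.restrict s)) (hs : μ s ≠ 0) (hs' : μ s ≠ ⊤)
    {r : ℝ≥0∞} (hr : 1 ≤ r) :
    (μ s)⁻¹ * ∫⁻ x in s, ‖f x‖ₑ ∂μ ≤ (μ s) ^ (-(r⁻¹).toReal) * eLpNorm f r (μ.restrict s) := by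
  have h := eLpNorm_le_eLpNorm_mul_rpow_measure_univ hr hf
  rw [eLpNorm_one_eq_lintegral_enorm, Measure.restrict_apply_univ] at h
  calc (μ s)⁻¹ * ∫⁻ x in s, ‖f x‖ₑ ∂μ
      ≤ (μ s)⁻¹ * (eLpNorm f r (μ.restrict s) * μ s ^ (1 / (1 : ℝ≥0∞).toReal - 1 / r.toReal)) := by
        gcongr
    _ = ((μ s) ^ (-1 : ℝ) * μ s ^ (1 / (1 : ℝ≥0∞).toReal - 1 / r.toReal)) *
          eLpNorm f r (μ.restrict s) := by
        rw [ENNReal.rpow_neg_one]; ring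
    _ = _ := by
        rw [← ENNReal.rpow_add _ _ hs hs', ENNReal.toReal_inv]
        congr 2
        simp only [ENNReal.toReal_one, one_div, inv_one]
        ring

theorem enorm_setAverage_le_eLpNorm {f : X → ℝ}
    (hf : AEStronglyMeasurable f (μ.restrict s)) (hs : μ s ≠ 0) (hs' : μ s ≠ ⊤)
    {r : ℝ≥0∞} (hr : 1 ≤ r) :
    ‖⨍ x in s, f x ∂μ‖ₑ ≤ (μ s) ^ (-(r⁻¹).toReal) * eLpNorm f r (μ.restrict s) :=
  (enorm_setAverage_le f).trans (lintegral_enorm_le_eLpNorm hf hs hs' hr)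

end Average

theorem enorm_fderiv_apply_le (u : E d → ℝ) (x w : E d) :
    ‖fderiv ℝ u x w‖ₑ ≤ ‖w‖ₑ * ‖gradient u x‖ₑ := by
  have : fderiv ℝ u x w = inner ℝ (gradient u x) w := by
    rw [gradient, InnerProductSpace.toDual_symm_apply]
  rw [this, mul_comm, ← ofReal_norm, ← ofReal_norm, ← ofReal_norm,
    ← ENNReal.ofReal_mul (norm_nonneg _)]
  exact ENNReal.ofReal_le_ofReal (norm_inner_le_norm _ _)

theorem measurable_gradient (u : E d → ℝ) : Measurable (gradient u) :=
  ((InnerProductSpace.toDual ℝ (E d)).symm.continuous.measurable).comp (measurable_fderiv ℝ u)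

theorem continuous_gradient {u : E d → ℝ} (hu : ContDiff ℝ 1 u) : Continuous (gradient u) :=
  ((InnerProductSpace.toDual ℝ (E d)).symm.continuous).comp (hu.continuous_fderiv one_ne_zero)

/-- The fundamental theorem of calculus along a segment, as an estimate. -/
theorem enorm_sub_le_lintegral_gradient {u : E d → ℝ} (hu : ContDiff ℝ 1 u) (x w : E d) {s s' : ℝ}
    (hs : 0 ≤ s) (hss : s ≤ s') :
    ‖u x - u (x + s • w)‖ₑ ≤ ‖w‖ₑ * ∫⁻ t in Set.Icc 0 s', ‖gradient u (x + t • w)‖ₑ := by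
  have hderiv : ∀ t : ℝ, HasDerivAt (fun t : ℝ => u (x + t • w)) (fderiv ℝ u (x + t • w) w) t := by
    intro t
    have h1 : HasDerivAt (fun t : ℝ => x + t • w) w t := by
      simpa using ((hasDerivAt_id t).smul_const w).const_add x
    exact (((hu.differentiable one_ne_zero) _).hasFDerivAt).comp_hasDerivAt t h1
  have hcont : Continuous fun t : ℝ => fderiv ℝ u (x + t • w) w :=
    ((hu.continuous_fderiv one_ne_zero).comp (by fun_prop)).clm_apply continuous_const
  have hftc := intervalIntegral.integral_eq_sub_of_hasDerivAt (a := 0) (b := s)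
    (fun t _ => hderiv t) (hcont.intervalIntegrable _ _)
  simp only [zero_smul, add_zero] at hftc
  rw [← enorm_neg, neg_sub, ← hftc, intervalIntegral.integral_of_le hs]
  calc ‖∫ t in Set.Ioc 0 s, fderiv ℝ u (x + t • w) w‖ₑ
      ≤ ∫⁻ t in Set.Ioc 0 s, ‖fderiv ℝ u (x + t • w) w‖ₑ := enorm_integral_le_lintegral_enorm _
    _ ≤ ∫⁻ t in Set.Icc 0 s', ‖fderiv ℝ u (x + t • w) w‖ₑ :=
        lintegral_mono_set fun t ht => ⟨ht.1.le, ht.2.trans hss⟩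
    _ ≤ ∫⁻ t in Set.Icc 0 s', ‖w‖ₑ * ‖gradient u (x + t • w)‖ₑ :=
        lintegral_mono fun t => enorm_fderiv_apply_le _ _ _
    _ = _ := lintegral_const_mul' _ _ (by simp)

/-- The uniform probability measure on `K`. -/
def unif (K : Set (E d)) : Measure (E d) := (volume K)⁻¹ • volume.restrict K

theorem isProbabilityMeasure_unif {K : Set (E d)} (h0 : volume K ≠ 0) (ht : volume K ≠ ⊤) :
    IsProbabilityMeasure (unif K) :=
  ⟨by simp [unif, ENNReal.inv_mul_cancel h0 ht]⟩

theorem isProbabilityMeasure_Icc01 :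
    IsProbabilityMeasure ((volume : Measure ℝ).restrict (Set.Icc 0 1)) := ⟨by simp⟩

/-- The map `(x, y, t) ↦ (1 - t) x + t y`, as a family of maps in `x`. -/
def segMap (p : E d × (E d × ℝ)) : E d := p.1 + p.2.2 • (p.2.1 - p.1)

theorem measurable_segMap : Measurable (segMap (d := d)) := by
  unfold segMap; fun_prop

/-- For fixed `t`, the point `(1 - t) x + t y` depends on `x` or on `y` with a factor of at least
`1 / 2`. Hence its law, for independent uniformly distributed `x` and `y` in a convex set, has
a bounded density. -/
theorem map_segMap_le {K : Set (E d)} (hKc : Convex ℝ K) (hKm : MeasurableSet K)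
    (h0 : volume K ≠ 0) (ht : volume K ≠ ⊤) :
    ((volume.restrict K).prod ((unif K).prod (volume.restrict (Set.Icc (0 : ℝ) 1)))).map segMap ≤
      (2 : ℝ≥0∞) ^ d • volume.restrict K := by
  have := isProbabilityMeasure_unif h0 ht
  have : IsFiniteMeasure (volume.restrict K) := ⟨by simpa using ht.lt_top⟩
  refine Measure.le_iff.2 fun A hA => ?_
  set f : E d → ℝ≥0∞ := (A ∩ K).indicator 1 with hf
  have hfm : Measurable f := measurable_one.indicator (hA.inter hKm)
  have hfi : ∫⁻ x, f x = volume (A ∩ K) := by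
    rw [hf, lintegral_indicator_one (hA.inter hKm)]
  have hone : ∀ l : ℝ, 1 / 2 ≤ l → ∀ c : E d, ∫⁻ x in K, f (l • x + c) ≤ 2 ^ d * volume (A ∩ K) := by
    intro l hl c
    refine (setLIntegral_le_lintegral _ _).trans ?_
    rw [← hfi]
    exact lintegral_comp_smul_add hfm.aemeasurable hl c
  have hslice : ∀ t ∈ Set.Icc (0 : ℝ) 1,
      ∫⁻ x in K, ∫⁻ y in K, f (x + t • (y - x)) ≤ 2 ^ d * volume (A ∩ K) * volume K := by
    intro t ht'
    rcases le_total (1 / 2) t with h | h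
    · calc ∫⁻ x in K, ∫⁻ y in K, f (x + t • (y - x)) ≤ ∫⁻ x in K, 2 ^ d * volume (A ∩ K) := by
            refine lintegral_mono fun x => ?_
            refine le_of_eq_of_le (lintegral_congr fun y => ?_) (hone t h (x - t • x))
            congr 1; rw [smul_sub]; abel
        _ = _ := by simp
    · have hm2 : Measurable (fun p : E d × E d => f (p.1 + t • (p.2 - p.1))) :=
        hfm.comp (by fun_prop)
      rw [lintegral_lintegral_swap (f := fun x y => f (x + t • (y - x))) hm2.aemeasurable]
      calc ∫⁻ y in K, ∫⁻ x in K, f (x + t • (y - x)) ≤ ∫⁻ x in K, 2 ^ d * volume (A ∩ K) := by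
            refine lintegral_mono fun y => ?_
            refine le_of_eq_of_le (lintegral_congr fun x => ?_) (hone (1 - t) (by linarith) (t • y))
            congr 1; rw [smul_sub, sub_smul, one_smul]; abel
        _ = _ := by simp
  have hmemK : ∀ x ∈ K, ∀ y ∈ K, ∀ t ∈ Set.Icc (0 : ℝ) 1, x + t • (y - x) ∈ K := fun x hx y hy t ht' =>
    hKc.add_smul_sub_mem hx hy ht'
  rw [Measure.map_apply measurable_segMap hA, Measure.smul_apply, Measure.restrict_apply hA,
    smul_eq_mul]
  calc ((volume.restrict K).prod ((unif K).prod (volume.restrict (Set.Icc (0 : ℝ) 1))))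
        (segMap ⁻¹' A)
      = ∫⁻ x in K, ∫⁻ y, (∫⁻ t in Set.Icc (0 : ℝ) 1, (segMap ⁻¹' A).indicator 1 (x, (y, t)))
          ∂(unif K) := by
        have hAm : MeasurableSet (segMap ⁻¹' A) := measurable_segMap hA
        rw [← lintegral_indicator_one hAm, lintegral_prod _ (measurable_one.indicator hAm).aemeasurable]
        refine lintegral_congr fun x => ?_
        have hm1 : Measurable fun q : E d × ℝ => (segMap (d := d) ⁻¹' A).indicator (1 : E d × (E d × ℝ) → ℝ≥0∞) (x, q) :=
          (measurable_one.indicator hAm).comp measurable_prodMk_left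
        rw [lintegral_prod _ hm1.aemeasurable]
    _ ≤ ∫⁻ x in K, (volume K)⁻¹ * ∫⁻ y in K, ∫⁻ t in Set.Icc (0 : ℝ) 1, f (x + t • (y - x)) := by
        refine setLIntegral_mono' hKm fun x hx => ?_
        rw [unif, lintegral_smul_measure, smul_eq_mul]
        gcongr 1
        refine setLIntegral_mono' hKm fun y hy => ?_
        refine setLIntegral_mono' measurableSet_Icc fun t ht' => ?_
        by_cases h : x + t • (y - x) ∈ A
        · rw [hf, Set.indicator_of_mem (show x + t • (y - x) ∈ A ∩ K from ⟨h, hmemK x hx y hy t ht'⟩)]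
          exact Set.indicator_le_self' (by simp) _
        · rw [Set.indicator_of_notMem (by exact h)]; exact zero_le
    _ = (volume K)⁻¹ * ∫⁻ t in Set.Icc (0 : ℝ) 1, ∫⁻ x in K, ∫⁻ y in K, f (x + t • (y - x)) := by
        rw [lintegral_const_mul' _ _ (ENNReal.inv_ne_top.2 h0)]
        congr 1
        have hm3 : Measurable fun p : (E d × ℝ) × E d => f (p.1.1 + p.1.2 • (p.2 - p.1.1)) :=
          hfm.comp (by fun_prop)
        calc ∫⁻ x in K, ∫⁻ y in K, ∫⁻ t in Set.Icc (0 : ℝ) 1, f (x + t • (y - x))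
            = ∫⁻ x in K, ∫⁻ t in Set.Icc (0 : ℝ) 1, ∫⁻ y in K, f (x + t • (y - x)) := by
              refine lintegral_congr fun x => ?_
              have hm2 : Measurable fun p : E d × ℝ => f (x + p.2 • (p.1 - x)) :=
                hfm.comp (by fun_prop)
              exact lintegral_lintegral_swap (f := fun y t => f (x + t • (y - x))) hm2.aemeasurable
          _ = _ := lintegral_lintegral_swap
              (f := fun x (t : ℝ) => ∫⁻ y in K, f (x + t • (y - x)))
              (hm3.lintegral_prod_right').aemeasurable
    _ ≤ (volume K)⁻¹ * ∫⁻ t in Set.Icc (0 : ℝ) 1, 2 ^ d * volume (A ∩ K) * volume K := by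
        gcongr 1
        exact setLIntegral_mono' measurableSet_Icc hslice
    _ = 2 ^ d * volume (A ∩ K) := by
        simp only [lintegral_const, Measure.restrict_apply_univ, Real.volume_Icc, sub_zero,
          ENNReal.ofReal_one, mul_one]
        rw [mul_comm, mul_assoc, ENNReal.mul_inv_cancel h0 ht, mul_one]

/-- The fundamental theorem of calculus along the segments from `x` to the points of `K`. -/
theorem enorm_sub_setAverage_le_of_contDiff {K : Set (E d)} (hK : IsCompact K)
    (h0 : volume K ≠ 0) {D : ℝ≥0∞} (hD : ∀ x ∈ K, ∀ y ∈ K, ‖y - x‖ₑ ≤ D) {u : E d → ℝ}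
    (hu : ContDiff ℝ 1 u) {x : E d} (hx : x ∈ K) :
    ‖u x - ⨍ y in K, u y‖ₑ ≤ ∫⁻ p, D * ‖gradient u (segMap (x, p))‖ₑ
      ∂((unif K).prod (volume.restrict (Set.Icc (0 : ℝ) 1))) := by
  have ht : volume K ≠ ⊤ := hK.measure_lt_top.ne
  have := isProbabilityMeasure_unif h0 ht
  have hui : IntegrableOn u K := hu.continuous.continuousOn.integrableOn_compact hK
  have hm : Measurable fun p : E d × ℝ => D * ‖gradient u (segMap (x, p))‖ₑ :=
    ((measurable_gradient u).comp (measurable_segMap.comp (by fun_prop))).enorm.const_mul _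
  rw [lintegral_prod _ hm.aemeasurable, unif, lintegral_smul_measure, smul_eq_mul, ← enorm_neg,
    neg_sub, ← setAverage_sub_const h0 ht hui]
  refine (enorm_setAverage_le _).trans ?_
  gcongr 1
  refine setLIntegral_mono' hK.measurableSet fun y hy => ?_
  have := enorm_sub_le_lintegral_gradient hu x (y - x) zero_le_one le_rfl
  rw [one_smul, add_sub_cancel] at this
  rw [← enorm_neg, neg_sub]
  refine this.trans ?_
  rw [lintegral_const_mul _ (by
    exact ((measurable_gradient u).comp (measurable_segMap.comp (by fun_prop))).enorm)]
  gcongr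
  · exact hD x hx y hy
  · rfl

/-- The Poincaré inequality on a compact convex set, for all exponents. -/
theorem eLpNorm_sub_setAverage_le {K : Set (E d)} (hK : IsCompact K) (hKc : Convex ℝ K)
    (h0 : volume K ≠ 0) {D : ℝ} (hD : ∀ x ∈ K, ∀ y ∈ K, dist y x ≤ D)
    {v : E d → ℝ} {g : E d → E d} (hv : IntegrableOn v K) (hg : IntegrableOn g K) {u : ℕ → E d → ℝ}
    (hu : IsC1Approx K v g u) {r : ℝ≥0∞} (hr : 1 ≤ r) :
    eLpNorm (fun x => v x - ⨍ y in K, v y) r (volume.restrict K) ≤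
      2 ^ d * ENNReal.ofReal D * eLpNorm g r (volume.restrict K) := by
  have ht : volume K ≠ ⊤ := hK.measure_lt_top.ne
  have := isProbabilityMeasure_unif h0 ht
  have := isProbabilityMeasure_Icc01
  have hui : ∀ n, IntegrableOn (u n) K := fun n =>
    (hu.contDiff n).continuous.continuousOn.integrableOn_compact hK
  have hD' : ∀ x ∈ K, ∀ y ∈ K, ‖y - x‖ₑ ≤ ENNReal.ofReal D := fun x hx y hy => by
    rw [← ofReal_norm, ← dist_eq_norm]; exact ENNReal.ofReal_le_ofReal (hD x hx y hy)
  have key : ∀ᵐ x ∂volume.restrict K, ‖v x - ⨍ y in K, v y‖ₑ ≤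
      ∫⁻ p, ENNReal.ofReal D * ‖g (segMap (x, p))‖ₑ
        ∂((unif K).prod (volume.restrict (Set.Icc (0 : ℝ) 1))) := by
    refine ae_enorm_le_lintegral_comp_of_tendsto (ν := volume.restrict K)
      (u := fun n x => u n x - ⨍ y in K, u n y)
      (F := fun z => ENNReal.ofReal D * ‖g z‖ₑ)
      (Fn := fun n z => ENNReal.ofReal D * ‖gradient (u n) z‖ₑ)
      (R := fun n z => ENNReal.ofReal D * ‖gradient (u n) z - g z‖ₑ) measurable_segMap
      (by simp) (map_segMap_le hKc hK.measurableSet h0 ht)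
      (hv.aestronglyMeasurable.aemeasurable.sub_const _) ?_
      (hg.aestronglyMeasurable.enorm.const_mul _)
      (fun n => (((measurable_gradient (u n)).aestronglyMeasurable.sub
        hg.aestronglyMeasurable).enorm.const_mul _)) ?_ ?_ ?_
    · have hle : ∀ n, ∫⁻ x in K, ‖u n x - (⨍ y in K, u n y) - (v x - ⨍ y in K, v y)‖ₑ ≤
          2 * ∫⁻ x in K, ‖u n x - v x‖ₑ := fun n => by
        calc ∫⁻ x in K, ‖u n x - (⨍ y in K, u n y) - (v x - ⨍ y in K, v y)‖ₑ
            ≤ ∫⁻ x in K, (‖u n x - v x‖ₑ + ‖⨍ y in K, (u n y - v y)‖ₑ) := by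
              refine lintegral_mono fun x => ?_
              rw [setAverage_sub (hui n) hv]
              refine le_trans (le_of_eq ?_) enorm_sub_le
              congr 1; ring
          _ = (∫⁻ x in K, ‖u n x - v x‖ₑ) + ‖⨍ y in K, (u n y - v y)‖ₑ * volume K := by
              rw [lintegral_add_right _ measurable_const]; simp
          _ ≤ (∫⁻ x in K, ‖u n x - v x‖ₑ) +
              ((volume K)⁻¹ * ∫⁻ x in K, ‖u n x - v x‖ₑ) * volume K := by
              gcongr; exact enorm_setAverage_le _
          _ = 2 * ∫⁻ x in K, ‖u n x - v x‖ₑ := by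
              rw [mul_right_comm, ENNReal.inv_mul_cancel h0 ht, one_mul, two_mul]
      refine tendsto_of_tendsto_of_tendsto_of_le_of_le tendsto_const_nhds ?_ (fun _ => zero_le) hle
      simpa using ENNReal.Tendsto.const_mul hu.tendsto (Or.inr (by simp : (2 : ℝ≥0∞) ≠ ⊤))
    · intro n
      filter_upwards [ae_restrict_mem hK.measurableSet] with x hx
      exact enorm_sub_setAverage_le_of_contDiff hK h0 hD' (hu.contDiff n) hx
    · intro n z
      rw [← mul_add]
      gcongr
      calc ‖gradient (u n) z‖ₑ = ‖g z + (gradient (u n) z - g z)‖ₑ := by congr 1; abel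
        _ ≤ _ := enorm_add_le _ _
    · simp_rw [lintegral_const_mul' _ _ (ENNReal.ofReal_ne_top (r := D))]
      simpa using ENNReal.Tendsto.const_mul hu.tendsto_gradient
        (Or.inr (ENNReal.ofReal_ne_top (r := D)))
  calc eLpNorm (fun x => v x - ⨍ y in K, v y) r (volume.restrict K)
      ≤ eLpNorm (fun x => ∫⁻ p, ENNReal.ofReal D * ‖g (segMap (x, p))‖ₑ
        ∂((unif K).prod (volume.restrict (Set.Icc (0 : ℝ) 1)))) r (volume.restrict K) :=
        eLpNorm_mono_enorm_ae (by filter_upwards [key] with x hx using by simpa using hx)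
    _ ≤ ((2 : ℝ≥0∞) ^ d) ^ (r⁻¹).toReal *
        eLpNorm (fun z => ENNReal.ofReal D * ‖g z‖ₑ) r (volume.restrict K) :=
        eLpNorm_lintegral_comp_le measurable_segMap (map_segMap_le hKc hK.measurableSet h0 ht)
          (hg.aestronglyMeasurable.enorm.const_mul _) hr
    _ ≤ 2 ^ d * (ENNReal.ofReal D * eLpNorm g r (volume.restrict K)) := by
        gcongr
        · calc ((2 : ℝ≥0∞) ^ d) ^ (r⁻¹).toReal ≤ ((2 : ℝ≥0∞) ^ d) ^ (1 : ℝ) :=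
                ENNReal.rpow_le_rpow_of_exponent_le (one_le_pow₀ (by norm_num)) (toReal_inv_le_one hr)
            _ = 2 ^ d := ENNReal.rpow_one _
        · exact (eLpNorm_const_mul_enorm ENNReal.ofReal_ne_top g r).le
    _ = _ := by rw [mul_assoc]

/-! ### Slices of simplices parallel to a face -/

/-- The gradient of an affine function. -/
def affGrad (A : E d →ᵃ[ℝ] ℝ) : E d :=
  (InnerProductSpace.toDual ℝ (E d)).symm (LinearMap.toContinuousLinearMap A.linear)

theorem affine_sub_eq_inner (A : E d →ᵃ[ℝ] ℝ) (x y : E d) :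
    A y - A x = inner ℝ (affGrad A) (y - x) := by
  rw [affGrad, InnerProductSpace.toDual_symm_apply]
  exact (A.linearMap_vsub y x).symm

theorem hasFDerivAt_affine (A : E d →ᵃ[ℝ] ℝ) (x : E d) :
    HasFDerivAt A (LinearMap.toContinuousLinearMap A.linear) x := by
  have h : ∀ y, A y = LinearMap.toContinuousLinearMap A.linear y + A 0 := fun y => by
    simpa using A.map_vadd 0 y
  have : (A : E d → ℝ) = fun y => LinearMap.toContinuousLinearMap A.linear y + A 0 := funext h
  rw [this]
  exact (ContinuousLinearMap.hasFDerivAt _).add_const _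

theorem gradient_affine (A : E d →ᵃ[ℝ] ℝ) (x : E d) : gradient A x = affGrad A := by
  rw [gradient, (hasFDerivAt_affine A x).fderiv, affGrad]

theorem continuous_affine (A : E d →ᵃ[ℝ] ℝ) : Continuous A :=
  continuous_iff_continuousAt.2 fun x => (hasFDerivAt_affine A x).continuousAt

theorem hyperplane_eq {A : E d → ℝ} {a : E d} (ha : a ≠ 0)
    (hA : ∀ x y, A y - A x = inner ℝ a (y - x)) (p : E d) (s : ℝ) (hp : A p = 0) :
    (AffineSubspace.mk' (s • ((‖a‖ ^ 2)⁻¹ • a) +ᵥ p) (Submodule.span ℝ {(‖a‖ ^ 2)⁻¹ • a})ᗮ : Set (E d))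
      = {x | A x = s} := by
  have ha2 : ‖a‖ ^ 2 ≠ 0 := by simpa using ha
  ext x
  have h1 : A x = inner ℝ a (x - p) := by have := hA p x; rw [hp] at this; linarith
  rw [SetLike.mem_coe, AffineSubspace.mem_mk', Submodule.mem_orthogonal_singleton_iff_inner_right,
    Set.mem_ofPred_eq, h1, vsub_eq_sub, vadd_eq_add, inner_smul_left,
    show x - (s • (‖a‖ ^ 2)⁻¹ • a + p) = (x - p) - s • (‖a‖ ^ 2)⁻¹ • a by abel, inner_sub_right,
    inner_smul_right, inner_smul_right, real_inner_self_eq_norm_sq, inv_mul_cancel₀ ha2, mul_one]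
  simp only [conj_trivial, mul_eq_zero, inv_eq_zero, ha2, false_or]
  exact sub_eq_zero

/-- The volume of a set by integration over the level sets of an affine function. -/
theorem volume_eq_lintegral_slice {A : E d → ℝ} {a : E d} (ha : a ≠ 0)
    (hA : ∀ x y, A y - A x = inner ℝ a (y - x)) {t : Set (E d)} (ht : MeasurableSet t) :
    volume t = ‖a‖ₑ⁻¹ * ∫⁻ s : ℝ, (μHE[d - 1] : Measure (E d)) (t ∩ {x | A x = s}) := by
  have ha2 : ‖a‖ ^ 2 ≠ 0 := by simpa using ha
  have ha1 : ‖a‖ ≠ 0 := by simpa using ha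
  obtain ⟨p, hp⟩ : ∃ p, A p = 0 := by
    refine ⟨(-(A 0) * (‖a‖ ^ 2)⁻¹) • a, ?_⟩
    have := hA 0 ((-(A 0) * (‖a‖ ^ 2)⁻¹) • a)
    rw [sub_zero, inner_smul_right, real_inner_self_eq_norm_sq, mul_assoc, inv_mul_cancel₀ ha2] at this
    linarith
  have hv : (‖a‖ ^ 2)⁻¹ • a ≠ 0 := smul_ne_zero (inv_ne_zero ha2) ha
  have h := EuclideanGeometry.euclideanHausdorffMeasure_eq_lintegral (V := E d) p hv ht
  simp_rw [hyperplane_eq ha hA p _ hp] at h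
  rw [finrank_euclideanSpace_fin, EuclideanSpace.euclideanHausdorffMeasure_eq_volume] at h
  rw [h]
  congr 1
  rw [← ofReal_norm, ← ofReal_norm, norm_smul, norm_inv, norm_pow, norm_norm,
    ← ENNReal.ofReal_inv_of_pos (by positivity)]
  congr 1
  field_simp

/-- A part of a hyperplane that lies in a ball of radius `D` has `(d-1)`-dimensional measure at most
a constant times `D^{d-1}`. -/
theorem hausdorff_slice_le (hd : d ≠ 0) {A : E d → ℝ} {a : E d} (ha : a ≠ 0)
    (hA : ∀ x y, A y - A x = inner ℝ a (y - x)) {s : ℝ} {S : Set (E d)} {c : E d} {D : ℝ}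
    (hD : 0 ≤ D) (hSA : ∀ x ∈ S, A x = s) (hc : A c = s) (hSD : ∀ x ∈ S, dist x c ≤ D) :
    (μHE[d - 1] : Measure (E d)) S ≤
      ENNReal.ofReal (D ^ (d - 1)) * volume (Metric.closedBall (0 : E (d - 1)) 1) := by
  obtain ⟨n, rfl⟩ : ∃ n, d = n + 1 := ⟨d - 1, by omega⟩
  have : Fact (Module.finrank ℝ (E (n + 1)) = n + 1) := ⟨by simp⟩
  let B := OrthonormalBasis.fromOrthogonalSpanSingleton (𝕜 := ℝ) n ha
  let f : E n → E (n + 1) := fun p => c + (B.repr.symm p : E (n + 1))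
  have hf : Isometry f :=
    (isometry_add_left c).comp (isometry_subtype_coe.comp B.repr.symm.isometry)
  have hSf : S ⊆ f '' Metric.closedBall 0 D := by
    intro x hx
    have hort : x - c ∈ (Submodule.span ℝ {a})ᗮ := by
      rw [Submodule.mem_orthogonal_singleton_iff_inner_right, ← hA c x, hSA x hx, hc, sub_self]
    refine ⟨B.repr ⟨x - c, hort⟩, ?_, by simp [f]⟩
    rw [mem_closedBall_zero_iff, LinearIsometryEquiv.norm_map]
    · simpa [dist_eq_norm] using hSD x hx
  refine (measure_mono hSf).trans ?_
  simp only [Nat.add_sub_cancel]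
  rw [hf.euclideanHausdorffMeasure_image, EuclideanSpace.euclideanHausdorffMeasure_eq_volume,
    Measure.addHaar_closedBall' _ _ hD]
  simp

/-- The map `(x, t) ↦ (1 - t) x + t z`. -/
def coneMap (z : E d) (p : E d × ℝ) : E d := p.1 + p.2 • (z - p.1)

theorem measurable_coneMap (z : E d) : Measurable (coneMap z) := by unfold coneMap; fun_prop

theorem coneMap_eq_homothety (z x : E d) (t : ℝ) :
    coneMap z (x, t) = AffineMap.homothety z (1 - t) x := by
  simp only [coneMap, AffineMap.homothety_apply, vsub_eq_sub, vadd_eq_add, sub_smul, one_smul,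
    smul_sub]
  abel

theorem coneMap_mem_hull {T : Finset (E d)} {x z : E d} (hx : x ∈ hull T) (hz : z ∈ hull T) {t : ℝ}
    (ht : t ∈ Set.Icc (0 : ℝ) 1) : coneMap z (x, t) ∈ hull T :=
  (convex_hull' T).add_smul_sub_mem hx hz ht

/-- The `(d-1)`-dimensional Hausdorff measure on a face. -/
def faceMeasure (F : Finset (E d)) : Measure (E d) := (μHE[d - 1] : Measure (E d)).restrict (hull F)

theorem dist_le_diam_hull {T : Finset (E d)} {x y : E d} (hx : x ∈ hull T) (hy : y ∈ hull T) :
    dist x y ≤ Metric.diam (hull T) :=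
  Metric.dist_le_diam_of_mem (isCompact_hull T).isBounded hx hy

namespace IsSimplex

variable {T : Finset (E d)} (hT : IsSimplex T)
include hT

/-- The gradient of the barycentric coordinate belonging to `z`. -/
def grad (z : E d) : E d := affGrad (hT.coord z)

theorem coord_sub (z x y : E d) : hT.coord z y - hT.coord z x = inner ℝ (hT.grad z) (y - x) :=
  affine_sub_eq_inner _ x y

theorem exists_ne_mem (hd : d ≠ 0) (z : E d) : ∃ y ∈ T, y ≠ z :=
  Finset.exists_mem_ne (by rw [hT.1]; omega) z

theorem grad_ne_zero (hd : d ≠ 0) {z : E d} (hz : z ∈ T) : hT.grad z ≠ 0 := by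
  intro h
  obtain ⟨y, hy, hne⟩ := hT.exists_ne_mem hd z
  have := hT.coord_sub z y z
  rw [hT.coord_self hz, hT.coord_ne hy hne.symm, h, inner_zero_left] at this
  norm_num at this

open scoped Classical in
theorem mem_hull_erase_iff {z y : E d} :
    y ∈ hull (T.erase z) ↔ y ∈ hull T ∧ hT.coord z y = 0 := by
  rw [hT.mem_hull_subset_iff (T.erase_subset z)]
  refine and_congr_right fun _ => ⟨fun h => h z (by simp), fun h z' hz' => ?_⟩
  rcases eq_or_ne z' z with rfl | hne
  · exact h
  · rw [hT.coord_of_notMem (fun h' => hz' (by simp [h', hne]))]; rfl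

open scoped Classical in
/-- The points of a simplex at relative height `t` above the face opposite to `z` form a scaled copy
of that face. -/
theorem inter_slice_eq {z : E d} (hz : z ∈ T) {t : ℝ} (ht : t ∈ Set.Ico (0 : ℝ) 1) (S : Set (E d)) :
    (S ∩ hull T) ∩ {x | hT.coord z x = t} =
      AffineMap.homothety z (1 - t) '' {x | x ∈ hull (T.erase z) ∧ coneMap z (x, t) ∈ S} := by
  have ht1 : 1 - t ≠ 0 := by linarith [ht.2]
  have hcoord : ∀ x, hT.coord z (coneMap z (x, t)) = (1 - t) * hT.coord z x + t := fun x => by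
    have h1 := hT.coord_sub z x (coneMap z (x, t))
    have h2 := hT.coord_sub z x z
    rw [coneMap, add_sub_cancel_left, inner_smul_right] at h1
    rw [hT.coord_self hz] at h2
    rw [coneMap]
    linear_combination h1 - t * h2
  ext y
  constructor
  · rintro ⟨⟨hyS, hyT⟩, hyt⟩
    have hx : coneMap z (AffineMap.homothety z (1 - t)⁻¹ y, t) = y := by
      rw [coneMap_eq_homothety, ← AffineMap.comp_apply, ← AffineMap.homothety_mul,
        mul_inv_cancel₀ ht1]
      simp
    set x := AffineMap.homothety z (1 - t)⁻¹ y with hxdef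
    have hx0 : hT.coord z x = 0 := by
      have := hcoord x
      rw [hx, hyt] at this
      have h3 : (1 - t) * hT.coord z x = 0 := by linarith
      exact (mul_eq_zero.1 h3).resolve_left ht1
    refine ⟨x, ⟨hT.mem_hull_erase_iff.2 ⟨?_, hx0⟩, by rwa [hx]⟩, by rw [← coneMap_eq_homothety, hx]⟩
    refine hT.mem_hull_iff.2 fun w hw => ?_
    rcases eq_or_ne w z with rfl | hne
    · exact hx0.ge
    · have h1 := hT.coord_sub w x z
      have h2 := hT.coord_sub w x y
      have e : y - x = t • (z - x) := by
        rw [← hx]; simp [coneMap]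
      rw [e, inner_smul_right] at h2
      rw [hT.coord_ne hz hne] at h1
      have h3 : hT.coord w y = (1 - t) * hT.coord w x := by linear_combination h2 - t * h1
      have h4 := hT.coord_nonneg hyT w
      rw [h3] at h4
      exact nonneg_of_mul_nonneg_right h4 (by linarith [ht.2])
  · rintro ⟨x, ⟨hxF, hxS⟩, rfl⟩
    have hxF' := hT.mem_hull_erase_iff.1 hxF
    rw [← coneMap_eq_homothety]
    refine ⟨⟨hxS, coneMap_mem_hull hxF'.1 (subset_hull T hz) ⟨ht.1, ht.2.le⟩⟩, ?_⟩
    rw [Set.mem_ofPred_eq, hcoord, hxF'.2]; ring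

open scoped Classical in
theorem hausdorff_slice_eq {z : E d} (hz : z ∈ T) {t : ℝ} (ht : t ∈ Set.Ico (0 : ℝ) 1)
    (S : Set (E d)) :
    (μHE[d - 1] : Measure (E d)) ((S ∩ hull T) ∩ {x | hT.coord z x = t}) =
      ENNReal.ofReal (1 - t) ^ (d - 1) *
        (μHE[d - 1] : Measure (E d)) {x | x ∈ hull (T.erase z) ∧ coneMap z (x, t) ∈ S} := by
  rw [hT.inter_slice_eq hz ht, euclideanHausdorffMeasure_homothety_image _ _ (by linarith [ht.2])]
  rw [ENNReal.smul_def, smul_eq_mul, ENNReal.coe_pow]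
  congr 2
  have h : (0 : ℝ) ≤ 1 - t := by linarith [ht.2]
  rw [ENNReal.ofReal, Real.toNNReal_of_nonneg h]
  congr 1
  ext
  simp [abs_of_nonneg h]

open scoped Classical in
/-- The volume of a simplex is at most height times area of a face. -/
theorem enorm_grad_mul_volume_le (hd : d ≠ 0) {z : E d} (hz : z ∈ T) :
    ‖hT.grad z‖ₑ * volume (hull T) ≤ (μHE[d - 1] : Measure (E d)) (hull (T.erase z)) := by
  have ha := hT.grad_ne_zero hd hz
  rw [volume_eq_lintegral_slice ha (hT.coord_sub z) (measurableSet_hull T), ← mul_assoc,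
    ENNReal.mul_inv_cancel (by simpa using ha) (by simp), one_mul]
  calc ∫⁻ s : ℝ, (μHE[d - 1] : Measure (E d)) (hull T ∩ {x | hT.coord z x = s})
      ≤ ∫⁻ s : ℝ, (Set.Icc (0 : ℝ) 1).indicator
          (fun _ => (μHE[d - 1] : Measure (E d)) (hull (T.erase z))) s := by
        refine lintegral_mono_ae ?_
        have h1 : ∀ᵐ s : ℝ, s ≠ 1 := by simp [ae_iff]
        filter_upwards [h1] with s hs1
        by_cases hs : s ∈ Set.Icc (0 : ℝ) 1
        · rw [Set.indicator_of_mem hs]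
          have hs' : s ∈ Set.Ico (0 : ℝ) 1 := ⟨hs.1, lt_of_le_of_ne hs.2 hs1⟩
          have := hT.hausdorff_slice_eq hz hs' Set.univ
          rw [Set.univ_inter] at this
          rw [this]
          calc _ ≤ 1 ^ (d - 1) * (μHE[d - 1] : Measure (E d)) (hull (T.erase z)) := by
                gcongr
                · rw [← ENNReal.ofReal_one]; exact ENNReal.ofReal_le_ofReal (by linarith [hs.1])
                · exact fun x hx => hx.1
            _ = _ := by rw [one_pow, one_mul]
        · rw [Set.indicator_of_notMem hs, nonpos_iff_eq_zero]
          convert measure_empty (μ := (μHE[d - 1] : Measure (E d)))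
          rw [Set.eq_empty_iff_forall_notMem]
          rintro x ⟨hx, hxs⟩
          exact hs (hxs ▸ ⟨hT.coord_nonneg hx z, hT.coord_le_one hx z⟩)
    _ = _ := by simp [lintegral_indicator measurableSet_Icc]

open scoped Classical in
theorem hausdorff_face_le (hd : d ≠ 0) {z : E d} (hz : z ∈ T) :
    (μHE[d - 1] : Measure (E d)) (hull (T.erase z)) ≤
      ENNReal.ofReal (Metric.diam (hull T) ^ (d - 1)) *
        volume (Metric.closedBall (0 : E (d - 1)) 1) := by
  obtain ⟨y, hy, hne⟩ := hT.exists_ne_mem hd z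
  refine hausdorff_slice_le hd (hT.grad_ne_zero hd hz) (hT.coord_sub z) (s := 0) (c := y)
    Metric.diam_nonneg (fun x hx => (hT.mem_hull_erase_iff.1 hx).2) (hT.coord_ne hy hne.symm)
    fun x hx => dist_le_diam_hull (hT.mem_hull_erase_iff.1 hx).1 (subset_hull T hy)

open scoped Classical in
theorem hausdorff_face_lt_top (hd : d ≠ 0) {z : E d} (hz : z ∈ T) :
    (μHE[d - 1] : Measure (E d)) (hull (T.erase z)) < ⊤ :=
  (hT.hausdorff_face_le hd hz).trans_lt
    (ENNReal.mul_lt_top ENNReal.ofReal_lt_top (isCompact_closedBall _ _).measure_lt_top)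

open scoped Classical in
theorem hausdorff_face_pos (hd : d ≠ 0) {z : E d} (hz : z ∈ T) :
    0 < (μHE[d - 1] : Measure (E d)) (hull (T.erase z)) :=
  (ENNReal.mul_pos (by simpa using hT.grad_ne_zero hd hz) hT.volume_pos.ne').trans_le
    (hT.enorm_grad_mul_volume_le hd hz)

end IsSimplex

/-- The uniform probability measure on `[0, 1/2]`. -/
def unifHalf : Measure ℝ := (2 : ℝ≥0∞) • volume.restrict (Set.Icc 0 (1 / 2))

instance isProbabilityMeasure_unifHalf : IsProbabilityMeasure unifHalf :=
  ⟨by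
    simp only [unifHalf, Measure.smul_apply, Measure.restrict_apply_univ, Real.volume_Icc, sub_zero,
      smul_eq_mul]
    rw [show (2 : ℝ≥0∞) = ENNReal.ofReal 2 by simp, ← ENNReal.ofReal_mul (by norm_num)]
    norm_num⟩

open scoped Classical in
/-- Moving a face towards the opposite vertex `z`, up to half of the way, spreads the measure on the
face over the simplex with bounded density. -/
theorem map_coneMap_le (hd : d ≠ 0) {T : Finset (E d)} (hT : IsSimplex T) {z : E d} (hz : z ∈ T) :
    ((faceMeasure (T.erase z)).prod unifHalf).map (coneMap z) ≤
      (2 ^ d * ((μHE[d - 1] : Measure (E d)) (hull (T.erase z)) / volume (hull T))) •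
        volume.restrict (hull T) := by
  have ha := hT.grad_ne_zero hd hz
  have : IsFiniteMeasure (faceMeasure (T.erase z)) :=
    ⟨by simpa [faceMeasure] using hT.hausdorff_face_lt_top hd hz⟩
  have hvT0 := hT.volume_pos.ne'
  have hvTt := (volume_hull_lt_top T).ne
  refine Measure.le_iff.2 fun S hS => ?_
  have hpre : MeasurableSet (coneMap z ⁻¹' S) := measurable_coneMap z hS
  rw [Measure.map_apply (measurable_coneMap z) hS, Measure.prod_apply_symm hpre, Measure.smul_apply,
    Measure.restrict_apply hS, unifHalf, lintegral_smul_measure, smul_eq_mul, smul_eq_mul]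
  have hpt : ∀ t ∈ Set.Icc (0 : ℝ) (1 / 2),
      faceMeasure (T.erase z) ((fun x => (x, t)) ⁻¹' (coneMap z ⁻¹' S)) ≤
      2 ^ (d - 1) * (μHE[d - 1] : Measure (E d)) ((S ∩ hull T) ∩ {x | hT.coord z x = t}) := by
    intro t ht
    have htI : t ∈ Set.Ico (0 : ℝ) 1 := ⟨ht.1, by linarith [ht.2]⟩
    have hm : MeasurableSet ((fun x : E d => (x, t)) ⁻¹' (coneMap z ⁻¹' S)) :=
      measurable_prodMk_right hpre
    rw [hT.hausdorff_slice_eq hz htI, faceMeasure, Measure.restrict_apply hm, ← mul_assoc, ← mul_pow]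
    have hset : (fun x => (x, t)) ⁻¹' (coneMap z ⁻¹' S) ∩ hull (T.erase z) =
        {x | x ∈ hull (T.erase z) ∧ coneMap z (x, t) ∈ S} := by
      ext x; exact and_comm
    rw [hset]
    have h1 : (1 : ℝ≥0∞) ≤ 2 * ENNReal.ofReal (1 - t) := by
      rw [show (2 : ℝ≥0∞) = ENNReal.ofReal 2 by simp, ← ENNReal.ofReal_mul (by norm_num)]
      rw [← ENNReal.ofReal_one]
      exact ENNReal.ofReal_le_ofReal (by linarith [ht.2])
    calc _ = 1 * (μHE[d - 1] : Measure (E d)) {x | x ∈ hull (T.erase z) ∧ coneMap z (x, t) ∈ S} := by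
          rw [one_mul]
      _ ≤ _ := by gcongr; exact one_le_pow₀ h1
  calc 2 * ∫⁻ t in Set.Icc (0 : ℝ) (1 / 2),
        faceMeasure (T.erase z) ((fun x => (x, t)) ⁻¹' (coneMap z ⁻¹' S))
      ≤ 2 * ∫⁻ t in Set.Icc (0 : ℝ) (1 / 2),
        2 ^ (d - 1) * (μHE[d - 1] : Measure (E d)) ((S ∩ hull T) ∩ {x | hT.coord z x = t}) := by
        gcongr 1
        exact setLIntegral_mono' measurableSet_Icc hpt
    _ ≤ 2 * (2 ^ (d - 1) *
        ∫⁻ t, (μHE[d - 1] : Measure (E d)) ((S ∩ hull T) ∩ {x | hT.coord z x = t})) := by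
        rw [lintegral_const_mul' _ _ (by simp)]
        gcongr
        exact Measure.restrict_le_self
    _ = 2 ^ d * (‖hT.grad z‖ₑ * volume (S ∩ hull T)) := by
        rw [volume_eq_lintegral_slice ha (hT.coord_sub z) (hS.inter (measurableSet_hull T)),
          ← mul_assoc ‖hT.grad z‖ₑ, ENNReal.mul_inv_cancel (by simpa using ha) (by simp), one_mul,
          ← mul_assoc, ← pow_succ']
        congr 2
        omega
    _ ≤ _ := by
        rw [mul_assoc]
        gcongr
        rw [ENNReal.le_div_iff_mul_le (Or.inl hvT0) (Or.inl hvTt)]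
        exact hT.enorm_grad_mul_volume_le hd hz

/-! ### Traces on faces -/

theorem isC1Approx_const {K : Set (E d)} {u : E d → ℝ} (hu : ContDiff ℝ 1 u) :
    IsC1Approx K u (gradient u) (fun _ => u) where
  contDiff _ := hu
  tendsto := by simp
  tendsto_gradient := by simp

theorem aemeasurable_enorm_sub {K : Set (E d)} {u v : E d → ℝ} (hu : ContDiff ℝ 1 u)
    (hv : IntegrableOn v K) : AEMeasurable (fun x => ‖u x - v x‖ₑ) (volume.restrict K) :=
  (hu.continuous.aestronglyMeasurable.sub hv.aestronglyMeasurable).enorm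

theorem aemeasurable_enorm_gradient_sub {K : Set (E d)} (u : E d → ℝ) {g : E d → E d}
    (hg : IntegrableOn g K) : AEMeasurable (fun x => ‖gradient u x - g x‖ₑ) (volume.restrict K) :=
  ((measurable_gradient u).aestronglyMeasurable.sub hg.aestronglyMeasurable).enorm

theorem gradient_sub {u w : E d → ℝ} (hu : ContDiff ℝ 1 u) (hw : ContDiff ℝ 1 w) (x : E d) :
    gradient (fun x => u x - w x) x = gradient u x - gradient w x := by
  rw [gradient, gradient, gradient, fderiv_fun_sub (hu.differentiable one_ne_zero x)
    (hw.differentiable one_ne_zero x), map_sub]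

/-- A function on a face is controlled by its averages over the segments towards the opposite vertex
and by the gradient. -/
theorem enorm_sub_le_lintegral_coneMap {u : E d → ℝ} (hu : ContDiff ℝ 1 u) {x z : E d} {D : ℝ≥0∞}
    (hD : ‖z - x‖ₑ ≤ D) (m : ℝ) :
    ‖u x - m‖ₑ ≤ ∫⁻ t, (‖u (coneMap z (x, t)) - m‖ₑ + D * ‖gradient u (coneMap z (x, t))‖ₑ)
      ∂unifHalf := by
  have hm : Measurable fun t : ℝ => ‖gradient u (coneMap z (x, t))‖ₑ :=
    ((measurable_gradient u).comp ((measurable_coneMap z).comp (by fun_prop))).enorm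
  have hm1 : Measurable fun t : ℝ => ‖u (coneMap z (x, t)) - m‖ₑ :=
    ((hu.continuous.measurable.comp ((measurable_coneMap z).comp (by fun_prop))).sub_const m).enorm
  set J := ∫⁻ t, ‖gradient u (coneMap z (x, t))‖ₑ ∂unifHalf with hJ
  have hpt : ∀ᵐ s ∂unifHalf, ‖u x - m‖ₑ ≤ ‖u (coneMap z (x, s)) - m‖ₑ + D * J := by
    have : ∀ᵐ s ∂unifHalf, s ∈ Set.Icc (0 : ℝ) (1 / 2) :=
      (Measure.smul_absolutelyContinuous).ae_le (ae_restrict_mem measurableSet_Icc)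
    filter_upwards [this] with s hs
    have h1 := enorm_sub_le_lintegral_gradient hu x (z - x) hs.1 hs.2
    have h2 : ∫⁻ t in Set.Icc (0 : ℝ) (1 / 2), ‖gradient u (x + t • (z - x))‖ₑ ≤ J := by
      rw [hJ, unifHalf, lintegral_smul_measure, smul_eq_mul]
      exact le_mul_of_one_le_left zero_le (by norm_num)
    calc ‖u x - m‖ₑ = ‖(u (coneMap z (x, s)) - m) + (u x - u (x + s • (z - x)))‖ₑ := by
          congr 1; simp [coneMap]
      _ ≤ ‖u (coneMap z (x, s)) - m‖ₑ + ‖u x - u (x + s • (z - x))‖ₑ := enorm_add_le _ _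
      _ ≤ _ := by gcongr; exact h1.trans (by gcongr)
  calc ‖u x - m‖ₑ = ∫⁻ _, ‖u x - m‖ₑ ∂unifHalf := by simp
    _ ≤ ∫⁻ s, (‖u (coneMap z (x, s)) - m‖ₑ + D * J) ∂unifHalf := lintegral_mono_ae hpt
    _ = _ := by
        rw [lintegral_add_left hm1, lintegral_add_left hm1, lintegral_const_mul _ hm]
        simp [hJ]

theorem enorm_sub_le_ofReal_diam {T : Finset (E d)} {x y : E d} (hx : x ∈ hull T)
    (hy : y ∈ hull T) : ‖y - x‖ₑ ≤ ENNReal.ofReal (Metric.diam (hull T)) := by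
  rw [← ofReal_norm, ← dist_eq_norm]
  exact ENNReal.ofReal_le_ofReal (dist_le_diam_hull hy hx)

section Trace

variable {T : Finset (E d)} (hT : IsSimplex T) {z : E d} (hz : z ∈ T)

/-- The constant `2^d |F| / |T|` of the trace inequality on the face `F` opposite to `z`. -/
def traceConst (T : Finset (E d)) (F : Finset (E d)) : ℝ≥0∞ :=
  2 ^ d * ((μHE[d - 1] : Measure (E d)) (hull F) / volume (hull T))

open scoped Classical in
theorem traceConst_ne_top (hd : d ≠ 0) (hT : IsSimplex T) (hz : z ∈ T) :
    traceConst T (T.erase z) ≠ ⊤ :=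
  ENNReal.mul_ne_top (by simp)
    (ENNReal.div_ne_top (hT.hausdorff_face_lt_top hd hz).ne hT.volume_pos.ne')

open scoped Classical in
theorem isFiniteMeasure_faceMeasure (hd : d ≠ 0) (hT : IsSimplex T) (hz : z ∈ T) :
    IsFiniteMeasure (faceMeasure (T.erase z)) :=
  ⟨by simpa [faceMeasure] using hT.hausdorff_face_lt_top hd hz⟩

open scoped Classical in
/-- The trace inequality, for all exponents. -/
theorem eLpNorm_trace_sub_le (hd : d ≠ 0) (hT : IsSimplex T) (hz : z ∈ T) {v : E d → ℝ}
    {g : E d → E d} (hv : IntegrableOn v (hull T)) (hg : IntegrableOn g (hull T))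
    {u : ℕ → E d → ℝ} (hu : IsC1Approx (hull T) v g u) {τ : E d → ℝ}
    (hτ : AEMeasurable τ (faceMeasure (T.erase z)))
    (huτ : Tendsto (fun n => ∫⁻ x, ‖u n x - τ x‖ₑ ∂faceMeasure (T.erase z)) atTop (𝓝 0))
    (m : ℝ) {r : ℝ≥0∞} (hr : 1 ≤ r) :
    eLpNorm (fun x => τ x - m) r (faceMeasure (T.erase z)) ≤
      traceConst T (T.erase z) ^ (r⁻¹).toReal *
        (eLpNorm (fun x => v x - m) r (volume.restrict (hull T)) +
          ENNReal.ofReal (Metric.diam (hull T)) * eLpNorm g r (volume.restrict (hull T))) := by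
  have := isFiniteMeasure_faceMeasure hd hT hz
  set D := ENNReal.ofReal (Metric.diam (hull T)) with hD
  have hDt : D ≠ ⊤ := ENNReal.ofReal_ne_top
  have hFm : AEMeasurable (fun z => ‖v z - m‖ₑ + D * ‖g z‖ₑ) (volume.restrict (hull T)) :=
    (hv.aestronglyMeasurable.aemeasurable.sub_const _).enorm.add
      (hg.aestronglyMeasurable.enorm.const_mul _)
  have key : ∀ᵐ x ∂faceMeasure (T.erase z), ‖τ x - m‖ₑ ≤
      ∫⁻ t, (‖v (coneMap z (x, t)) - m‖ₑ + D * ‖g (coneMap z (x, t))‖ₑ) ∂unifHalf := by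
    refine ae_enorm_le_lintegral_comp_of_tendsto (ν := volume.restrict (hull T))
      (u := fun n x => u n x - m) (F := fun z => ‖v z - m‖ₑ + D * ‖g z‖ₑ)
      (Fn := fun n z => ‖u n z - m‖ₑ + D * ‖gradient (u n) z‖ₑ)
      (R := fun n z => ‖u n z - v z‖ₑ + D * ‖gradient (u n) z - g z‖ₑ) (measurable_coneMap z)
      (traceConst_ne_top hd hT hz) (map_coneMap_le hd hT hz) (hτ.sub_const _) ?_ hFm
      (fun n => ((hu.contDiff n).continuous.aestronglyMeasurable.sub
        hv.aestronglyMeasurable).enorm.add (((measurable_gradient (u n)).aestronglyMeasurable.sub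
        hg.aestronglyMeasurable).enorm.const_mul _)) ?_ ?_ ?_
    · simpa using huτ
    · intro n
      filter_upwards [ae_restrict_mem (measurableSet_hull _)] with x hx
      exact enorm_sub_le_lintegral_coneMap (hu.contDiff n)
        (enorm_sub_le_ofReal_diam (hT.mem_hull_erase_iff.1 hx).1 (subset_hull T hz)) m
    · intro n y
      calc ‖u n y - m‖ₑ + D * ‖gradient (u n) y‖ₑ
          ≤ (‖v y - m‖ₑ + ‖u n y - v y‖ₑ) + D * (‖g y‖ₑ + ‖gradient (u n) y - g y‖ₑ) := by
            gcongr
            · calc ‖u n y - m‖ₑ = ‖(v y - m) + (u n y - v y)‖ₑ := by congr 1; ring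
                _ ≤ _ := enorm_add_le _ _
            · calc ‖gradient (u n) y‖ₑ = ‖g y + (gradient (u n) y - g y)‖ₑ := by congr 1; abel
                _ ≤ _ := enorm_add_le _ _
        _ = _ := by ring
    · have h1 : ∀ n, ∫⁻ y in hull T, (‖u n y - v y‖ₑ + D * ‖gradient (u n) y - g y‖ₑ) =
          (∫⁻ y in hull T, ‖u n y - v y‖ₑ) + D * ∫⁻ y in hull T, ‖gradient (u n) y - g y‖ₑ := by
        intro n
        rw [lintegral_add_left' (aemeasurable_enorm_sub (hu.contDiff n) hv),
          lintegral_const_mul' _ _ hDt]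
      simp_rw [h1]
      simpa using hu.tendsto.add (ENNReal.Tendsto.const_mul hu.tendsto_gradient (Or.inr hDt))
  calc eLpNorm (fun x => τ x - m) r (faceMeasure (T.erase z))
      ≤ eLpNorm (fun x => ∫⁻ t, (‖v (coneMap z (x, t)) - m‖ₑ + D * ‖g (coneMap z (x, t))‖ₑ)
          ∂unifHalf) r (faceMeasure (T.erase z)) :=
        eLpNorm_mono_enorm_ae (by filter_upwards [key] with x hx using by simpa using hx)
    _ ≤ traceConst T (T.erase z) ^ (r⁻¹).toReal *
          eLpNorm (fun y => ‖v y - m‖ₑ + D * ‖g y‖ₑ) r (volume.restrict (hull T)) :=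
        eLpNorm_lintegral_comp_le (measurable_coneMap z) (map_coneMap_le hd hT hz) hFm hr
    _ ≤ _ := by
        gcongr
        refine (eLpNorm_add_le (f := fun y => ‖v y - m‖ₑ) (g := fun y => D * ‖g y‖ₑ)
          ?_ ?_ hr).trans ?_
        · exact (hv.aestronglyMeasurable.aemeasurable.sub_const _).enorm.aestronglyMeasurable
        · exact (hg.aestronglyMeasurable.enorm.const_mul _).aestronglyMeasurable
        · rw [eLpNorm_const_mul_enorm hDt]
          gcongr
          exact (eLpNorm_congr_enorm_ae (Eventually.of_forall fun y => by simp)).le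

theorem integrableOn_hull_of_continuous {F : Type*} [NormedAddCommGroup F] {f : E d → F}
    (hf : Continuous f) (T : Finset (E d)) :
    IntegrableOn f (hull T) := hf.continuousOn.integrableOn_compact (isCompact_hull T)

open scoped Classical in
/-- The trace inequality for continuously differentiable functions, in `L¹`. -/
theorem lintegral_face_le (hd : d ≠ 0) (hT : IsSimplex T) (hz : z ∈ T) {u : E d → ℝ}
    (hu : ContDiff ℝ 1 u) (m : ℝ) :
    ∫⁻ x, ‖u x - m‖ₑ ∂faceMeasure (T.erase z) ≤ traceConst T (T.erase z) *
      ((∫⁻ x in hull T, ‖u x - m‖ₑ) +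
        ENNReal.ofReal (Metric.diam (hull T)) * ∫⁻ x in hull T, ‖gradient u x‖ₑ) := by
  have := eLpNorm_trace_sub_le hd hT hz (integrableOn_hull_of_continuous hu.continuous T)
    (integrableOn_hull_of_continuous (continuous_gradient hu) T) (isC1Approx_const hu) (τ := u)
    hu.continuous.measurable.aemeasurable (by simp) m le_rfl
  simpa [eLpNorm_one_eq_lintegral_enorm] using this

open scoped Classical in
/-- Existence of traces: the restrictions to a face of smooth approximations form a Cauchy sequence
in `L¹`. -/
theorem exists_trace (hd : d ≠ 0) (hT : IsSimplex T) (hz : z ∈ T) {v : E d → ℝ}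
    {g : E d → E d} (hv : IntegrableOn v (hull T)) (hg : IntegrableOn g (hull T))
    {u : ℕ → E d → ℝ} (hu : IsC1Approx (hull T) v g u) :
    ∃ τ, MemLp τ 1 (faceMeasure (T.erase z)) ∧
      Tendsto (fun n => eLpNorm (u n - τ) 1 (faceMeasure (T.erase z))) atTop (𝓝 0) := by
  have := isFiniteMeasure_faceMeasure hd hT hz
  set μ := faceMeasure (T.erase z) with hμ
  set D := ENNReal.ofReal (Metric.diam (hull T)) with hD
  have hDt : D ≠ ⊤ := ENNReal.ofReal_ne_top
  have hmem : ∀ n, MemLp (u n) 1 μ := fun n => by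
    obtain ⟨C, hC⟩ := (isCompact_hull (T.erase z)).exists_bound_of_continuousOn
      (hu.contDiff n).continuous.continuousOn
    refine MemLp.of_bound (hu.contDiff n).continuous.aestronglyMeasurable C ?_
    filter_upwards [ae_restrict_mem (measurableSet_hull _)] with x hx using hC x hx
  set a : ℕ → ℝ≥0∞ := fun n => ∫⁻ x in hull T, ‖u n x - v x‖ₑ
  set b : ℕ → ℝ≥0∞ := fun n => ∫⁻ x in hull T, ‖gradient (u n) x - g x‖ₑ
  have hle : ∀ p : ℕ × ℕ, eLpNorm (u p.1 - u p.2) 1 μ ≤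
      traceConst T (T.erase z) * ((a p.1 + a p.2) + D * (b p.1 + b p.2)) := by
    rintro ⟨i, j⟩
    have h := lintegral_face_le hd hT hz ((hu.contDiff i).sub (hu.contDiff j)) 0
    simp only [sub_zero] at h
    rw [eLpNorm_one_eq_lintegral_enorm]
    refine h.trans ?_
    gcongr
    · refine le_trans (lintegral_mono fun x => ?_)
        (lintegral_add_left' (aemeasurable_enorm_sub (hu.contDiff i) hv) _).le
      calc ‖u i x - u j x‖ₑ = ‖(u i x - v x) - (u j x - v x)‖ₑ := by congr 1; ring
        _ ≤ _ := enorm_sub_le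
    · refine le_trans (lintegral_mono fun x => ?_)
        (lintegral_add_left' (aemeasurable_enorm_gradient_sub (u i) hg) _).le
      rw [gradient_sub (hu.contDiff i) (hu.contDiff j)]
      calc ‖gradient (u i) x - gradient (u j) x‖ₑ =
            ‖(gradient (u i) x - g x) - (gradient (u j) x - g x)‖ₑ := by congr 1; abel
        _ ≤ _ := enorm_sub_le
  have hlim : Tendsto (fun p : ℕ × ℕ => traceConst T (T.erase z) *
      ((a p.1 + a p.2) + D * (b p.1 + b p.2))) atTop (𝓝 0) := by
    rw [← prod_atTop_atTop_eq]
    have ha := hu.tendsto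
    have hb := hu.tendsto_gradient
    have h1 := (ha.comp (tendsto_fst (g := (atTop : Filter ℕ)))).add
      (ha.comp (tendsto_snd (f := (atTop : Filter ℕ))))
    have h2 := (hb.comp (tendsto_fst (g := (atTop : Filter ℕ)))).add
      (hb.comp (tendsto_snd (f := (atTop : Filter ℕ))))
    have h3 := ENNReal.Tendsto.const_mul (h1.add (ENNReal.Tendsto.const_mul h2 (Or.inr hDt)))
      (Or.inr (traceConst_ne_top hd hT hz))
    simpa using h3
  have hcau : CauchySeq fun n => (hmem n).toLp (u n) := by
    rw [Lp.cauchySeq_Lp_iff_cauchySeq_eLpNorm]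
    refine tendsto_of_tendsto_of_tendsto_of_le_of_le tendsto_const_nhds hlim (fun _ => zero_le)
      fun p => ?_
    refine le_of_eq_of_le (eLpNorm_congr_ae ?_) (hle p)
    exact (hmem p.1).coeFn_toLp.sub (hmem p.2).coeFn_toLp
  obtain ⟨τ, hτ⟩ := cauchySeq_tendsto_of_complete hcau
  refine ⟨τ, Lp.memLp τ, ?_⟩
  rw [Lp.tendsto_Lp_iff_tendsto_eLpNorm'] at hτ
  refine hτ.congr fun n => eLpNorm_congr_ae ?_
  exact (hmem n).coeFn_toLp.sub (ae_eq_refl _)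

open scoped Classical in
/-- The means of a function over a simplex and over one of its faces differ by at most the diameter
times the mean of the gradient. -/
theorem enorm_average_face_sub_le (hd : d ≠ 0) (hT : IsSimplex T) (hz : z ∈ T) {u : E d → ℝ}
    (hu : ContDiff ℝ 1 u) :
    ‖(⨍ x, u x ∂faceMeasure (T.erase z)) - ⨍ x in hull T, u x‖ₑ ≤
      2 ^ d * (2 ^ d + 1) * (ENNReal.ofReal (Metric.diam (hull T)) *
        ((volume (hull T))⁻¹ * ∫⁻ x in hull T, ‖gradient u x‖ₑ)) := by
  have := isFiniteMeasure_faceMeasure hd hT hz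
  set D := ENNReal.ofReal (Metric.diam (hull T)) with hD
  set m := ⨍ x in hull T, u x
  set F := hull (T.erase z) with hF
  have hF0 : (μHE[d - 1] : Measure (E d)) F ≠ 0 := (hT.hausdorff_face_pos hd hz).ne'
  have hFt : (μHE[d - 1] : Measure (E d)) F ≠ ⊤ := (hT.hausdorff_face_lt_top hd hz).ne
  have hui : IntegrableOn u F (μHE[d - 1]) := by
    obtain ⟨C, hC⟩ := (isCompact_hull (T.erase z)).exists_bound_of_continuousOn
      hu.continuous.continuousOn
    refine memLp_one_iff_integrable.1
      (MemLp.of_bound (μ := faceMeasure (T.erase z)) hu.continuous.aestronglyMeasurable C ?_)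
    filter_upwards [ae_restrict_mem (measurableSet_hull _)] with x hx using hC x hx
  have hpoin := eLpNorm_sub_setAverage_le (isCompact_hull T) (convex_hull' T) hT.volume_pos.ne'
    (fun x hx y hy => dist_le_diam_hull hy hx)
    (integrableOn_hull_of_continuous hu.continuous T)
    (integrableOn_hull_of_continuous (continuous_gradient hu) T) (isC1Approx_const hu) le_rfl
  rw [eLpNorm_one_eq_lintegral_enorm, eLpNorm_one_eq_lintegral_enorm] at hpoin
  unfold faceMeasure
  rw [← setAverage_sub_const hF0 hFt hui]
  refine (enorm_setAverage_le _).trans ?_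
  have h1 := lintegral_face_le hd hT hz hu m
  calc ((μHE[d - 1] : Measure (E d)) F)⁻¹ * ∫⁻ x, ‖u x - m‖ₑ ∂faceMeasure (T.erase z)
      ≤ ((μHE[d - 1] : Measure (E d)) F)⁻¹ * (traceConst T (T.erase z) *
          ((2 ^ d * D * ∫⁻ x in hull T, ‖gradient u x‖ₑ) +
            D * ∫⁻ x in hull T, ‖gradient u x‖ₑ)) := by
        gcongr 1
        refine h1.trans ?_
        gcongr
    _ = _ := by
        rw [traceConst, ENNReal.div_eq_inv_mul]
        have : ((μHE[d - 1] : Measure (E d)) F)⁻¹ * (μHE[d - 1] : Measure (E d)) F = 1 :=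
          ENNReal.inv_mul_cancel hF0 hFt
        calc _ = (((μHE[d - 1] : Measure (E d)) F)⁻¹ * (μHE[d - 1] : Measure (E d)) F) *
              (2 ^ d * (2 ^ d + 1) * (D * ((volume (hull T))⁻¹ *
                ∫⁻ x in hull T, ‖gradient u x‖ₑ))) := by ring
          _ = _ := by rw [this, one_mul]

end Trace

/-! ### Simplices and pairs of adjacent simplices are strictly star-shaped -/

/-- The centroid of a finite set of points. -/
def center (F : Finset (E d)) : E d := ∑ w ∈ F, (F.card : ℝ)⁻¹ • w

theorem sum_center_weights {F : Finset (E d)} (hF : F.Nonempty) :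
    ∑ _w ∈ F, (F.card : ℝ)⁻¹ = 1 := by
  have : (F.card : ℝ) ≠ 0 := by exact_mod_cast hF.card_pos.ne'
  rw [Finset.sum_const, nsmul_eq_mul, mul_inv_cancel₀ this]

theorem center_mem_hull {F : Finset (E d)} (hF : F.Nonempty) : center F ∈ hull F :=
  mem_hull_iff_exists.2 ⟨fun _ => (F.card : ℝ)⁻¹, fun _ _ => by positivity,
    sum_center_weights hF, rfl⟩

theorem hasWeakGradient_mono {O O' : Set (E d)} {v : E d → ℝ} {g : E d → E d} (hO : O' ⊆ O)
    (hOm : MeasurableSet O) (h : HasWeakGradient O v g) :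
    HasWeakGradient O' v g := by
  intro φ hφ hφc hφs i
  have h1 := h φ hφ hφc (hφs.trans hO) i
  have hzero : ∀ x ∉ O', φ x = 0 := fun x hx => image_eq_zero_of_notMem_tsupport fun h' => hx (hφs h')
  have hzero' : ∀ x ∉ O', fderiv ℝ φ x = 0 := fun x hx =>
    image_eq_zero_of_notMem_tsupport fun h' => hx (hφs (tsupport_fderiv_subset ℝ h'))
  rw [setIntegral_eq_of_subset_of_forall_sdiff_eq_zero hOm hO fun x hx => by
    rw [hzero' x hx.2]; simp] at h1
  rw [h1, setIntegral_eq_of_subset_of_forall_sdiff_eq_zero hOm hO fun x hx => by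
    rw [hzero x hx.2]; simp]

theorem volume_hull_sdiff_interior (T : Finset (E d)) : volume (hull T \ interior (hull T)) = 0 := by
  have := (convex_hull' T).addHaar_frontier volume
  rwa [(isClosed_hull T).frontier_eq] at this

namespace IsSimplex

variable {T : Finset (E d)} (hT : IsSimplex T)
include hT

theorem coord_add_smul_sub (z b x : E d) (l : ℝ) :
    hT.coord z (b + l • (x - b)) = (1 - l) * hT.coord z b + l * hT.coord z x := by
  have h1 := hT.coord_sub z b (b + l • (x - b))
  have h2 := hT.coord_sub z b x
  rw [add_sub_cancel_left, inner_smul_right] at h1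
  linear_combination h1 - l * h2

theorem coord_center {F : Finset (E d)} (hF : F ⊆ T) {w : E d} (hw : w ∈ F) :
    hT.coord w (center F) = (F.card : ℝ)⁻¹ := by
  rw [center, affineMap_sum_smul _ _ _ (sum_center_weights ⟨w, hw⟩), Finset.sum_eq_single w]
  · rw [hT.coord_self (hF hw), mul_one]
  · intro y hy hne
    rw [hT.coord_ne (hF hy) hne.symm, mul_zero]
  · exact fun h => (h hw).elim

/-- A simplex is strictly star-shaped about its center. -/
theorem center_add_mem_interior {x : E d} (hx : x ∈ hull T) {l : ℝ} (hl : l ∈ Set.Ioo (0 : ℝ) 1) :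
    center T + l • (x - center T) ∈ interior (hull T) := by
  refine hT.mem_interior_hull_iff.2 fun w hw => ?_
  rw [hT.coord_add_smul_sub, hT.coord_center subset_rfl hw]
  have h1 : 0 < 1 - l := by linarith [hl.2]
  have h2 : (0 : ℝ) < T.card := by exact_mod_cast hT.nonempty.card_pos
  have h3 := mul_nonneg hl.1.le (hT.coord_nonneg hx w)
  have h4 : 0 < (1 - l) * (T.card : ℝ)⁻¹ := by positivity
  linarith

/-- `W^{1,1}` functions on a simplex are limits of smooth functions. -/
theorem exists_approx {v : E d → ℝ} {g : E d → E d} (hv : IntegrableOn v (hull T))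
    (hg : IntegrableOn g (hull T)) (hw : HasWeakGradient (interior (hull T)) v g) :
    ∃ u, IsC1Approx (hull T) v g u :=
  exists_isC1Approx (isCompact_hull T) (volume_hull_sdiff_interior T)
    (fun _ hx _ hl => hT.center_add_mem_interior hx hl) hv hg hw

end IsSimplex

open scoped Classical in
/-- Two nondegenerate simplices that share the face opposite to `z` and `z'`, respectively, and have
no other points in common. -/
structure Adjacent (T T' : Finset (E d)) (z z' : E d) : Prop where
  simplex : IsSimplex T
  simplex' : IsSimplex T'
  mem : z ∈ T
  mem' : z' ∈ T'
  erase_eq : T.erase z = T'.erase z'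
  inter_subset : hull T ∩ hull T' ⊆ hull (T.erase z)

namespace Adjacent

variable {T T' : Finset (E d)} {z z' : E d}

theorem symm (h : Adjacent T T' z z') : Adjacent T' T z' z :=
  ⟨h.simplex', h.simplex, h.mem', h.mem, h.erase_eq.symm, by
    rw [Set.inter_comm, ← h.erase_eq]; exact h.inter_subset⟩

open scoped Classical in
/-- The barycentric coordinates of the two opposite vertices are proportional, since both are affine
and vanish on the common face. -/
theorem coord_apply_eq (h : Adjacent T T' z z') (y : E d) :
    h.simplex.coord z y = h.simplex'.coord z' y * h.simplex.coord z z' := by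
  conv_lhs => rw [← h.simplex'.sum_coord_smul y]
  rw [affineMap_sum_smul _ _ _ (h.simplex'.sum_coord y), Finset.sum_eq_single z']
  · intro w hw hne
    have : w ∈ T.erase z := by rw [h.erase_eq]; exact Finset.mem_erase.2 ⟨hne, hw⟩
    rw [h.simplex.coord_ne (Finset.mem_of_mem_erase this) (Finset.ne_of_mem_erase this).symm,
      mul_zero]
  · exact fun h' => (h' h.mem').elim

open scoped Classical in
theorem erase_nonempty (h : Adjacent T T' z z') (hd : d ≠ 0) : (T.erase z).Nonempty := by
  rw [← Finset.card_pos, Finset.card_erase_of_mem h.mem, h.simplex.1]; omega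

open scoped Classical in
/-- The vertices opposite to the common face lie on different sides of it. -/
theorem coord_opposite_neg (h : Adjacent T T' z z') (hd : d ≠ 0) : h.simplex.coord z z' < 0 := by
  by_contra! hneg
  set F := T.erase z with hF
  have hFn := h.erase_nonempty hd
  set c := center F
  have hcF : c ∈ hull F := center_mem_hull hFn
  have hFT' : F ⊆ T' := by rw [hF, h.erase_eq]; exact T'.erase_subset z'
  have hc0 : 0 < (F.card : ℝ)⁻¹ := by
    have := hFn.card_pos
    positivity
  -- a point of the second simplex close to the common face lies in the first simplex, too
  have hev : ∀ᶠ ε : ℝ in 𝓝[>] 0, ∀ w ∈ F, 0 < h.simplex.coord w (c + ε • (z' - c)) := by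
    refine (Finset.eventually_all F).2 fun w hw => ?_
    have hcont : Continuous fun ε : ℝ => h.simplex.coord w (c + ε • (z' - c)) :=
      (continuous_affine _).comp (by fun_prop)
    have h0 : 0 < h.simplex.coord w (c + (0 : ℝ) • (z' - c)) := by
      rw [zero_smul, add_zero, h.simplex.coord_center (T.erase_subset z) hw]; exact hc0
    exact nhdsWithin_le_nhds (hcont.continuousAt.eventually_const_lt h0)
  obtain ⟨ε, hε, hε0, hε1⟩ := (hev.and (Ioo_mem_nhdsGT zero_lt_one)).exists
  have hq' : c + ε • (z' - c) ∈ hull T' :=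
    (convex_hull' T').add_smul_sub_mem (hull_mono hFT' hcF) (subset_hull T' h.mem') ⟨hε0.le, hε1.le⟩
  have hq : c + ε • (z' - c) ∈ hull T := by
    refine h.simplex.mem_hull_iff.2 fun w hw => ?_
    rcases eq_or_ne w z with rfl | hne
    · rw [h.simplex.coord_add_smul_sub, (h.simplex.mem_hull_erase_iff.1 hcF).2, mul_zero, zero_add]
      exact mul_nonneg hε0.le hneg
    · exact (hε w (Finset.mem_erase.2 ⟨hne, hw⟩)).le
  have := h.inter_subset ⟨hq, hq'⟩
  rw [h.erase_eq] at this
  have h0 := (h.simplex'.mem_hull_erase_iff.1 this).2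
  rw [h.simplex'.coord_add_smul_sub, h.simplex'.coord_self h.mem',
    (h.simplex'.mem_hull_erase_iff.1 (by rw [← h.erase_eq]; exact hcF)).2] at h0
  linarith

open scoped Classical in
/-- A point of the first simplex whose barycentric coordinates belonging to the common face are
positive is interior to the union. -/
theorem mem_interior_union (h : Adjacent T T' z z') (hd : d ≠ 0) {q : E d}
    (hq : ∀ w ∈ T.erase z, 0 < h.simplex.coord w q) (hqz : 0 ≤ h.simplex.coord z q) :
    q ∈ interior (hull T ∪ hull T') := by
  rcases hqz.lt_or_eq with hpos | hzero
  · refine interior_mono Set.subset_union_left (h.simplex.mem_interior_hull_iff.2 fun w hw => ?_)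
    rcases eq_or_ne w z with rfl | hne
    · exact hpos
    · exact hq w (Finset.mem_erase.2 ⟨hne, hw⟩)
  · have hqF : q ∈ hull (T.erase z) := by
      refine h.simplex.mem_hull_erase_iff.2 ⟨h.simplex.mem_hull_iff.2 fun w hw => ?_, hzero.symm⟩
      rcases eq_or_ne w z with rfl | hne
      · exact hzero.le
      · exact (hq w (Finset.mem_erase.2 ⟨hne, hw⟩)).le
    have hq' : ∀ w ∈ T.erase z, 0 < h.simplex'.coord w q := by
      intro w hw
      have e : h.simplex.coord w q = h.simplex'.coord w q := by
        obtain ⟨b, -, hb1, hb2⟩ := mem_hull_iff_exists.1 hqF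
        rw [← hb2, affineMap_sum_smul _ _ _ hb1, affineMap_sum_smul _ _ _ hb1]
        refine Finset.sum_congr rfl fun y hy => ?_
        have hy' : y ∈ T'.erase z' := h.erase_eq ▸ hy
        rcases eq_or_ne w y with rfl | hne
        · rw [h.simplex.coord_self (Finset.mem_of_mem_erase hy),
            h.simplex'.coord_self (Finset.mem_of_mem_erase hy')]
        · rw [h.simplex.coord_ne (Finset.mem_of_mem_erase hy) hne,
            h.simplex'.coord_ne (Finset.mem_of_mem_erase hy') hne]
      rw [← e]; exact hq w hw
    have hev : ∀ᶠ y in 𝓝 q, ∀ w ∈ T.erase z,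
        0 < h.simplex.coord w y ∧ 0 < h.simplex'.coord w y :=
      (Finset.eventually_all _).2 fun w hw =>
        ((continuous_affine _).continuousAt.eventually_const_lt (hq w hw)).and
          ((continuous_affine _).continuousAt.eventually_const_lt (hq' w hw))
    refine mem_interior_iff_mem_nhds.2 (mem_of_superset hev fun y hy => ?_)
    rcases le_or_gt 0 (h.simplex.coord z y) with hz0 | hz0
    · refine Or.inl (h.simplex.mem_hull_iff.2 fun w hw => ?_)
      rcases eq_or_ne w z with rfl | hne
      · exact hz0
      · exact (hy w (Finset.mem_erase.2 ⟨hne, hw⟩)).1.le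
    · refine Or.inr (h.simplex'.mem_hull_iff.2 fun w hw => ?_)
      rcases eq_or_ne w z' with rfl | hne
      · rw [h.coord_apply_eq] at hz0
        exact (pos_of_mul_neg_left hz0 (h.coord_opposite_neg hd).le).le
      · have : w ∈ T.erase z := by rw [h.erase_eq]; exact Finset.mem_erase.2 ⟨hne, hw⟩
        exact (hy w this).2.le

open scoped Classical in
theorem center_add_mem_interior (h : Adjacent T T' z z') (hd : d ≠ 0) {x : E d} (hx : x ∈ hull T)
    {l : ℝ} (hl : l ∈ Set.Ioo (0 : ℝ) 1) :
    center (T.erase z) + l • (x - center (T.erase z)) ∈ interior (hull T ∪ hull T') := by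
  have hFn := h.erase_nonempty hd
  have hc0 : 0 < ((T.erase z).card : ℝ)⁻¹ := by
    have := hFn.card_pos
    positivity
  refine h.mem_interior_union hd (fun w hw => ?_) ?_
  · rw [h.simplex.coord_add_smul_sub, h.simplex.coord_center (T.erase_subset z) hw]
    have h1 : 0 < 1 - l := by linarith [hl.2]
    have h3 := mul_nonneg hl.1.le (h.simplex.coord_nonneg hx w)
    have h4 := mul_pos h1 hc0
    linarith
  · rw [h.simplex.coord_add_smul_sub, (h.simplex.mem_hull_erase_iff.1 (center_mem_hull hFn)).2,
      mul_zero, zero_add]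
    exact mul_nonneg hl.1.le (h.simplex.coord_nonneg hx z)

/-- `W^{1,1}` functions on the union of two adjacent simplices are limits of smooth functions. -/
theorem exists_approx (h : Adjacent T T' z z') (hd : d ≠ 0) {v : E d → ℝ} {g : E d → E d}
    (hv : IntegrableOn v (hull T ∪ hull T')) (hg : IntegrableOn g (hull T ∪ hull T'))
    (hw : HasWeakGradient (interior (hull T ∪ hull T')) v g) :
    ∃ u, IsC1Approx (hull T ∪ hull T') v g u := by
  classical
  refine exists_isC1Approx ((isCompact_hull T).union (isCompact_hull T')) ?_
    (b := center (T.erase z)) ?_ hv hg hw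
  · refine measure_mono_null (t := (hull T \ interior (hull T)) ∪ (hull T' \ interior (hull T')))
      ?_ (measure_union_null (volume_hull_sdiff_interior T) (volume_hull_sdiff_interior T'))
    rintro x ⟨hx | hx, hxi⟩
    · exact Or.inl ⟨hx, fun h' => hxi (interior_mono Set.subset_union_left h')⟩
    · exact Or.inr ⟨hx, fun h' => hxi (interior_mono Set.subset_union_right h')⟩
  · rintro x (hx | hx) l hl
    · exact h.center_add_mem_interior hd hx hl
    · have := h.symm.center_add_mem_interior hd hx hl
      rw [Set.union_comm, h.erase_eq]
      exact this

end Adjacent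

/-- The quantity `diam(T) |T|⁻¹ ∫_T |g|`. -/
def meanGrad (T : Finset (E d)) (g : E d → E d) : ℝ≥0∞ :=
  ENNReal.ofReal (Metric.diam (hull T)) * ((volume (hull T))⁻¹ * ∫⁻ x in hull T, ‖g x‖ₑ)

theorem meanGrad_le_add {T : Finset (E d)} {g : E d → E d} (hg : IntegrableOn g (hull T))
    (G : E d → E d) : meanGrad T G ≤ meanGrad T g + meanGrad T (fun x => G x - g x) := by
  rw [meanGrad, meanGrad, meanGrad, ← mul_add, ← mul_add,
    ← lintegral_add_left' hg.aestronglyMeasurable.enorm]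
  gcongr with x
  calc ‖G x‖ₑ = ‖g x + (G x - g x)‖ₑ := by congr 1; abel
    _ ≤ _ := enorm_add_le _ _

theorem tendsto_meanGrad_sub {T : Finset (E d)} (hT : IsSimplex T) {v : E d → ℝ} {g : E d → E d}
    {u : ℕ → E d → ℝ} (hu : IsC1Approx (hull T) v g u) :
    Tendsto (fun n => meanGrad T (fun x => gradient (u n) x - g x)) atTop (𝓝 0) := by
  have h1 := ENNReal.Tendsto.const_mul (a := (volume (hull T))⁻¹) hu.tendsto_gradient
    (Or.inr (ENNReal.inv_ne_top.2 hT.volume_pos.ne'))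
  have h2 := ENNReal.Tendsto.const_mul (a := ENNReal.ofReal (Metric.diam (hull T))) h1
    (Or.inr ENNReal.ofReal_ne_top)
  simpa [meanGrad] using h2

theorem tendsto_enorm_average_sub {T : Finset (E d)} (hT : IsSimplex T) {v : E d → ℝ}
    {g : E d → E d} (hv : IntegrableOn v (hull T)) {u : ℕ → E d → ℝ}
    (hu : IsC1Approx (hull T) v g u) :
    Tendsto (fun n => ‖(⨍ x in hull T, v x) - ⨍ x in hull T, u n x‖ₑ) atTop (𝓝 0) := by
  have h1 := ENNReal.Tendsto.const_mul (a := (volume (hull T))⁻¹) hu.tendsto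
    (Or.inr (ENNReal.inv_ne_top.2 hT.volume_pos.ne'))
  rw [mul_zero] at h1
  refine tendsto_of_tendsto_of_tendsto_of_le_of_le tendsto_const_nhds h1 (fun _ => zero_le)
    fun n => ?_
  rw [← enorm_neg, neg_sub,
    ← setAverage_sub (integrableOn_hull_of_continuous (hu.contDiff n).continuous T) hv]
  exact enorm_setAverage_le _

/-- The means of a Sobolev function over two adjacent simplices are compared with each other by means
of the trace on the common face. -/
theorem Adjacent.enorm_average_sub_le {T T' : Finset (E d)} {z z' : E d} (h : Adjacent T T' z z')
    (hd : d ≠ 0) {v : E d → ℝ} {g : E d → E d}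
    (hv : IntegrableOn v (hull T ∪ hull T')) (hg : IntegrableOn g (hull T ∪ hull T'))
    (hw : HasWeakGradient (interior (hull T ∪ hull T')) v g) :
    ‖(⨍ x in hull T, v x) - ⨍ x in hull T', v x‖ₑ ≤
      2 ^ d * (2 ^ d + 1) * (meanGrad T g + meanGrad T' g) := by
  classical
  obtain ⟨u, hu⟩ := h.exists_approx hd hv hg hw
  have hu1 := hu.mono (Set.subset_union_left (s := hull T) (t := hull T'))
  have hu2 := hu.mono (Set.subset_union_right (s := hull T) (t := hull T'))
  have hg1 := hg.mono_set (Set.subset_union_left (s := hull T) (t := hull T'))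
  have hg2 := hg.mono_set (Set.subset_union_right (s := hull T) (t := hull T'))
  set C : ℝ≥0∞ := 2 ^ d * (2 ^ d + 1) with hC
  have hCt : C ≠ ⊤ := by
    rw [hC]; exact ENNReal.mul_ne_top (by simp) (by simp)
  have hn : ∀ n, ‖(⨍ x in hull T, v x) - ⨍ x in hull T', v x‖ₑ ≤
      C * (meanGrad T g + meanGrad T' g) +
      (‖(⨍ x in hull T, v x) - ⨍ x in hull T, u n x‖ₑ +
        ‖(⨍ x in hull T', v x) - ⨍ x in hull T', u n x‖ₑ +
        C * (meanGrad T (fun x => gradient (u n) x - g x) +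
          meanGrad T' (fun x => gradient (u n) x - g x))) := by
    intro n
    have h1 := enorm_average_face_sub_le hd h.simplex h.mem (hu.contDiff n)
    have h2 := enorm_average_face_sub_le hd h.simplex' h.mem' (hu.contDiff n)
    rw [← h.erase_eq] at h2
    set a := ⨍ x in hull T, v x
    set a' := ⨍ x in hull T', v x
    set b := ⨍ x in hull T, u n x
    set b' := ⨍ x in hull T', u n x
    set f := ⨍ x, u n x ∂faceMeasure (T.erase z)
    calc ‖a - a'‖ₑ = ‖((a - b) - (a' - b')) + ((f - b') - (f - b))‖ₑ := by congr 1; ring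
      _ ≤ (‖a - b‖ₑ + ‖a' - b'‖ₑ) + (‖f - b'‖ₑ + ‖f - b‖ₑ) :=
          (enorm_add_le _ _).trans (add_le_add enorm_sub_le enorm_sub_le)
      _ ≤ (‖a - b‖ₑ + ‖a' - b'‖ₑ) + (C * meanGrad T' (gradient (u n)) +
            C * meanGrad T (gradient (u n))) := by
          gcongr
          · exact h2
          · exact h1
      _ ≤ (‖a - b‖ₑ + ‖a' - b'‖ₑ) +
            (C * (meanGrad T' g + meanGrad T' (fun x => gradient (u n) x - g x)) +
            C * (meanGrad T g + meanGrad T (fun x => gradient (u n) x - g x))) := by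
          gcongr
          · exact meanGrad_le_add hg2 _
          · exact meanGrad_le_add hg1 _
      _ = _ := by ring
  have h3 := ((tendsto_enorm_average_sub h.simplex
    (hv.mono_set (Set.subset_union_left (s := hull T) (t := hull T'))) hu1).add
    (tendsto_enorm_average_sub h.simplex'
    (hv.mono_set (Set.subset_union_right (s := hull T) (t := hull T'))) hu2)).add
    (ENNReal.Tendsto.const_mul ((tendsto_meanGrad_sub h.simplex hu1).add
      (tendsto_meanGrad_sub h.simplex' hu2)) (Or.inr hCt))
  have h4 := h3.const_add (C * (meanGrad T g + meanGrad T' g))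
  simp only [add_zero, mul_zero] at h4
  exact ge_of_tendsto h4 (Eventually.of_forall hn)

/-! ### Conforming triangulations and nodal basis functions -/

namespace IsTriangulation

variable {Ω : Set (E d)} {𝒯 : Finset (Finset (E d))} (h𝒯 : IsTriangulation Ω 𝒯)
include h𝒯

theorem isSimplex {T : Finset (E d)} (hT : T ∈ 𝒯) : IsSimplex T :=
  ⟨h𝒯.card_eq T hT, h𝒯.affineIndependent T hT⟩

open scoped Classical in
theorem hull_inter {S T : Finset (E d)} (hS : S ∈ 𝒯) (hT : T ∈ 𝒯) :
    hull S ∩ hull T = hull (S ∩ T) := by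
  rw [h𝒯.conforming S hS T hT, hull, Finset.coe_inter]

/-- A node contained in an element is a vertex of this element. -/
theorem mem_of_mem_hull {S T : Finset (E d)} (hS : S ∈ 𝒯) (hT : T ∈ 𝒯) {x : E d} (hx : x ∈ S)
    (hxT : x ∈ hull T) : x ∈ T := by
  classical
  have h : x ∈ hull (S ∩ T) := by
    rw [← h𝒯.hull_inter hS hT]; exact ⟨subset_hull S hx, hxT⟩
  by_contra hn
  have h0 := ((h𝒯.isSimplex hS).mem_hull_subset_iff Finset.inter_subset_left).1 h |>.2 x
    (fun h' => hn (Finset.mem_inter.1 h').2)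
  rw [(h𝒯.isSimplex hS).coord_self hx] at h0
  exact one_ne_zero h0

/-- The barycentric coordinates of a point do not depend on the element containing it. -/
theorem coord_eq {S T : Finset (E d)} (hS : S ∈ 𝒯) (hT : T ∈ 𝒯) {y : E d} (hyS : y ∈ hull S)
    (hyT : y ∈ hull T) (z : E d) : (h𝒯.isSimplex hS).coord z y = (h𝒯.isSimplex hT).coord z y := by
  classical
  have h : y ∈ hull (S ∩ T) := by rw [← h𝒯.hull_inter hS hT]; exact ⟨hyS, hyT⟩
  have h0 : ∀ z, z ∉ S ∩ T → (h𝒯.isSimplex hT).coord z y = 0 :=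
    (((h𝒯.isSimplex hT).mem_hull_subset_iff Finset.inter_subset_right).1 h).2
  by_cases hz : z ∈ S
  · refine (h𝒯.isSimplex hS).coord_eq_of_sum (w := fun z => (h𝒯.isSimplex hT).coord z y) ?_ ?_ hz
    · rw [← (h𝒯.isSimplex hT).sum_coord y]
      rw [← Finset.sum_subset (Finset.inter_subset_left (s₁ := S) (s₂ := T)) fun z _ hz => h0 z hz]
      exact Finset.sum_subset Finset.inter_subset_right fun z _ hz => h0 z hz
    · conv_rhs => rw [← (h𝒯.isSimplex hT).sum_coord_smul y]
      rw [← Finset.sum_subset (Finset.inter_subset_left (s₁ := S) (s₂ := T))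
        fun z _ hz => by simp [h0 z hz]]
      exact Finset.sum_subset Finset.inter_subset_right fun z _ hz => by simp [h0 z hz]
  · rw [h0 z fun h' => hz (Finset.mem_inter.1 h').1, (h𝒯.isSimplex hS).coord_of_notMem hz]; rfl

theorem nodalBasis_eq {T : Finset (E d)} (hT : T ∈ 𝒯) {y : E d} (hy : y ∈ hull T) (x : E d) :
    nodalBasis 𝒯 x y = (h𝒯.isSimplex hT).coord x y := by
  have h : ∃ w : E d → ℝ, ∃ T ∈ 𝒯, IsBarycentric T y w :=
    ⟨_, T, hT, (h𝒯.isSimplex hT).isBarycentric_coord hy⟩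
  rw [nodalBasis, dif_pos h]
  obtain ⟨S, hS, hw⟩ := h.choose_spec
  have hyS : y ∈ hull S := mem_hull_iff_exists.2 ⟨_, hw.1, hw.2.2.1, hw.2.2.2⟩
  rw [(h𝒯.isSimplex hS).eq_coord_of_isBarycentric hw, h𝒯.coord_eq hS hT hyS hy]

omit h𝒯 in
theorem mem_nodes {x : E d} : x ∈ nodes 𝒯 ↔ ∃ T ∈ 𝒯, x ∈ T := by
  simp [nodes]

theorem interp_eq {T : Finset (E d)} (hT : T ∈ 𝒯) (v : E d → ℝ) {y : E d} (hy : y ∈ hull T) :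
    interp 𝒯 v y = ∑ x ∈ T, (⨍ z in patch 𝒯 {x}, v z) * (h𝒯.isSimplex hT).coord x y := by
  rw [interp]
  simp_rw [h𝒯.nodalBasis_eq hT hy]
  refine (Finset.sum_subset (fun x hx => mem_nodes.2 ⟨T, hT, hx⟩) fun x _ hx => ?_).symm
  rw [(h𝒯.isSimplex hT).coord_of_notMem hx]; simp

theorem mem_patch_singleton {x y : E d} (hx : x ∈ nodes 𝒯) :
    y ∈ patch 𝒯 {x} ↔ ∃ T ∈ 𝒯, x ∈ T ∧ y ∈ hull T := by
  obtain ⟨S, hS, hxS⟩ := mem_nodes.1 hx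
  simp only [patch, Set.mem_iUnion, exists_prop, Set.inter_singleton_nonempty]
  refine exists_congr fun T => and_congr_right fun hT => and_congr_left fun _ => ?_
  exact ⟨fun h => h𝒯.mem_of_mem_hull hS hT hxS h, fun h => subset_hull T h⟩

omit h𝒯 in
theorem hull_subset_patch {S T : Finset (E d)} (hS : S ∈ 𝒯) {x : E d} (hx : x ∈ S) (hxT : x ∈ T) :
    hull S ⊆ patch 𝒯 (hull T) := by
  intro y hy
  simp only [patch, Set.mem_iUnion]
  exact ⟨S, hS, ⟨x, subset_hull S hx, subset_hull T hxT⟩, hy⟩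

theorem patch_singleton_subset {T : Finset (E d)} (hT : T ∈ 𝒯) {x : E d} (hx : x ∈ T) :
    patch 𝒯 {x} ⊆ patch 𝒯 (hull T) := by
  intro y hy
  obtain ⟨S, hS, hxS, hyS⟩ := (h𝒯.mem_patch_singleton (mem_nodes.2 ⟨T, hT, hx⟩)).1 hy
  exact hull_subset_patch hS hxS hx hyS

theorem hull_subset_patch_singleton {T : Finset (E d)} (hT : T ∈ 𝒯) {x : E d} (hx : x ∈ T) :
    hull T ⊆ patch 𝒯 {x} := fun _ hy =>
  (h𝒯.mem_patch_singleton (mem_nodes.2 ⟨T, hT, hx⟩)).2 ⟨T, hT, hx, hy⟩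

omit h𝒯 in
theorem volume_patch_lt_top (A : Set (E d)) : volume (patch 𝒯 A) < ⊤ := by
  refine (measure_mono (t := ⋃ T ∈ 𝒯, hull T) ?_).trans_lt
    (measure_biUnion_lt_top 𝒯.finite_toSet fun T _ => volume_hull_lt_top T)
  exact Set.iUnion₂_mono fun T _ => Set.iUnion_subset fun _ => subset_rfl

theorem hull_subset_closure {T : Finset (E d)} (hT : T ∈ 𝒯) : hull T ⊆ closure Ω := by
  rw [← h𝒯.iUnion_eq]; exact Set.subset_biUnion_of_mem (u := fun T => hull T) hT

theorem patch_subset_closure (A : Set (E d)) : patch 𝒯 A ⊆ closure Ω := by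
  rw [← h𝒯.iUnion_eq]
  exact Set.iUnion₂_mono fun T _ => Set.iUnion_subset fun _ => subset_rfl

theorem interior_hull_subset (hΩ : IsPolyhedralDomain Ω) {T : Finset (E d)} (hT : T ∈ 𝒯) :
    interior (hull T) ⊆ Ω := by
  have := interior_mono (h𝒯.hull_subset_closure hT)
  rwa [hΩ.interior_closure] at this

theorem interior_union_subset (hΩ : IsPolyhedralDomain Ω) {S T : Finset (E d)} (hS : S ∈ 𝒯)
    (hT : T ∈ 𝒯) : interior (hull S ∪ hull T) ⊆ Ω := by
  have := interior_mono (Set.union_subset (h𝒯.hull_subset_closure hS) (h𝒯.hull_subset_closure hT))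
  rwa [hΩ.interior_closure] at this

/-- The boundary of the domain is a null set. -/
theorem ae_eq_closure (hΩ : IsPolyhedralDomain Ω) : (Ω : Set (E d)) =ᵐ[volume] closure Ω := by
  refine subset_closure.eventuallyLE.antisymm (ae_le_set.2 ?_)
  refine measure_mono_null (t := ⋃ T ∈ 𝒯, (hull T \ interior (hull T))) ?_
    ((measure_biUnion_null_iff 𝒯.countable_toSet).2 fun T _ => volume_hull_sdiff_interior T)
  rintro x ⟨hx, hxΩ⟩
  rw [← h𝒯.iUnion_eq, Set.mem_iUnion₂] at hx
  obtain ⟨T, hT, hxT⟩ := hx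
  exact Set.mem_biUnion hT ⟨hxT, fun h => hxΩ (h𝒯.interior_hull_subset hΩ hT h)⟩

theorem restrict_eq (hΩ : IsPolyhedralDomain Ω) :
    (volume : Measure (E d)).restrict Ω = volume.restrict (closure Ω) :=
  Measure.restrict_congr_set (h𝒯.ae_eq_closure hΩ)

theorem restrict_patch_le (hΩ : IsPolyhedralDomain Ω) (A : Set (E d)) :
    (volume : Measure (E d)).restrict (patch 𝒯 A) ≤ volume.restrict Ω := by
  rw [h𝒯.restrict_eq hΩ]
  exact Measure.restrict_mono (h𝒯.patch_subset_closure A) le_rfl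

theorem restrict_hull_le (hΩ : IsPolyhedralDomain Ω) {T : Finset (E d)} (hT : T ∈ 𝒯) :
    (volume : Measure (E d)).restrict (hull T) ≤ volume.restrict Ω := by
  rw [h𝒯.restrict_eq hΩ]
  exact Measure.restrict_mono (h𝒯.hull_subset_closure hT) le_rfl

open scoped Classical in
theorem adjacent {S T : Finset (E d)} (hS : S ∈ 𝒯) (hT : T ∈ 𝒯) (hne : S ≠ T)
    (hcard : d ≤ (S ∩ T).card) : ∃ z z', Adjacent S T z z' := by
  have hSc := h𝒯.card_eq S hS
  have hTc := h𝒯.card_eq T hT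
  have key : ∀ A B : Finset (E d), A.card = d + 1 → B.card = d + 1 → A ≠ B → d ≤ (A ∩ B).card →
      ∃ z ∈ A, A.erase z = A ∩ B := by
    intro A B hA hB hAB hc
    have hlt : (A ∩ B).card < A.card := by
      refine Finset.card_lt_card (Finset.inter_subset_left.ssubset_of_ne fun h => hAB ?_)
      exact Finset.eq_of_subset_of_card_le (Finset.inter_eq_left.1 h) (by omega)
    obtain ⟨z, hz, hz'⟩ := Finset.exists_mem_notMem_of_card_lt_card hlt
    refine ⟨z, hz, (Finset.eq_of_subset_of_card_le (fun y hy => Finset.mem_erase.2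
      ⟨by rintro rfl; exact hz' hy, (Finset.mem_inter.1 hy).1⟩) ?_).symm⟩
    rw [Finset.card_erase_of_mem hz]; omega
  obtain ⟨z, hz, hz1⟩ := key S T hSc hTc hne hcard
  obtain ⟨z', hz', hz1'⟩ := key T S hTc hSc hne.symm (by rwa [Finset.inter_comm])
  refine ⟨z, z', h𝒯.isSimplex hS, h𝒯.isSimplex hT, hz, hz', ?_, ?_⟩
  · rw [hz1, hz1', Finset.inter_comm]
  · rw [h𝒯.hull_inter hS hT, hz1]

end IsTriangulation

/-! ### Elements sharing a node are connected through common faces -/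

/-- The elements that contain the node `x`. -/
abbrev NodeElem (𝒯 : Finset (Finset (E d))) (x : E d) := {T : Finset (E d) // T ∈ 𝒯 ∧ x ∈ T}

open scoped Classical in
/-- Two elements containing `x` are neighbours if they share at least `d` vertices. -/
def nodeGraph (𝒯 : Finset (Finset (E d))) (x : E d) : SimpleGraph (NodeElem 𝒯 x) where
  Adj S T := S ≠ T ∧ d ≤ (S.1 ∩ T.1).card
  symm := ⟨fun S T h => ⟨h.1.symm, by rw [Finset.inter_comm]; exact h.2⟩⟩
  loopless := ⟨fun S h => h.1 rfl⟩

/-- A segment from a given point that does not lie in `hull S` to a generic point avoids `hull S`, if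
`S` consists of at most `d - 1` points. -/
theorem segment_disjoint_hull {S : Finset (E d)} {a b q : E d} (ha : a ∉ hull S)
    (hb : b ∉ affineSpan ℝ (insert a (S : Set (E d)))) (hq : q ∈ segment ℝ a b) : q ∉ hull S := by
  intro hqS
  rw [segment_eq_image'] at hq
  obtain ⟨t, ht, rfl⟩ := hq
  rcases eq_or_ne t 0 with rfl | ht0
  · simp at hqS; exact ha hqS
  · refine hb ?_
    have h1 : a ∈ affineSpan ℝ (insert a (S : Set (E d))) := mem_affineSpan ℝ (Set.mem_insert _ _)
    have h2 : a + t • (b - a) ∈ affineSpan ℝ (insert a (S : Set (E d))) :=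
      affineSpan_mono ℝ (Set.subset_insert _ _) (convexHull_subset_affineSpan _ hqS)
    have h3 := AffineMap.lineMap_mem t⁻¹ h1 h2
    rw [AffineMap.lineMap_apply, vsub_eq_sub, vadd_eq_add, add_sub_cancel_left, smul_smul,
      inv_mul_cancel₀ ht0, one_smul, sub_add_cancel] at h3
    exact h3

theorem IsPolyhedralDomain.exists_preconnected {Ω : Set (E d)} (hΩ : IsPolyhedralDomain Ω) {x : E d}
    (hx : x ∈ closure Ω) {ε : ℝ} (hε : 0 < ε) :
    ∃ U ∈ 𝓝 x, U ⊆ Metric.ball x ε ∧ IsPreconnected (U ∩ Ω) := by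
  by_cases hxΩ : x ∈ Ω
  · obtain ⟨δ, hδ, hδΩ⟩ := Metric.isOpen_iff.1 hΩ.isOpen x hxΩ
    refine ⟨Metric.ball x (min ε δ), Metric.ball_mem_nhds x (lt_min hε hδ),
      Metric.ball_subset_ball (min_le_left _ _), ?_⟩
    rw [Set.inter_eq_left.2 ((Metric.ball_subset_ball (min_le_right _ _)).trans hδΩ)]
    exact (convex_ball x _).isPreconnected
  · refine hΩ.one_sided x ?_ ε hε
    rw [frontier, hΩ.isOpen.interior_eq]
    exact ⟨hx, hxΩ⟩

/-- The elements containing a given node are connected by chains of neighbours: near the node the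
domain is connected, and the union of all faces of codimension at least two does not disconnect a
ball. -/
theorem nodeGraph_preconnected {Ω : Set (E d)} {𝒯 : Finset (Finset (E d))}
    (hΩ : IsPolyhedralDomain Ω) (h𝒯 : IsTriangulation Ω 𝒯) (x : E d) :
    (nodeGraph 𝒯 x).Preconnected := by
  classical
  intro S T
  by_contra hST
  set G := nodeGraph 𝒯 x
  -- the elements reachable from `S`, and the other ones
  set 𝒜 : Finset (Finset (E d)) := 𝒯.filter fun A => ∃ h : A ∈ 𝒯 ∧ x ∈ A, G.Reachable S ⟨A, h⟩
    with h𝒜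
  set ℬ : Finset (Finset (E d)) := 𝒯.filter fun A => ∃ h : A ∈ 𝒯 ∧ x ∈ A, ¬G.Reachable S ⟨A, h⟩
    with hℬ
  have hcard : ∀ A ∈ 𝒜, ∀ B ∈ ℬ, (A ∩ B).card < d := by
    intro A hA B hB
    by_contra! hle
    obtain ⟨-, hA1, hA2⟩ := Finset.mem_filter.1 hA
    obtain ⟨-, hB1, hB2⟩ := Finset.mem_filter.1 hB
    rcases eq_or_ne A B with rfl | hne
    · exact hB2 hA2
    · exact hB2 (hA2.trans (SimpleGraph.Adj.reachable ⟨fun h => hne (congrArg Subtype.val h), hle⟩))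
  set CA : Set (E d) := ⋃ A ∈ 𝒜, hull A with hCA
  set CB : Set (E d) := ⋃ B ∈ ℬ, hull B with hCB
  have hCAc : IsClosed CA := isClosed_biUnion_finset fun A _ => isClosed_hull A
  have hCBc : IsClosed CB := isClosed_biUnion_finset fun A _ => isClosed_hull A
  -- a small ball around `x` only meets elements that contain `x`
  obtain ⟨ε, hε, hεT⟩ : ∃ ε > 0, ∀ A ∈ 𝒯, x ∉ A → Disjoint (Metric.ball x ε) (hull A) := by
    have h1 : ∀ᶠ y in 𝓝 x, ∀ A ∈ 𝒯, x ∉ A → y ∉ hull A := by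
      refine (Finset.eventually_all 𝒯).2 fun A hA => ?_
      by_cases hxA : x ∈ A
      · simp [hxA]
      · have : x ∉ hull A := fun h => hxA (h𝒯.mem_of_mem_hull S.2.1 hA S.2.2 h)
        filter_upwards [(isClosed_hull A).isOpen_compl.mem_nhds this] with y hy _ using hy
    obtain ⟨ε, hε, h⟩ := Metric.eventually_nhds_iff_ball.1 h1
    exact ⟨ε, hε, fun A hA hxA => Set.disjoint_left.2 fun y hy => h y hy A hA hxA⟩
  have hcover : ∀ y ∈ Metric.ball x ε, y ∈ Ω → y ∈ CA ∪ CB := by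
    intro y hy hyΩ
    have : y ∈ closure Ω := subset_closure hyΩ
    rw [← h𝒯.iUnion_eq, Set.mem_iUnion₂] at this
    obtain ⟨A, hA, hyA⟩ := this
    have hxA : x ∈ A := by
      by_contra hn; exact Set.disjoint_left.1 (hεT A hA hn) hy hyA
    by_cases hr : G.Reachable S ⟨A, hA, hxA⟩
    · exact Or.inl (Set.mem_biUnion (Finset.mem_filter.2 ⟨hA, ⟨hA, hxA⟩, hr⟩) hyA)
    · exact Or.inr (Set.mem_biUnion (Finset.mem_filter.2 ⟨hA, ⟨hA, hxA⟩, hr⟩) hyA)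
  have hxcl : x ∈ closure Ω := h𝒯.hull_subset_closure S.2.1 (subset_hull _ S.2.2)
  obtain ⟨U, hU, hUε, hUc⟩ := hΩ.exists_preconnected hxcl hε
  have hmeet : ∀ A ∈ 𝒯, ∀ y ∈ hull A, ∀ O ∈ 𝓝 y, (O ∩ interior (hull A)).Nonempty := by
    intro A hA y hy O hO
    rw [← (h𝒯.isSimplex hA).closure_interior] at hy
    exact mem_closure_iff_nhds.1 hy O hO
  have hUmeet : ∀ A ∈ 𝒯, x ∈ A → (U ∩ Ω ∩ hull A).Nonempty := by
    intro A hA hxA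
    obtain ⟨y, hyU, hyA⟩ := hmeet A hA x (subset_hull A hxA) U hU
    exact ⟨y, ⟨hyU, h𝒯.interior_hull_subset hΩ hA hyA⟩, interior_subset hyA⟩
  obtain ⟨p, ⟨hpU, hpΩ⟩, hpA, hpB⟩ : (U ∩ Ω ∩ (CA ∩ CB)).Nonempty := by
    refine isPreconnected_closed_iff.1 hUc CA CB hCAc hCBc (fun y hy => hcover y (hUε hy.1) hy.2)
      ?_ ?_
    · obtain ⟨y, hy, hyS⟩ := hUmeet S S.2.1 S.2.2
      exact ⟨y, hy, Set.mem_biUnion (Finset.mem_filter.2 ⟨S.2.1, S.2, SimpleGraph.Reachable.refl _⟩) hyS⟩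
    · obtain ⟨y, hy, hyT⟩ := hUmeet T T.2.1 T.2.2
      exact ⟨y, hy, Set.mem_biUnion (Finset.mem_filter.2 ⟨T.2.1, T.2, hST⟩) hyT⟩
  simp only [hCA, hCB, Set.mem_iUnion₂] at hpA hpB
  obtain ⟨A, hA, hpA⟩ := hpA
  obtain ⟨B, hB, hpB⟩ := hpB
  obtain ⟨δ, hδ, hδΩ⟩ : ∃ δ > 0, Metric.ball p δ ⊆ Ω ∩ Metric.ball x ε :=
    Metric.isOpen_iff.1 (hΩ.isOpen.inter Metric.isOpen_ball) p ⟨hpΩ, hUε hpU⟩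
  have hnull : ∀ {O N : Set (E d)}, IsOpen O → O.Nonempty → volume N = 0 → ∃ y ∈ O, y ∉ N := by
    intro O N hO hne hN
    by_contra! h
    exact (hO.measure_pos volume hne).ne' (measure_mono_null h hN)
  have hI𝒯 := fun C (hC : C ∈ 𝒜) => (Finset.mem_filter.1 hC).1
  have hI𝒯' := fun C (hC : C ∈ ℬ) => (Finset.mem_filter.1 hC).1
  -- generic points of the two unions close to `p`
  obtain ⟨a, ⟨haδ, haA⟩, haN⟩ := hnull (Metric.isOpen_ball.inter isOpen_interior)
    (hmeet A (hI𝒯 A hA) p hpA _ (Metric.ball_mem_nhds p hδ))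
    (show volume (⋃ A ∈ 𝒜, ⋃ B ∈ ℬ, hull (A ∩ B)) = 0 from
      (measure_biUnion_null_iff 𝒜.countable_toSet).2 fun A hA =>
        (measure_biUnion_null_iff ℬ.countable_toSet).2 fun B hB =>
          volume_hull_eq_zero_of_card_le (hcard A hA B hB).le)
  obtain ⟨b, ⟨hbδ, hbB⟩, hbN⟩ := hnull (Metric.isOpen_ball.inter isOpen_interior)
    (hmeet B (hI𝒯' B hB) p hpB _ (Metric.ball_mem_nhds p hδ))
    (show volume (⋃ A ∈ 𝒜, ⋃ B ∈ ℬ,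
        (affineSpan ℝ (insert a ((A ∩ B : Finset (E d)) : Set (E d))) : Set (E d))) = 0 from
      (measure_biUnion_null_iff 𝒜.countable_toSet).2 fun A hA =>
        (measure_biUnion_null_iff ℬ.countable_toSet).2 fun B hB => by
          refine Measure.addHaar_affineSubspace _ _ ?_
          have := affineSpan_ne_top_of_card_le (S := insert a (A ∩ B))
            ((Finset.card_insert_le _ _).trans (hcard A hA B hB))
          rwa [Finset.coe_insert] at this)
  have hseg : segment ℝ a b ⊆ Metric.ball p δ := (convex_ball p δ).segment_subset haδ hbδ
  obtain ⟨q, hqs, hqA, hqB⟩ : (segment ℝ a b ∩ (CA ∩ CB)).Nonempty := by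
    refine isPreconnected_closed_iff.1 (convex_segment a b).isPreconnected CA CB hCAc hCBc
      (fun y hy => hcover y (hδΩ (hseg hy)).2 (hδΩ (hseg hy)).1) ?_ ?_
    · exact ⟨a, left_mem_segment ℝ a b, Set.mem_biUnion hA (interior_subset haA)⟩
    · exact ⟨b, right_mem_segment ℝ a b, Set.mem_biUnion hB (interior_subset hbB)⟩
  simp only [hCA, hCB, Set.mem_iUnion₂] at hqA hqB
  obtain ⟨A', hA', hqA'⟩ := hqA
  obtain ⟨B', hB', hqB'⟩ := hqB
  refine segment_disjoint_hull (S := A' ∩ B') ?_ ?_ hqs ?_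
  · exact fun h => haN (Set.mem_biUnion hA' (Set.mem_biUnion hB' h))
  · exact fun h => hbN (Set.mem_biUnion hA' (Set.mem_biUnion hB' h))
  · rw [← h𝒯.hull_inter (hI𝒯 A' hA') (hI𝒯' B' hB')]; exact ⟨hqA', hqB'⟩

/-! ### Consequences of shape regularity -/

/-- The volume of the unit ball of dimension `n`. -/
def ballVol (n : ℕ) : ℝ := (volume (Metric.closedBall (0 : E n) 1)).toReal

/-- A bound for `h_T ‖∇φ‖` in a mesh with shape parameter `γ`, `φ` being a barycentric coordinate,
and for `|F| / h_T^{d-1}`, `F` being a face of `T`. -/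
def gradConst (d : ℕ) (γ : ℝ) : ℝ := max 1 (γ ^ (d - 1) * ballVol (d - 1))

/-- A bound for the number of elements containing a given node. -/
def starCard (d : ℕ) (γ : ℝ) : ℕ := ⌊γ ^ d * ballVol d⌋₊

/-- A bound for the ratio of the sizes of two elements with a common node. -/
def sizeRatio (d : ℕ) (γ : ℝ) : ℝ := (gradConst d γ * max 1 γ) ^ starCard d γ

theorem one_le_gradConst (d : ℕ) (γ : ℝ) : 1 ≤ gradConst d γ := le_max_left _ _

theorem gradConst_pos (d : ℕ) (γ : ℝ) : 0 < gradConst d γ := one_pos.trans_le (one_le_gradConst d γ)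

theorem one_le_gradConst_mul (d : ℕ) (γ : ℝ) : 1 ≤ gradConst d γ * max 1 γ :=
  one_le_mul_of_one_le_of_one_le (one_le_gradConst d γ) (le_max_left _ _)

theorem one_le_sizeRatio (d : ℕ) (γ : ℝ) : 1 ≤ sizeRatio d γ := one_le_pow₀ (one_le_gradConst_mul d γ)

theorem ballVol_nonneg (n : ℕ) : 0 ≤ ballVol n := ENNReal.toReal_nonneg

theorem volume_ball_ne_top (n : ℕ) : volume (Metric.closedBall (0 : E n) 1) ≠ ⊤ :=
  (isCompact_closedBall _ _).measure_lt_top.ne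

namespace IsSimplex

variable {T : Finset (E d)} (hT : IsSimplex T)
include hT

open scoped Classical in
theorem hausdorff_face_le_gradConst (hd : d ≠ 0) {γ : ℝ} (hγ : Metric.diam (hull T) ≤ γ * hElem T)
    {z : E d} (hz : z ∈ T) :
    (μHE[d - 1] : Measure (E d)) (hull (T.erase z)) ≤
      ENNReal.ofReal (gradConst d γ * hElem T ^ (d - 1)) := by
  refine (hT.hausdorff_face_le hd hz).trans ?_
  rw [← ENNReal.ofReal_toReal (volume_ball_ne_top (d - 1)), ← ENNReal.ofReal_mul (by positivity)]
  refine ENNReal.ofReal_le_ofReal ?_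
  change _ * ballVol (d - 1) ≤ _
  calc Metric.diam (hull T) ^ (d - 1) * ballVol (d - 1)
      ≤ (γ * hElem T) ^ (d - 1) * ballVol (d - 1) := by
        gcongr
        exact ballVol_nonneg _
    _ = (γ ^ (d - 1) * ballVol (d - 1)) * hElem T ^ (d - 1) := by rw [mul_pow]; ring
    _ ≤ _ := by
      gcongr
      · exact pow_nonneg hT.hElem_pos.le _
      · exact le_max_right _ _

theorem norm_grad_mul_hElem_le (hd : d ≠ 0) {γ : ℝ} (hγ : Metric.diam (hull T) ≤ γ * hElem T)
    {z : E d} (hz : z ∈ T) : ‖hT.grad z‖ * hElem T ≤ gradConst d γ := by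
  classical
  have h := (hT.enorm_grad_mul_volume_le hd hz).trans (hT.hausdorff_face_le_gradConst hd hγ hz)
  rw [← ENNReal.ofReal_toReal (volume_hull_lt_top T).ne, ← hElem_pow hd, ← ofReal_norm,
    ← ENNReal.ofReal_mul (norm_nonneg _),
    ENNReal.ofReal_le_ofReal_iff (mul_nonneg (gradConst_pos d γ).le (pow_nonneg hT.hElem_pos.le _))]
    at h
  have hp : hElem T ^ d = hElem T * hElem T ^ (d - 1) := by
    rw [← pow_succ', Nat.sub_add_cancel (by omega)]
  rw [hp, ← mul_assoc] at h
  exact le_of_mul_le_mul_right h (pow_pos hT.hElem_pos _)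

/-- The edges of a shape regular simplex are not short: a barycentric coordinate varies by `1` along
an edge, and its gradient is at most of the order `1 / h_T`. -/
theorem hElem_le_dist (hd : d ≠ 0) {γ : ℝ} (hγ : Metric.diam (hull T) ≤ γ * hElem T) {x y : E d}
    (hx : x ∈ T) (hy : y ∈ T) (hne : x ≠ y) : hElem T ≤ gradConst d γ * dist x y := by
  have h1 := hT.coord_sub x y x
  rw [hT.coord_self hx, hT.coord_ne hy hne, sub_zero] at h1
  have h2 : 1 ≤ ‖hT.grad x‖ * dist x y := by
    rw [dist_eq_norm, h1]; exact real_inner_le_norm _ _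
  have h3 := hT.norm_grad_mul_hElem_le hd hγ hx
  calc hElem T ≤ hElem T * (‖hT.grad x‖ * dist x y) := le_mul_of_one_le_right hT.hElem_pos.le h2
    _ = (‖hT.grad x‖ * hElem T) * dist x y := by ring
    _ ≤ _ := by gcongr

theorem one_le_enorm_grad_mul_diam (hd : d ≠ 0) {z : E d} (hz : z ∈ T) :
    1 ≤ ‖hT.grad z‖ₑ * ENNReal.ofReal (Metric.diam (hull T)) := by
  obtain ⟨y, hy, hne⟩ := hT.exists_ne_mem hd z
  have h1 := hT.coord_sub z y z
  rw [hT.coord_self hz, hT.coord_ne hy hne.symm, sub_zero] at h1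
  rw [← ofReal_norm, ← ENNReal.ofReal_mul (norm_nonneg _), ← ENNReal.ofReal_one]
  refine ENNReal.ofReal_le_ofReal ?_
  rw [h1]
  refine (real_inner_le_norm _ _).trans ?_
  gcongr
  rw [← dist_eq_norm]
  exact dist_le_diam_hull (subset_hull T hz) (subset_hull T hy)

open scoped Classical in
/-- The volume of a simplex is at most the measure of a face times the diameter. -/
theorem volume_le_face_mul_diam (hd : d ≠ 0) {z : E d} (hz : z ∈ T) :
    volume (hull T) ≤ (μHE[d - 1] : Measure (E d)) (hull (T.erase z)) *
      ENNReal.ofReal (Metric.diam (hull T)) := by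
  calc volume (hull T)
      ≤ volume (hull T) * (‖hT.grad z‖ₑ * ENNReal.ofReal (Metric.diam (hull T))) :=
        le_mul_of_one_le_right' (hT.one_le_enorm_grad_mul_diam hd hz)
    _ = (‖hT.grad z‖ₑ * volume (hull T)) * ENNReal.ofReal (Metric.diam (hull T)) := by ring
    _ ≤ _ := by gcongr; exact hT.enorm_grad_mul_volume_le hd hz

end IsSimplex

open scoped Classical in
theorem hFace_pow (hd : 2 ≤ d) (F : Finset (E d)) :
    hFace F ^ (d - 1) = ((μHE[d - 1] : Measure (E d)) (hull F)).toReal := by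
  have h : ((d - 1 : ℕ) : ℝ) = (d : ℝ) - 1 := by rw [Nat.cast_sub (by omega), Nat.cast_one]
  have h' : (d : ℝ) - 1 ≠ 0 := by rw [← h]; exact_mod_cast (by omega : d - 1 ≠ 0)
  rw [hFace, ← Real.rpow_natCast, ← Real.rpow_mul ENNReal.toReal_nonneg, h,
    one_div_mul_cancel h', Real.rpow_one]

theorem hFace_nonneg (F : Finset (E d)) : 0 ≤ hFace F := Real.rpow_nonneg ENNReal.toReal_nonneg _

open scoped Classical in
theorem IsSimplex.hElem_le_hFace {T : Finset (E d)} (hT : IsSimplex T) (hd : 2 ≤ d) {γ : ℝ}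
    (hγ : Metric.diam (hull T) ≤ γ * hElem T) (hγ1 : 1 ≤ γ) {z : E d} (hz : z ∈ T) :
    hElem T ≤ γ * hFace (T.erase z) := by
  have hd0 : d ≠ 0 := by omega
  have h := hT.volume_le_face_mul_diam hd0 hz
  have hlt := hT.hausdorff_face_lt_top hd0 hz
  rw [← ENNReal.ofReal_toReal (volume_hull_lt_top T).ne, ← hElem_pow hd0,
    ← ENNReal.ofReal_toReal hlt.ne, ← hFace_pow hd,
    ← ENNReal.ofReal_mul (pow_nonneg (hFace_nonneg _) _), ENNReal.ofReal_le_ofReal_iff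
      (mul_nonneg (pow_nonneg (hFace_nonneg _) _) Metric.diam_nonneg)] at h
  have hp : hElem T ^ d = hElem T ^ (d - 1) * hElem T := by
    rw [← pow_succ, Nat.sub_add_cancel (by omega)]
  have h2 : hElem T ^ (d - 1) ≤ hFace (T.erase z) ^ (d - 1) * γ := by
    refine le_of_mul_le_mul_right ?_ hT.hElem_pos
    rw [← hp]
    refine h.trans ?_
    rw [mul_assoc]
    exact mul_le_mul_of_nonneg_left hγ (pow_nonneg (hFace_nonneg _) _)
  refine le_of_pow_le_pow_left₀ (n := d - 1) (by omega)
    (mul_nonneg (by linarith) (hFace_nonneg _)) ?_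
  rw [mul_pow]
  calc _ ≤ _ := h2
    _ = γ * hFace (T.erase z) ^ (d - 1) := mul_comm _ _
    _ ≤ _ := by
      gcongr
      · exact pow_nonneg (hFace_nonneg _) _
      · exact le_self_pow₀ hγ1 (by omega)

namespace IsTriangulation

variable {Ω : Set (E d)} {𝒯 : Finset (Finset (E d))} (h𝒯 : IsTriangulation Ω 𝒯)
include h𝒯

theorem volume_hull_inter {S T : Finset (E d)} (hS : S ∈ 𝒯) (hT : T ∈ 𝒯) (hne : S ≠ T) :
    volume (hull S ∩ hull T) = 0 := by
  classical
  rw [h𝒯.hull_inter hS hT]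
  refine volume_hull_eq_zero_of_card_le ?_
  have hlt : (S ∩ T).card < S.card := by
    refine Finset.card_lt_card (Finset.inter_subset_left.ssubset_of_ne fun h => hne ?_)
    refine Finset.eq_of_subset_of_card_le (Finset.inter_eq_left.1 h) ?_
    rw [h𝒯.card_eq S hS, h𝒯.card_eq T hT]
  rw [h𝒯.card_eq S hS] at hlt
  omega

open scoped Classical in
/-- The number of elements containing a node is bounded: shrunk towards the node to a common volume,
they do not overlap and lie in a ball of comparable volume. -/
theorem card_filter_mem_le (hd : d ≠ 0) {γ : ℝ} (hγ0 : 0 ≤ γ) (hγ : IsShapeRegular γ 𝒯) (x : E d) :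
    (𝒯.filter (x ∈ ·)).card ≤ starCard d γ := by
  rcases (𝒯.filter (x ∈ ·)).eq_empty_or_nonempty with h0 | hne
  · rw [h0]; simp
  obtain ⟨S, hS, hmin⟩ := Finset.exists_min_image _ hElem hne
  set 𝒮 := 𝒯.filter (x ∈ ·)
  have hmem : ∀ T ∈ 𝒮, T ∈ 𝒯 ∧ x ∈ T := fun T hT => Finset.mem_filter.1 hT
  have hpos : ∀ T ∈ 𝒮, 0 < hElem T := fun T hT => (h𝒯.isSimplex (hmem T hT).1).hElem_pos
  set s := hElem S with hs
  have hs0 : 0 < s := hpos S hS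
  set A : Finset (E d) → Set (E d) := fun T => AffineMap.homothety x (s / hElem T) '' hull T with hA
  have hratio : ∀ T ∈ 𝒮, s / hElem T ≤ 1 := fun T hT => (div_le_one (hpos T hT)).2 (hmin T hT)
  have hAsub : ∀ T ∈ 𝒮, A T ⊆ hull T := by
    rintro T hT _ ⟨y, hy, rfl⟩
    rw [AffineMap.homothety_eq_lineMap]
    exact (convex_hull' T).lineMap_mem (subset_hull T (hmem T hT).2) hy
      ⟨by have := hpos T hT; positivity, hratio T hT⟩
  have hAball : ∀ T ∈ 𝒮, A T ⊆ Metric.closedBall x (s * γ) := by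
    rintro T hT _ ⟨y, hy, rfl⟩
    have hp := hpos T hT
    rw [Metric.mem_closedBall, dist_homothety_center, Real.norm_of_nonneg (by positivity)]
    calc s / hElem T * dist x y ≤ s / hElem T * (γ * hElem T) := by
          gcongr
          exact (dist_le_diam_hull (subset_hull T (hmem T hT).2) hy).trans (hγ T (hmem T hT).1)
      _ = s * γ := by field_simp
  have hAvol : ∀ T ∈ 𝒮, volume (A T) = ENNReal.ofReal (s ^ d) := by
    intro T hT
    have hp := hpos T hT
    rw [hA, Measure.addHaar_image_homothety, ← ENNReal.ofReal_toReal (volume_hull_lt_top T).ne,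
      ← hElem_pow hd, ← ENNReal.ofReal_mul (abs_nonneg _)]
    congr 1
    rw [abs_of_nonneg (by positivity)]
    simp only [finrank_euclideanSpace, Fintype.card_fin]
    rw [div_pow, div_mul_cancel₀ _ (by positivity)]
  have hAm : ∀ T ∈ 𝒮, MeasurableSet (A T) := fun T _ =>
    ((isCompact_hull T).image (AffineMap.homothety_continuous x _)).measurableSet
  have hsum : ∑ T ∈ 𝒮, volume (A T) ≤ volume (Metric.closedBall x (s * γ)) := by
    rw [← measure_biUnion_finset₀ (fun T hT T' hT' hne => ?_) fun T hT => (hAm T hT).nullMeasurableSet]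
    · exact measure_mono (Set.iUnion₂_subset hAball)
    · exact measure_mono_null (Set.inter_subset_inter (hAsub T hT) (hAsub T' hT'))
        (h𝒯.volume_hull_inter (hmem T hT).1 (hmem T' hT').1 hne)
  rw [Finset.sum_congr rfl hAvol, Finset.sum_const, nsmul_eq_mul,
    Measure.addHaar_closedBall' volume x (by positivity),
    ← ENNReal.ofReal_toReal (volume_ball_ne_top d), ← ENNReal.ofReal_mul (by positivity),
    ← ENNReal.ofReal_natCast, ← ENNReal.ofReal_mul (by positivity)] at hsum
  rw [ENNReal.ofReal_le_ofReal_iff (by positivity)] at hsum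
  simp only [finrank_euclideanSpace, Fintype.card_fin] at hsum
  refine Nat.le_floor ?_
  refine le_of_mul_le_mul_right (hsum.trans (le_of_eq ?_)) (pow_pos hs0 d)
  rw [mul_pow, ballVol]; ring

/-- A path visits each element around the node at most once. -/
theorem exists_walk_length_le (hΩ : IsPolyhedralDomain Ω) (hd : d ≠ 0) {γ : ℝ} (hγ0 : 0 ≤ γ)
    (hγ : IsShapeRegular γ 𝒯) {x : E d} (S T : NodeElem 𝒯 x) :
    ∃ p : (nodeGraph 𝒯 x).Walk S T, p.length ≤ starCard d γ := by
  classical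
  obtain ⟨p⟩ := nodeGraph_preconnected hΩ h𝒯 x S T
  let _ : Fintype (NodeElem 𝒯 x) := Fintype.subtype (𝒯.filter (x ∈ ·)) (by simp)
  refine ⟨p.bypass, p.bypass_isPath.length_lt.le.trans ?_⟩
  rw [Fintype.card_of_subtype (𝒯.filter (x ∈ ·)) (by simp)]
  exact h𝒯.card_filter_mem_le hd hγ0 hγ x

open scoped Classical in
/-- Two elements with a common edge are of comparable size. -/
theorem hElem_le_of_two_le_card (hd : d ≠ 0) {γ : ℝ} (hγ : IsShapeRegular γ 𝒯) {S T : Finset (E d)}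
    (hS : S ∈ 𝒯) (hT : T ∈ 𝒯) (hST : 2 ≤ (S ∩ T).card) :
    hElem T ≤ gradConst d γ * max 1 γ * hElem S := by
  obtain ⟨a, ha, b, hb, hab⟩ := Finset.one_lt_card.1 hST
  rw [Finset.mem_inter] at ha hb
  refine ((h𝒯.isSimplex hT).hElem_le_dist hd (hγ T hT) ha.2 hb.2 hab).trans ?_
  rw [mul_assoc]
  refine mul_le_mul_of_nonneg_left ?_ (gradConst_pos d γ).le
  refine (dist_le_diam_hull (subset_hull S ha.1) (subset_hull S hb.1)).trans ((hγ S hS).trans ?_)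
  exact mul_le_mul_of_nonneg_right (le_max_right _ _) (h𝒯.isSimplex hS).hElem_pos.le

/-- Two elements with a common node are of comparable size. -/
theorem hElem_le_sizeRatio_mul (hΩ : IsPolyhedralDomain Ω) (hd : 2 ≤ d) {γ : ℝ} (hγ0 : 0 ≤ γ)
    (hγ : IsShapeRegular γ 𝒯) {x : E d} {S T : Finset (E d)} (hS : S ∈ 𝒯) (hT : T ∈ 𝒯)
    (hxS : x ∈ S) (hxT : x ∈ T) : hElem T ≤ sizeRatio d γ * hElem S := by
  have hpos : ∀ A : NodeElem 𝒯 x, 0 ≤ hElem A.1 := fun A => (h𝒯.isSimplex A.2.1).hElem_pos.le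
  have key : ∀ {S T : NodeElem 𝒯 x} (p : (nodeGraph 𝒯 x).Walk S T),
      hElem T.1 ≤ (gradConst d γ * max 1 γ) ^ p.length * hElem S.1 := by
    intro S T p
    induction p with
    | nil => simp
    | @cons A B C h p ih =>
      rw [SimpleGraph.Walk.length_cons, pow_succ, mul_assoc]
      refine ih.trans (mul_le_mul_of_nonneg_left ?_ ?_)
      · exact h𝒯.hElem_le_of_two_le_card (by omega) hγ A.2.1 B.2.1
          (hd.trans h.2)
      · exact pow_nonneg (zero_le_one.trans (one_le_gradConst_mul d γ)) _
  obtain ⟨p, hp⟩ := h𝒯.exists_walk_length_le hΩ (by omega) hγ0 hγ (⟨S, hS, hxS⟩ : NodeElem 𝒯 x)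
    ⟨T, hT, hxT⟩
  refine (key p).trans (mul_le_mul_of_nonneg_right ?_ (h𝒯.isSimplex hS).hElem_pos.le)
  exact pow_le_pow_right₀ (one_le_gradConst_mul d γ) hp

end IsTriangulation

/-! ### Mean values over elements sharing a node -/

/-- A bound for the number by which the mean value of a function over the patch of a vertex of `T`
deviates from its mean value over `T`, relative to `h_T |T|^{-1/r} ‖∇v‖`. -/
def nodeConst (d : ℕ) (γ : ℝ) : ℝ≥0∞ :=
  starCard d γ * (2 ^ d + starCard d γ * (2 ^ d * (2 ^ d + 1) * 2)) *
    ENNReal.ofReal (γ * sizeRatio d γ ^ (d + 1))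

theorem nodeConst_ne_top (d : ℕ) (γ : ℝ) : nodeConst d γ ≠ ⊤ := by
  unfold nodeConst
  finiteness

/-- The quantity `h_T |T|^{-1/r} ‖g‖_{L^r(D_T)}`. -/
def localGrad (𝒯 : Finset (Finset (E d))) (T : Finset (E d)) (r : ℝ≥0∞) (g : E d → E d) : ℝ≥0∞ :=
  ENNReal.ofReal (hElem T) * (volume (hull T) ^ (-(r⁻¹).toReal) *
    eLpNorm g r (volume.restrict (patch 𝒯 (hull T))))

namespace IsTriangulation

variable {Ω : Set (E d)} {𝒯 : Finset (Finset (E d))} (h𝒯 : IsTriangulation Ω 𝒯)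
include h𝒯

theorem integrableOn_hull (hΩ : IsPolyhedralDomain Ω) {F : Type*} [NormedAddCommGroup F] {f : E d → F}
    (hf : IntegrableOn f Ω) {T : Finset (E d)} (hT : T ∈ 𝒯) : IntegrableOn f (hull T) :=
  Integrable.mono_measure hf (h𝒯.restrict_hull_le hΩ hT)

theorem integrableOn_patch (hΩ : IsPolyhedralDomain Ω) {F : Type*} [NormedAddCommGroup F]
    {f : E d → F} (hf : IntegrableOn f Ω) (A : Set (E d)) : IntegrableOn f (patch 𝒯 A) :=
  Integrable.mono_measure hf (h𝒯.restrict_patch_le hΩ A)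

theorem exists_isC1Approx_hull (hΩ : IsPolyhedralDomain Ω) {v : E d → ℝ} {g : E d → E d}
    (hv : IntegrableOn v Ω) (hg : IntegrableOn g Ω) (hw : HasWeakGradient Ω v g) {T : Finset (E d)}
    (hT : T ∈ 𝒯) : ∃ u, IsC1Approx (hull T) v g u :=
  (h𝒯.isSimplex hT).exists_approx (h𝒯.integrableOn_hull hΩ hv hT) (h𝒯.integrableOn_hull hΩ hg hT)
    (hasWeakGradient_mono (h𝒯.interior_hull_subset hΩ hT) hΩ.isOpen.measurableSet hw)

/-- Poincaré's inequality on an element. -/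
theorem eLpNorm_sub_average_hull_le (hΩ : IsPolyhedralDomain Ω) {v : E d → ℝ} {g : E d → E d}
    (hv : IntegrableOn v Ω) (hg : IntegrableOn g Ω) (hw : HasWeakGradient Ω v g) {T : Finset (E d)}
    (hT : T ∈ 𝒯) {r : ℝ≥0∞} (hr : 1 ≤ r) :
    eLpNorm (fun x => v x - ⨍ y in hull T, v y) r (volume.restrict (hull T)) ≤
      2 ^ d * ENNReal.ofReal (Metric.diam (hull T)) * eLpNorm g r (volume.restrict (hull T)) := by
  obtain ⟨u, hu⟩ := h𝒯.exists_isC1Approx_hull hΩ hv hg hw hT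
  exact eLpNorm_sub_setAverage_le (isCompact_hull T) (convex_hull' T) (h𝒯.isSimplex hT).volume_pos.ne'
    (fun x hx y hy => dist_le_diam_hull hy hx) (h𝒯.integrableOn_hull hΩ hv hT)
    (h𝒯.integrableOn_hull hΩ hg hT) hu hr

theorem enorm_average_sub_le_of_walk (hΩ : IsPolyhedralDomain Ω) (hd : d ≠ 0) {v : E d → ℝ}
    {g : E d → E d} (hv : IntegrableOn v Ω) (hg : IntegrableOn g Ω) (hw : HasWeakGradient Ω v g)
    {x : E d} {B : ℝ≥0∞} (hB : ∀ A : NodeElem 𝒯 x, meanGrad A.1 g ≤ B) {S T : NodeElem 𝒯 x}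
    (p : (nodeGraph 𝒯 x).Walk S T) :
    ‖(⨍ y in hull S.1, v y) - ⨍ y in hull T.1, v y‖ₑ ≤
      p.length * (2 ^ d * (2 ^ d + 1) * 2) * B := by
  induction p with
  | nil => simp
  | @cons S A T h p ih =>
    obtain ⟨z, z', hz⟩ := h𝒯.adjacent S.2.1 A.2.1 (fun h' => h.1 (Subtype.ext h')) h.2
    have h1 := hz.enorm_average_sub_le hd
      ((h𝒯.integrableOn_hull hΩ hv S.2.1).union (h𝒯.integrableOn_hull hΩ hv A.2.1))
      ((h𝒯.integrableOn_hull hΩ hg S.2.1).union (h𝒯.integrableOn_hull hΩ hg A.2.1))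
      (hasWeakGradient_mono (h𝒯.interior_union_subset hΩ S.2.1 A.2.1) hΩ.isOpen.measurableSet hw)
    calc ‖(⨍ y in hull S.1, v y) - ⨍ y in hull T.1, v y‖ₑ
        = ‖((⨍ y in hull S.1, v y) - ⨍ y in hull A.1, v y) +
            ((⨍ y in hull A.1, v y) - ⨍ y in hull T.1, v y)‖ₑ := by congr 1; ring
      _ ≤ _ := enorm_add_le _ _
      _ ≤ 2 ^ d * (2 ^ d + 1) * (B + B) + p.length * (2 ^ d * (2 ^ d + 1) * 2) * B := by
        gcongr
        exact h1.trans (by gcongr <;> exact hB _)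
      _ = _ := by
        rw [SimpleGraph.Walk.length_cons]; push_cast; ring

/-- The mean value over the patch of a node compared with the mean value over one of its elements. -/
theorem enorm_average_patch_sub_le (hΩ : IsPolyhedralDomain Ω) (hd : d ≠ 0) {γ : ℝ} (hγ0 : 0 ≤ γ)
    (hγ : IsShapeRegular γ 𝒯) {v : E d → ℝ}
    {g : E d → E d} (hv : IntegrableOn v Ω) (hg : IntegrableOn g Ω) (hw : HasWeakGradient Ω v g)
    {x : E d} {B : ℝ≥0∞} (hB : ∀ A ∈ 𝒯, x ∈ A → meanGrad A g ≤ B) {T : Finset (E d)} (hT : T ∈ 𝒯)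
    (hx : x ∈ T) :
    ‖(⨍ y in patch 𝒯 {x}, v y) - ⨍ y in hull T, v y‖ₑ ≤
      starCard d γ * (2 ^ d + starCard d γ * (2 ^ d * (2 ^ d + 1) * 2)) * B := by
  classical
  set m := ⨍ y in hull T, v y with hm
  set N : ℝ≥0∞ := ((starCard d γ : ℕ) : ℝ≥0∞) with hN
  set K : ℝ≥0∞ := 2 ^ d * (2 ^ d + 1) * 2 with hK
  have hsub := h𝒯.hull_subset_patch_singleton hT hx
  have hω0 : volume (patch 𝒯 {x}) ≠ 0 :=
    ((h𝒯.isSimplex hT).volume_pos.trans_le (measure_mono hsub)).ne'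
  have hpatch : patch 𝒯 {x} ⊆ ⋃ A ∈ 𝒯.filter (x ∈ ·), hull A := by
    intro y hy
    obtain ⟨A, hA, hxA, hyA⟩ := (h𝒯.mem_patch_singleton (mem_nodes.2 ⟨T, hT, hx⟩)).1 hy
    exact Set.mem_biUnion (Finset.mem_filter.2 ⟨hA, hxA⟩) hyA
  rw [← setAverage_sub_const hω0 (volume_patch_lt_top _).ne (h𝒯.integrableOn_patch hΩ hv _)]
  refine (enorm_setAverage_le _).trans ?_
  -- the contribution of one element of the patch
  have hone : ∀ A ∈ 𝒯.filter (x ∈ ·),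
      (volume (patch 𝒯 {x}))⁻¹ * ∫⁻ y in hull A, ‖v y - m‖ₑ ≤ (2 ^ d + N * K) * B := by
    intro A hA
    obtain ⟨hA, hxA⟩ := Finset.mem_filter.1 hA
    have hA0 := (h𝒯.isSimplex hA).volume_pos.ne'
    have hAt := (volume_hull_lt_top A).ne
    set mA := ⨍ y in hull A, v y with hmA
    have h1 : ‖mA - m‖ₑ ≤ N * K * B := by
      obtain ⟨p, hp⟩ := h𝒯.exists_walk_length_le hΩ hd hγ0 hγ (⟨A, hA, hxA⟩ : NodeElem 𝒯 x)
        ⟨T, hT, hx⟩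
      refine (h𝒯.enorm_average_sub_le_of_walk hΩ hd hv hg hw (fun A => hB A.1 A.2.1 A.2.2) p).trans ?_
      gcongr
      exact Nat.cast_le.2 hp
    have h2 : (volume (hull A))⁻¹ * ∫⁻ y in hull A, ‖v y - mA‖ₑ ≤ 2 ^ d * B := by
      have := h𝒯.eLpNorm_sub_average_hull_le hΩ hv hg hw hA le_rfl
      rw [eLpNorm_one_eq_lintegral_enorm, eLpNorm_one_eq_lintegral_enorm] at this
      calc _ ≤ (volume (hull A))⁻¹ * (2 ^ d * ENNReal.ofReal (Metric.diam (hull A)) *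
              ∫⁻ y in hull A, ‖g y‖ₑ) := by gcongr
        _ = 2 ^ d * meanGrad A g := by rw [meanGrad]; ring
        _ ≤ _ := by gcongr; exact hB A hA hxA
    calc (volume (patch 𝒯 {x}))⁻¹ * ∫⁻ y in hull A, ‖v y - m‖ₑ
        ≤ (volume (hull A))⁻¹ * ∫⁻ y in hull A, (‖v y - mA‖ₑ + ‖mA - m‖ₑ) := by
          gcongr with y
          · exact h𝒯.hull_subset_patch_singleton hA hxA
          · calc ‖v y - m‖ₑ = ‖(v y - mA) + (mA - m)‖ₑ := by congr 1; ring
              _ ≤ _ := enorm_add_le _ _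
      _ = (volume (hull A))⁻¹ * (∫⁻ y in hull A, ‖v y - mA‖ₑ) + ‖mA - m‖ₑ := by
          rw [lintegral_add_right _ measurable_const, setLIntegral_const, mul_add, mul_comm ‖mA - m‖ₑ,
            ← mul_assoc, ENNReal.inv_mul_cancel hA0 hAt, one_mul]
      _ ≤ 2 ^ d * B + N * K * B := add_le_add h2 h1
      _ = _ := by ring
  calc (volume (patch 𝒯 {x}))⁻¹ * ∫⁻ y in patch 𝒯 {x}, ‖v y - m‖ₑ
      ≤ (volume (patch 𝒯 {x}))⁻¹ * ∑ A ∈ 𝒯.filter (x ∈ ·), ∫⁻ y in hull A, ‖v y - m‖ₑ := by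
        gcongr
        refine (lintegral_mono_set hpatch).trans ?_
        rw [← Finset.sum_attach]
        simp only [← Finset.mem_coe, Set.biUnion_eq_iUnion]
        refine (lintegral_iUnion_le _ _).trans (le_of_eq ?_)
        rw [tsum_fintype]; rfl
    _ ≤ ∑ A ∈ 𝒯.filter (x ∈ ·), (2 ^ d + N * K) * B := by
        rw [Finset.mul_sum]; exact Finset.sum_le_sum hone
    _ = (𝒯.filter (x ∈ ·)).card * ((2 ^ d + N * K) * B) := by
        rw [Finset.sum_const, nsmul_eq_mul]
    _ ≤ N * ((2 ^ d + N * K) * B) := by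
        gcongr
        exact Nat.cast_le.2 (h𝒯.card_filter_mem_le hd hγ0 hγ x)
    _ = _ := by ring

/-- The normalizing factors in `L^r` means over two elements with a common node are comparable. -/
theorem volume_rpow_neg_le (hΩ : IsPolyhedralDomain Ω) (hd : 2 ≤ d) {γ : ℝ} (hγ0 : 0 ≤ γ)
    (hγ : IsShapeRegular γ 𝒯) {x : E d} {A T : Finset (E d)} (hA : A ∈ 𝒯) (hT : T ∈ 𝒯)
    (hxA : x ∈ A) (hxT : x ∈ T) {r : ℝ≥0∞} (hr : 1 ≤ r) :
    volume (hull A) ^ (-(r⁻¹).toReal) ≤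
      ENNReal.ofReal (sizeRatio d γ ^ d) * volume (hull T) ^ (-(r⁻¹).toReal) := by
  have hd0 : d ≠ 0 := by omega
  have hL := one_le_sizeRatio d γ
  have hA0 := (h𝒯.isSimplex hA).volume_pos.ne'
  have hAt := (volume_hull_lt_top A).ne
  have hT0 := (h𝒯.isSimplex hT).volume_pos.ne'
  have hTt := (volume_hull_lt_top T).ne
  set θ := (r⁻¹).toReal with hθ
  set K := ENNReal.ofReal (sizeRatio d γ ^ d) with hK
  have hθ0 : 0 ≤ θ := toReal_inv_nonneg r
  have h1 : volume (hull T) ≤ K * volume (hull A) := by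
    rw [← ENNReal.ofReal_toReal hTt, ← ENNReal.ofReal_toReal hAt, ← hElem_pow hd0, ← hElem_pow hd0,
      hK, ← ENNReal.ofReal_mul (by positivity), ← mul_pow]
    refine ENNReal.ofReal_le_ofReal (pow_le_pow_left₀ (h𝒯.isSimplex hT).hElem_pos.le ?_ _)
    exact h𝒯.hElem_le_sizeRatio_mul hΩ hd hγ0 hγ hA hT hxA hxT
  have hK1 : 1 ≤ K := by
    rw [hK, ← ENNReal.ofReal_one]; exact ENNReal.ofReal_le_ofReal (one_le_pow₀ hL)
  have h2 : volume (hull T) ^ θ ≤ K * volume (hull A) ^ θ := by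
    calc volume (hull T) ^ θ ≤ (K * volume (hull A)) ^ θ := ENNReal.rpow_le_rpow h1 hθ0
      _ = K ^ θ * volume (hull A) ^ θ := ENNReal.mul_rpow_of_nonneg _ _ hθ0
      _ ≤ K ^ (1 : ℝ) * volume (hull A) ^ θ := by
        gcongr
        exact toReal_inv_le_one hr
      _ = _ := by rw [ENNReal.rpow_one]
  have hb0 : volume (hull T) ^ θ ≠ 0 := (ENNReal.rpow_pos hT0.bot_lt hTt).ne'
  have hbt : volume (hull T) ^ θ ≠ ⊤ := ENNReal.rpow_ne_top_of_nonneg hθ0 hTt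
  have ha0 : volume (hull A) ^ θ ≠ 0 := (ENNReal.rpow_pos hA0.bot_lt hAt).ne'
  have hat : volume (hull A) ^ θ ≠ ⊤ := ENNReal.rpow_ne_top_of_nonneg hθ0 hAt
  rw [ENNReal.rpow_neg, ENNReal.rpow_neg]
  set a := volume (hull A) ^ θ
  set b := volume (hull T) ^ θ
  calc a⁻¹ = a⁻¹ * (b * b⁻¹) := by rw [ENNReal.mul_inv_cancel hb0 hbt, mul_one]
    _ ≤ a⁻¹ * (K * a * b⁻¹) := by gcongr
    _ = K * (a⁻¹ * a) * b⁻¹ := by ring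
    _ = _ := by rw [ENNReal.inv_mul_cancel ha0 hat, mul_one]

/-- Every scaled mean of the gradient over an element near `T` is bounded, by Hölder's inequality, by
the scaled `L^r` mean over `D_T`. -/
theorem meanGrad_le_localGrad (hΩ : IsPolyhedralDomain Ω) (hd : 2 ≤ d) {γ : ℝ} (hγ0 : 0 ≤ γ)
    (hγ : IsShapeRegular γ 𝒯) {x : E d} {A T : Finset (E d)} (hA : A ∈ 𝒯) (hT : T ∈ 𝒯)
    (hxA : x ∈ A) (hxT : x ∈ T) {r : ℝ≥0∞} (hr : 1 ≤ r) {g : E d → E d}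
    (hg : AEStronglyMeasurable g (volume.restrict Ω)) :
    meanGrad A g ≤ ENNReal.ofReal (γ * sizeRatio d γ ^ (d + 1)) * localGrad 𝒯 T r g := by
  have hL := one_le_sizeRatio d γ
  have hdiam : Metric.diam (hull A) ≤ γ * sizeRatio d γ * hElem T := by
    refine (hγ A hA).trans ?_
    rw [mul_assoc]
    exact mul_le_mul_of_nonneg_left (h𝒯.hElem_le_sizeRatio_mul hΩ hd hγ0 hγ hT hA hxT hxA) hγ0
  rw [meanGrad, localGrad]
  calc _ ≤ ENNReal.ofReal (γ * sizeRatio d γ * hElem T) *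
        ((ENNReal.ofReal (sizeRatio d γ ^ d) * volume (hull T) ^ (-(r⁻¹).toReal)) *
          eLpNorm g r (volume.restrict (patch 𝒯 (hull T)))) := by
        refine mul_le_mul' (ENNReal.ofReal_le_ofReal hdiam) ?_
        refine (lintegral_enorm_le_eLpNorm (hg.mono_measure (h𝒯.restrict_hull_le hΩ hA))
          (h𝒯.isSimplex hA).volume_pos.ne' (volume_hull_lt_top A).ne hr).trans ?_
        refine mul_le_mul' (h𝒯.volume_rpow_neg_le hΩ hd hγ0 hγ hA hT hxA hxT hr) ?_
        exact eLpNorm_mono_measure _ (Measure.restrict_mono (hull_subset_patch hA hxA hxT) le_rfl)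
    _ = _ := by
        rw [ENNReal.ofReal_mul (by positivity), pow_succ, ← mul_assoc γ,
          mul_right_comm γ _ (sizeRatio d γ), ENNReal.ofReal_mul (p := γ * sizeRatio d γ) (by positivity)]
        ring

theorem enorm_average_patch_sub_le_localGrad (hΩ : IsPolyhedralDomain Ω) (hd : 2 ≤ d) {γ : ℝ}
    (hγ0 : 0 ≤ γ) (hγ : IsShapeRegular γ 𝒯) {v : E d → ℝ}
    {g : E d → E d} (hv : IntegrableOn v Ω) (hg : IntegrableOn g Ω) (hw : HasWeakGradient Ω v g)
    {x : E d} {T : Finset (E d)} (hT : T ∈ 𝒯) (hx : x ∈ T) {r : ℝ≥0∞} (hr : 1 ≤ r) :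
    ‖(⨍ y in patch 𝒯 {x}, v y) - ⨍ y in hull T, v y‖ₑ ≤ nodeConst d γ * localGrad 𝒯 T r g := by
  rw [nodeConst, mul_assoc]
  exact h𝒯.enorm_average_patch_sub_le hΩ (by omega) hγ0 hγ hv hg hw (fun A hA hxA =>
    h𝒯.meanGrad_le_localGrad hΩ hd hγ0 hγ hA hT hxA hx hr hg.aestronglyMeasurable) hT hx

end IsTriangulation

/-! ### The local estimates on shape regular meshes -/

theorem eLpNorm_le_mul_rpow {X F : Type*} [MeasurableSpace X] {μ : Measure X} [NormedAddCommGroup F]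
    {f : X → F} {B : ℝ≥0∞} (hf : ∀ᵐ x ∂μ, ‖f x‖ₑ ≤ B) (r : ℝ≥0∞) :
    eLpNorm f r μ ≤ B * μ Set.univ ^ (r⁻¹).toReal := by
  refine (eLpNorm_le_of_ae_enorm_bound hf).trans (le_of_eq ?_)
  rw [ENNReal.toReal_inv, smul_eq_mul, mul_comm]

theorem volume_hull_rpow_neg_mul {T : Finset (E d)} (hT : IsSimplex T) (θ : ℝ) :
    volume (hull T) ^ (-θ) * volume (hull T) ^ θ = 1 := by
  rw [← ENNReal.rpow_add _ _ hT.volume_pos.ne' (volume_hull_lt_top T).ne, neg_add_cancel,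
    ENNReal.rpow_zero]

theorem affineMap_sum_apply {ι : Type*} (s : Finset ι) (f : ι → E d →ᵃ[ℝ] ℝ) (y : E d) :
    (∑ i ∈ s, f i) y = ∑ i ∈ s, f i y := by
  classical
  induction s using Finset.induction_on with
  | empty => rfl
  | insert i s hi ih =>
    rw [Finset.sum_insert hi, Finset.sum_insert hi, ← ih]; rfl

namespace IsTriangulation

variable {Ω : Set (E d)} {𝒯 : Finset (Finset (E d))} (h𝒯 : IsTriangulation Ω 𝒯)

/-- The affine function that agrees with the interpolant on the element `T`. -/
def interpAffine {T : Finset (E d)} (hT : T ∈ 𝒯) (v : E d → ℝ) : E d →ᵃ[ℝ] ℝ :=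
  ∑ x ∈ T, (⨍ z in patch 𝒯 {x}, v z) • (h𝒯.isSimplex hT).coord x

include h𝒯

theorem interpAffine_apply {T : Finset (E d)} (hT : T ∈ 𝒯) (v : E d → ℝ) (y : E d) :
    h𝒯.interpAffine hT v y =
      ∑ x ∈ T, (⨍ z in patch 𝒯 {x}, v z) * (h𝒯.isSimplex hT).coord x y := by
  rw [interpAffine, affineMap_sum_apply]
  rfl

theorem eqOn_interpAffine {T : Finset (E d)} (hT : T ∈ 𝒯) (v : E d → ℝ) :
    Set.EqOn (interp 𝒯 v) (h𝒯.interpAffine hT v) (hull T) := fun y hy => by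
  rw [h𝒯.interp_eq hT v hy, h𝒯.interpAffine_apply]

theorem gradient_interp {T : Finset (E d)} (hT : T ∈ 𝒯) (v : E d → ℝ) {y : E d}
    (hy : y ∈ interior (hull T)) :
    gradient (interp 𝒯 v) y = affGrad (h𝒯.interpAffine hT v) := by
  rw [← gradient_affine _ y, gradient, gradient]
  congr 1
  refine EventuallyEq.fderiv_eq ?_
  filter_upwards [mem_interior_iff_mem_nhds.1 hy] with z hz using h𝒯.eqOn_interpAffine hT v hz

theorem affGrad_interpAffine {T : Finset (E d)} (hT : T ∈ 𝒯) (v : E d → ℝ) (m : ℝ) :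
    affGrad (h𝒯.interpAffine hT v) =
      ∑ x ∈ T, ((⨍ z in patch 𝒯 {x}, v z) - m) • (h𝒯.isSimplex hT).grad x := by
  refine ext_inner_right ℝ fun w => ?_
  have h := affine_sub_eq_inner (h𝒯.interpAffine hT v) 0 w
  rw [sub_zero] at h
  rw [← h, sum_inner, h𝒯.interpAffine_apply, h𝒯.interpAffine_apply, ← Finset.sum_sub_distrib]
  have h0 : ∑ x ∈ T, m * ((h𝒯.isSimplex hT).coord x w - (h𝒯.isSimplex hT).coord x 0) = 0 := by
    rw [← Finset.mul_sum, Finset.sum_sub_distrib, (h𝒯.isSimplex hT).sum_coord,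
      (h𝒯.isSimplex hT).sum_coord, sub_self, mul_zero]
  rw [← sub_zero (∑ x ∈ T, _), ← h0, ← Finset.sum_sub_distrib]
  refine Finset.sum_congr rfl fun x _ => ?_
  have h1 := (h𝒯.isSimplex hT).coord_sub x 0 w
  rw [sub_zero] at h1
  rw [real_inner_smul_left, ← h1]
  ring

theorem enorm_interp_sub_le {T : Finset (E d)} (hT : T ∈ 𝒯) {v : E d → ℝ} {m : ℝ} {B : ℝ≥0∞}
    (hB : ∀ x ∈ T, ‖(⨍ z in patch 𝒯 {x}, v z) - m‖ₑ ≤ B) {y : E d} (hy : y ∈ hull T) :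
    ‖interp 𝒯 v y - m‖ₑ ≤ (d + 1) * B := by
  have h : interp 𝒯 v y - m =
      ∑ x ∈ T, ((⨍ z in patch 𝒯 {x}, v z) - m) * (h𝒯.isSimplex hT).coord x y := by
    simp_rw [sub_mul]
    rw [Finset.sum_sub_distrib, ← Finset.mul_sum, (h𝒯.isSimplex hT).sum_coord, mul_one,
      h𝒯.interp_eq hT v hy]
  rw [h]
  refine (enorm_sum_le _ _).trans ?_
  calc _ ≤ ∑ x ∈ T, B := Finset.sum_le_sum fun x hx => by
        rw [enorm_mul]
        refine (mul_le_mul' (hB x hx) ?_).trans (mul_one B).le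
        rw [← ofReal_norm, ← ENNReal.ofReal_one,
          Real.norm_of_nonneg ((h𝒯.isSimplex hT).coord_nonneg hy x)]
        exact ENNReal.ofReal_le_ofReal ((h𝒯.isSimplex hT).coord_le_one hy x)
    _ = _ := by rw [Finset.sum_const, h𝒯.card_eq T hT, nsmul_eq_mul]; push_cast; rfl

/-- Stability of the interpolation operator. -/
theorem eLpNorm_interp_le (hΩ : IsPolyhedralDomain Ω) {T : Finset (E d)} (hT : T ∈ 𝒯) {r : ℝ≥0∞}
    (hr : 1 ≤ r) {v : E d → ℝ} (hv : AEStronglyMeasurable v (volume.restrict Ω)) :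
    eLpNorm (interp 𝒯 v) r (volume.restrict (hull T)) ≤
      (d + 1) * eLpNorm v r (volume.restrict (patch 𝒯 (hull T))) := by
  have hS := h𝒯.isSimplex hT
  set θ := (r⁻¹).toReal with hθ
  set V := eLpNorm v r (volume.restrict (patch 𝒯 (hull T)))
  have hB : ∀ x ∈ T, ‖(⨍ z in patch 𝒯 {x}, v z) - 0‖ₑ ≤ volume (hull T) ^ (-θ) * V := by
    intro x hx
    have hsub := h𝒯.hull_subset_patch_singleton hT hx
    rw [sub_zero]
    refine (enorm_setAverage_le_eLpNorm (hv.mono_measure (h𝒯.restrict_patch_le hΩ _))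
      (hS.volume_pos.trans_le (measure_mono hsub)).ne' (volume_patch_lt_top _).ne hr).trans ?_
    refine mul_le_mul' ?_
      (eLpNorm_mono_measure _ (Measure.restrict_mono (h𝒯.patch_singleton_subset hT hx) le_rfl))
    rw [ENNReal.rpow_neg, ENNReal.rpow_neg]
    exact ENNReal.inv_le_inv.2 (ENNReal.rpow_le_rpow (measure_mono hsub) (toReal_inv_nonneg r))
  have h1 := eLpNorm_le_mul_rpow (μ := volume.restrict (hull T)) (f := interp 𝒯 v)
    (B := (d + 1) * (volume (hull T) ^ (-θ) * V))
    (ae_restrict_of_forall_mem (measurableSet_hull T) fun y hy => by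
      simpa using h𝒯.enorm_interp_sub_le hT hB hy) r
  refine h1.trans (le_of_eq ?_)
  rw [Measure.restrict_apply_univ]
  calc _ = (d + 1) * (volume (hull T) ^ (-θ) * volume (hull T) ^ θ) * V := by ring
    _ = _ := by rw [volume_hull_rpow_neg_mul hS, mul_one]

section Sobolev

variable {γ : ℝ} {v : E d → ℝ} {g : E d → E d} {T : Finset (E d)} {r : ℝ≥0∞}

theorem localGrad_mul_rpow (hT : T ∈ 𝒯) (r : ℝ≥0∞) (g : E d → E d) :
    localGrad 𝒯 T r g * volume (hull T) ^ (r⁻¹).toReal =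
      ENNReal.ofReal (hElem T) * eLpNorm g r (volume.restrict (patch 𝒯 (hull T))) := by
  rw [localGrad]
  calc _ = ENNReal.ofReal (hElem T) *
        (volume (hull T) ^ (-(r⁻¹).toReal) * volume (hull T) ^ (r⁻¹).toReal) *
          eLpNorm g r (volume.restrict (patch 𝒯 (hull T))) := by ring
    _ = _ := by rw [volume_hull_rpow_neg_mul (h𝒯.isSimplex hT), mul_one]

theorem eLpNorm_gradient_interp_le (hΩ : IsPolyhedralDomain Ω) (hd : 2 ≤ d) (hγ0 : 0 ≤ γ)
    (hγ : IsShapeRegular γ 𝒯) (hT : T ∈ 𝒯) (hr : 1 ≤ r) (hv : IntegrableOn v Ω)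
    (hg : IntegrableOn g Ω) (hw : HasWeakGradient Ω v g) :
    eLpNorm (gradient (interp 𝒯 v)) r (volume.restrict (hull T)) ≤
      (d + 1) * nodeConst d γ * ENNReal.ofReal (gradConst d γ) *
        eLpNorm g r (volume.restrict (patch 𝒯 (hull T))) := by
  have hS := h𝒯.isSimplex hT
  set m := ⨍ y in hull T, v y
  set Q := localGrad 𝒯 T r g
  have hB := fun x (hx : x ∈ T) =>
    h𝒯.enorm_average_patch_sub_le_localGrad hΩ hd hγ0 hγ hv hg hw hT hx hr
  have hG : ‖affGrad (h𝒯.interpAffine hT v)‖ₑ ≤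
      (d + 1) * (nodeConst d γ * Q * ENNReal.ofReal (gradConst d γ / hElem T)) := by
    rw [h𝒯.affGrad_interpAffine hT v m]
    refine (enorm_sum_le _ _).trans ?_
    calc _ ≤ ∑ x ∈ T, nodeConst d γ * Q * ENNReal.ofReal (gradConst d γ / hElem T) :=
          Finset.sum_le_sum fun x hx => by
            rw [enorm_smul]
            refine mul_le_mul' (hB x hx) ?_
            rw [← ofReal_norm]
            refine ENNReal.ofReal_le_ofReal ?_
            rw [le_div_iff₀ hS.hElem_pos]
            exact hS.norm_grad_mul_hElem_le (by omega) (hγ T hT) hx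
      _ = _ := by rw [Finset.sum_const, h𝒯.card_eq T hT, nsmul_eq_mul]; push_cast; rfl
  have hae : ∀ᵐ y ∂volume.restrict (hull T), ‖gradient (interp 𝒯 v) y‖ₑ ≤
      (d + 1) * (nodeConst d γ * Q * ENNReal.ofReal (gradConst d γ / hElem T)) := by
    rw [ae_restrict_iff' (measurableSet_hull T)]
    filter_upwards [measure_eq_zero_iff_ae_notMem.1 (volume_hull_sdiff_interior T)] with y hy hyT
    have hyi : y ∈ interior (hull T) := by by_contra h; exact hy ⟨hyT, h⟩
    rw [h𝒯.gradient_interp hT v hyi]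
    exact hG
  refine (eLpNorm_le_mul_rpow hae r).trans (le_of_eq ?_)
  rw [Measure.restrict_apply_univ]
  have hh : ENNReal.ofReal (gradConst d γ / hElem T) * ENNReal.ofReal (hElem T) =
      ENNReal.ofReal (gradConst d γ) := by
    rw [← ENNReal.ofReal_mul (div_nonneg (gradConst_pos d γ).le hS.hElem_pos.le),
      div_mul_cancel₀ _ hS.hElem_pos.ne']
  calc _ = (d + 1) * (nodeConst d γ * ENNReal.ofReal (gradConst d γ / hElem T) *
        (Q * volume (hull T) ^ (r⁻¹).toReal)) := by ring
    _ = (d + 1) * nodeConst d γ *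
          (ENNReal.ofReal (gradConst d γ / hElem T) * ENNReal.ofReal (hElem T)) *
          eLpNorm g r (volume.restrict (patch 𝒯 (hull T))) := by
        rw [h𝒯.localGrad_mul_rpow hT]; ring
    _ = _ := by rw [hh]

theorem eLpNorm_restrict_hull_le_patch (hT : T ∈ 𝒯) (r : ℝ≥0∞) (g : E d → E d) :
    eLpNorm g r (volume.restrict (hull T)) ≤ eLpNorm g r (volume.restrict (patch 𝒯 (hull T))) := by
  obtain ⟨x, hx⟩ := (h𝒯.isSimplex hT).nonempty
  exact eLpNorm_mono_measure _ (Measure.restrict_mono (hull_subset_patch hT hx hx) le_rfl)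

omit h𝒯 in
theorem ofReal_diam_le (hγ0 : 0 ≤ γ) (hγ : IsShapeRegular γ 𝒯) (hT : T ∈ 𝒯) :
    ENNReal.ofReal (Metric.diam (hull T)) ≤ ENNReal.ofReal γ * ENNReal.ofReal (hElem T) := by
  rw [← ENNReal.ofReal_mul hγ0]
  exact ENNReal.ofReal_le_ofReal (hγ T hT)

theorem continuous_interpAffine (hT : T ∈ 𝒯) (v : E d → ℝ) : Continuous (h𝒯.interpAffine hT v) :=
  continuous_affine _

theorem aestronglyMeasurable_interp (hT : T ∈ 𝒯) (v : E d → ℝ) {μ : Measure (E d)} {S : Set (E d)}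
    (hS : S ⊆ hull T) (hSm : MeasurableSet S) : AEStronglyMeasurable (interp 𝒯 v) (μ.restrict S) :=
  (h𝒯.continuous_interpAffine hT v).aestronglyMeasurable.congr
    (ae_restrict_of_forall_mem hSm fun _ hy => (h𝒯.eqOn_interpAffine hT v (hS hy)).symm)

theorem eLpNorm_sub_interp_le (hΩ : IsPolyhedralDomain Ω) (hd : 2 ≤ d) (hγ0 : 0 ≤ γ)
    (hγ : IsShapeRegular γ 𝒯) (hT : T ∈ 𝒯) (hr : 1 ≤ r) (hv : IntegrableOn v Ω)
    (hg : IntegrableOn g Ω) (hw : HasWeakGradient Ω v g) :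
    eLpNorm (v - interp 𝒯 v) r (volume.restrict (hull T)) ≤
      (2 ^ d * ENNReal.ofReal γ + (d + 1) * nodeConst d γ) * ENNReal.ofReal (hElem T) *
        eLpNorm g r (volume.restrict (patch 𝒯 (hull T))) := by
  have hS := h𝒯.isSimplex hT
  set m := ⨍ y in hull T, v y with hm
  set Q := localGrad 𝒯 T r g with hQ
  set G := eLpNorm g r (volume.restrict (patch 𝒯 (hull T))) with hG
  have hB := fun x (hx : x ∈ T) =>
    h𝒯.enorm_average_patch_sub_le_localGrad hΩ hd hγ0 hγ hv hg hw hT hx hr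
  have h1 : eLpNorm (fun y => interp 𝒯 v y - m) r (volume.restrict (hull T)) ≤
      (d + 1) * (nodeConst d γ * Q) * volume (hull T) ^ (r⁻¹).toReal := by
    have := eLpNorm_le_mul_rpow (μ := volume.restrict (hull T))
      (ae_restrict_of_forall_mem (measurableSet_hull T) fun y hy => h𝒯.enorm_interp_sub_le hT hB hy) r
    rwa [Measure.restrict_apply_univ] at this
  have h2 := h𝒯.eLpNorm_sub_average_hull_le hΩ hv hg hw hT hr
  have heq : v - interp 𝒯 v = (fun y => v y - m) - fun y => interp 𝒯 v y - m := by
    ext y; simp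
  rw [heq]
  refine (eLpNorm_sub_le ((h𝒯.integrableOn_hull hΩ hv hT).aestronglyMeasurable.sub
    aestronglyMeasurable_const) ((h𝒯.aestronglyMeasurable_interp hT v subset_rfl
      (measurableSet_hull T)).sub aestronglyMeasurable_const) hr).trans ?_
  calc _ ≤ 2 ^ d * (ENNReal.ofReal γ * ENNReal.ofReal (hElem T)) * G +
        (d + 1) * nodeConst d γ * (Q * volume (hull T) ^ (r⁻¹).toReal) := by
        refine add_le_add (h2.trans ?_) (h1.trans (le_of_eq (by ring)))
        refine mul_le_mul' (mul_le_mul' le_rfl (ofReal_diam_le hγ0 hγ hT))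
          (h𝒯.eLpNorm_restrict_hull_le_patch hT r g)
    _ = _ := by rw [hQ, h𝒯.localGrad_mul_rpow hT]; ring

open scoped Classical in
/-- The scaling of the trace inequality. -/
theorem hElem_mul_face_le (hd : 2 ≤ d) (hγ1 : 1 ≤ γ) (hγ : IsShapeRegular γ 𝒯) (hT : T ∈ 𝒯) {z : E d}
    (hz : z ∈ T) (hr : 1 ≤ r) :
    ENNReal.ofReal (hElem T) * ((μHE[d - 1] : Measure (E d)) (hull (T.erase z)) ^ (r⁻¹).toReal *
        volume (hull T) ^ (-(r⁻¹).toReal)) ≤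
      ENNReal.ofReal (gradConst d γ * γ) *
        ENNReal.ofReal (hFace (T.erase z) ^ (1 - (r⁻¹).toReal)) := by
  have hS := h𝒯.isSimplex hT
  have hd0 : d ≠ 0 := by omega
  set θ := (r⁻¹).toReal with hθ
  have hθ0 : 0 ≤ θ := toReal_inv_nonneg r
  have hθ1 : θ ≤ 1 := toReal_inv_le_one hr
  set h := hElem T with hh
  have hpos : 0 < h := hS.hElem_pos
  set k := gradConst d γ
  have hk1 : 1 ≤ k := one_le_gradConst d γ
  have hF := hS.hausdorff_face_le_gradConst hd0 (hγ T hT) hz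
  have hFh := hS.hElem_le_hFace hd (hγ T hT) hγ1 hz
  have hF0 : 0 ≤ hFace (T.erase z) := hFace_nonneg _
  have hp : h ^ d = h ^ (d - 1) * h := by rw [← pow_succ, Nat.sub_add_cancel (by omega)]
  calc _ ≤ ENNReal.ofReal h * (ENNReal.ofReal (k * h ^ (d - 1)) ^ θ *
          ENNReal.ofReal (h ^ d) ^ (-θ)) := by
        rw [hElem_pow hd0, ENNReal.ofReal_toReal (volume_hull_lt_top T).ne]
        gcongr
    _ = ENNReal.ofReal (h * ((k * h ^ (d - 1)) ^ θ * (h ^ d) ^ (-θ))) := by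
        rw [ENNReal.ofReal_rpow_of_pos (by positivity), ENNReal.ofReal_rpow_of_pos (by positivity),
          ← ENNReal.ofReal_mul (by positivity), ← ENNReal.ofReal_mul (by positivity)]
    _ ≤ _ := by
        rw [← ENNReal.ofReal_mul (by positivity)]
        refine ENNReal.ofReal_le_ofReal ?_
        have e1 : h * ((k * h ^ (d - 1)) ^ θ * (h ^ d) ^ (-θ)) = k ^ θ * h ^ (1 - θ) := by
          rw [hp, Real.mul_rpow (by positivity) (by positivity),
            Real.mul_rpow (by positivity) hpos.le, Real.rpow_neg (by positivity),
            Real.rpow_neg hpos.le, Real.rpow_sub hpos, Real.rpow_one]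
          have := Real.rpow_pos_of_pos (pow_pos hpos (d - 1)) θ
          field_simp
        rw [e1]
        have e2 : k ^ θ ≤ k := by
          conv_rhs => rw [← Real.rpow_one k]
          exact Real.rpow_le_rpow_of_exponent_le hk1 hθ1
        have e3 : h ^ (1 - θ) ≤ γ * hFace (T.erase z) ^ (1 - θ) := by
          calc h ^ (1 - θ) ≤ (γ * hFace (T.erase z)) ^ (1 - θ) :=
                Real.rpow_le_rpow hpos.le hFh (by linarith)
            _ = γ ^ (1 - θ) * hFace (T.erase z) ^ (1 - θ) := Real.mul_rpow (by linarith) hF0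
            _ ≤ γ * hFace (T.erase z) ^ (1 - θ) := by
              gcongr
              conv_rhs => rw [← Real.rpow_one γ]
              exact Real.rpow_le_rpow_of_exponent_le hγ1 (by linarith)
        rw [mul_assoc]
        exact mul_le_mul e2 e3 (by positivity) (by positivity)

open scoped Classical in
theorem eLpNorm_trace_sub_interp_le (hΩ : IsPolyhedralDomain Ω) (hd : 2 ≤ d) (hγ1 : 1 ≤ γ)
    (hγ : IsShapeRegular γ 𝒯) (hT : T ∈ 𝒯) (hr : 1 ≤ r) (hv : IntegrableOn v Ω)
    (hg : IntegrableOn g Ω) (hw : HasWeakGradient Ω v g) {z : E d} (hz : z ∈ T) {τ : E d → ℝ}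
    (hτ : IsTrace T (T.erase z) v g τ) :
    eLpNorm (τ - interp 𝒯 v) r (faceMeasure (T.erase z)) ≤
      (2 ^ d * (2 ^ d + 1) * ENNReal.ofReal γ + (d + 1) * nodeConst d γ) *
        ENNReal.ofReal (gradConst d γ * γ) *
        ENNReal.ofReal (hFace (T.erase z) ^ (1 - (r⁻¹).toReal)) *
        eLpNorm g r (volume.restrict (patch 𝒯 (hull T))) := by
  have hS := h𝒯.isSimplex hT
  have hd0 : d ≠ 0 := by omega
  have hγ0 : 0 ≤ γ := by linarith
  obtain ⟨hτm, u, hu1, hu2, hu3, hu4⟩ := hτ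
  have hu : IsC1Approx (hull T) v g u :=
    ⟨hu1, by simpa [eLpNorm_one_eq_lintegral_enorm] using hu2,
      by simpa [eLpNorm_one_eq_lintegral_enorm] using hu3⟩
  set m := ⨍ y in hull T, v y with hm
  set Q := localGrad 𝒯 T r g with hQ
  set G := eLpNorm g r (volume.restrict (patch 𝒯 (hull T))) with hG
  set θ := (r⁻¹).toReal with hθ
  have hθ0 : 0 ≤ θ := toReal_inv_nonneg r
  have hθ1 : θ ≤ 1 := toReal_inv_le_one hr
  set F := (μHE[d - 1] : Measure (E d)) (hull (T.erase z)) with hF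
  have hB := fun x (hx : x ∈ T) =>
    h𝒯.enorm_average_patch_sub_le_localGrad hΩ hd hγ0 hγ hv hg hw hT hx hr
  have hface := hull_mono (T.erase_subset z)
  have h1 : eLpNorm (fun y => interp 𝒯 v y - m) r (faceMeasure (T.erase z)) ≤
      (d + 1) * (nodeConst d γ * Q) * F ^ θ := by
    have := eLpNorm_le_mul_rpow (μ := faceMeasure (T.erase z))
      (ae_restrict_of_forall_mem (measurableSet_hull _) fun y hy =>
        h𝒯.enorm_interp_sub_le hT hB (hface hy)) r
    rwa [faceMeasure, Measure.restrict_apply_univ] at this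
  have h2 := eLpNorm_trace_sub_le hd0 hS hz (h𝒯.integrableOn_hull hΩ hv hT)
    (h𝒯.integrableOn_hull hΩ hg hT) hu hτm.aestronglyMeasurable.aemeasurable
    (by simpa [faceMeasure, eLpNorm_one_eq_lintegral_enorm] using hu4) m hr
  have h3 := h𝒯.eLpNorm_sub_average_hull_le hΩ hv hg hw hT hr
  have hC : traceConst T (T.erase z) ^ θ ≤ 2 ^ d * (F ^ θ * volume (hull T) ^ (-θ)) := by
    rw [traceConst, ENNReal.mul_rpow_of_nonneg _ _ hθ0, ENNReal.div_rpow_of_nonneg _ _ hθ0,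
      ENNReal.rpow_neg, div_eq_mul_inv]
    refine mul_le_mul' ?_ le_rfl
    conv_rhs => rw [← ENNReal.rpow_one (2 ^ d)]
    exact ENNReal.rpow_le_rpow_of_exponent_le (one_le_pow₀ (by norm_num)) hθ1
  have heq : τ - interp 𝒯 v = (fun y => τ y - m) - fun y => interp 𝒯 v y - m := by
    ext y; simp
  rw [heq]
  refine (eLpNorm_sub_le (hτm.aestronglyMeasurable.sub aestronglyMeasurable_const)
    ((h𝒯.aestronglyMeasurable_interp hT v hface (measurableSet_hull _)).sub
      aestronglyMeasurable_const) hr).trans ?_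
  have hgp := h𝒯.eLpNorm_restrict_hull_le_patch hT r g
  have hdm := ofReal_diam_le hγ0 hγ hT
  calc _ ≤ 2 ^ d * (F ^ θ * volume (hull T) ^ (-θ)) *
          (2 ^ d * (ENNReal.ofReal γ * ENNReal.ofReal (hElem T)) * G +
            (ENNReal.ofReal γ * ENNReal.ofReal (hElem T)) * G) +
        (d + 1) * (nodeConst d γ * Q) * F ^ θ := by
        refine add_le_add (h2.trans (mul_le_mul' hC (add_le_add (h3.trans ?_) ?_))) h1
        · exact mul_le_mul' (mul_le_mul' le_rfl hdm) hgp
        · exact mul_le_mul' hdm hgp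
    _ = (2 ^ d * (2 ^ d + 1) * ENNReal.ofReal γ + (d + 1) * nodeConst d γ) *
          (ENNReal.ofReal (hElem T) * (F ^ θ * volume (hull T) ^ (-θ))) * G := by
        rw [hQ, localGrad]; ring
    _ ≤ (2 ^ d * (2 ^ d + 1) * ENNReal.ofReal γ + (d + 1) * nodeConst d γ) *
          (ENNReal.ofReal (gradConst d γ * γ) * ENNReal.ofReal (hFace (T.erase z) ^ (1 - θ))) * G := by
        exact mul_le_mul' (mul_le_mul' le_rfl (h𝒯.hElem_mul_face_le hd hγ1 hγ hT hz hr)) le_rfl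
    _ = _ := by ring

open scoped Classical in
theorem exists_isTrace (hΩ : IsPolyhedralDomain Ω) (hd : d ≠ 0) (hT : T ∈ 𝒯) (hv : IntegrableOn v Ω)
    (hg : IntegrableOn g Ω) (hw : HasWeakGradient Ω v g) {z : E d} (hz : z ∈ T) :
    ∃ τ, IsTrace T (T.erase z) v g τ := by
  obtain ⟨u, hu⟩ := h𝒯.exists_isC1Approx_hull hΩ hv hg hw hT
  obtain ⟨τ, hτ, hτ'⟩ := exists_trace hd (h𝒯.isSimplex hT) hz (h𝒯.integrableOn_hull hΩ hv hT)
    (h𝒯.integrableOn_hull hΩ hg hT) hu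
  exact ⟨τ, hτ, u, hu.contDiff, by simpa [eLpNorm_one_eq_lintegral_enorm] using hu.tendsto,
    by simpa [eLpNorm_one_eq_lintegral_enorm] using hu.tendsto_gradient, hτ'⟩

end Sobolev

end IsTriangulation

/-- The constant in the local estimates, for meshes with shape parameter `γ ≥ 1`. -/
def localConst (d : ℕ) (γ : ℝ) : ℝ≥0∞ :=
  (d + 1) + (d + 1) * nodeConst d γ * ENNReal.ofReal (gradConst d γ) +
    (2 ^ d * (2 ^ d + 1) * ENNReal.ofReal γ + (d + 1) * nodeConst d γ) *
      ENNReal.ofReal (gradConst d γ * γ)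

theorem localConst_ne_top (d : ℕ) (γ : ℝ) : localConst d γ ≠ ⊤ := by
  have := nodeConst_ne_top d γ
  unfold localConst
  finiteness

theorem localEstimates_of_one_le {Ω : Set (E d)} {𝒯 : Finset (Finset (E d))} {γ : ℝ} (hd : 2 ≤ d)
    (hΩ : IsPolyhedralDomain Ω) (h𝒯 : IsTriangulation Ω 𝒯) (hγ1 : 1 ≤ γ)
    (hγ : IsShapeRegular γ 𝒯) : LocalEstimates Ω 𝒯 (localConst d γ).toNNReal := by
  classical
  have hc : (((localConst d γ).toNNReal : ℝ≥0) : ℝ≥0∞) = localConst d γ :=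
    ENNReal.coe_toNNReal (localConst_ne_top d γ)
  have hγ0 : 0 ≤ γ := by linarith
  have hfin : IsFiniteMeasure (volume.restrict Ω) := ⟨by
    simpa using hΩ.isBounded.measure_lt_top⟩
  set C := ENNReal.ofReal (gradConst d γ * γ)
  have hC1 : 1 ≤ C := by
    rw [← ENNReal.ofReal_one]
    exact ENNReal.ofReal_le_ofReal (one_le_mul_of_one_le_of_one_le (one_le_gradConst d γ) hγ1)
  intro r hr T hT
  rw [hc]
  refine ⟨fun v hv => ?_, fun v g ⟨hv, hg, hw⟩ => ?_⟩
  · refine (h𝒯.eLpNorm_interp_le hΩ hT hr hv.aestronglyMeasurable).trans ?_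
    gcongr
    rw [localConst, add_assoc]
    exact le_self_add
  · replace hv : IntegrableOn v Ω := hv.integrable hr
    replace hg : IntegrableOn g Ω := hg.integrable hr
    refine ⟨?_, ?_, fun F hF hFc => ?_⟩
    · refine (h𝒯.eLpNorm_gradient_interp_le hΩ hd hγ0 hγ hT hr hv hg hw).trans ?_
      gcongr
      rw [localConst]
      exact le_add_self.trans le_self_add
    · refine (h𝒯.eLpNorm_sub_interp_le hΩ hd hγ0 hγ hT hr hv hg hw).trans ?_
      gcongr
      rw [localConst]
      refine le_trans ?_ le_add_self
      refine le_trans ?_ (le_mul_of_one_le_right' hC1)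
      gcongr
      exact le_mul_of_one_le_right' le_add_self
    · obtain ⟨z, hz, rfl⟩ : ∃ z ∈ T, F = T.erase z := by
        obtain ⟨z, hz, hzF⟩ := Finset.exists_mem_notMem_of_card_lt_card
          (by rw [hFc, h𝒯.card_eq T hT]; omega : F.card < T.card)
        refine ⟨z, hz, Finset.eq_of_subset_of_card_le (fun y hy => Finset.mem_erase.2
          ⟨by rintro rfl; exact hzF hy, hF hy⟩) ?_⟩
        rw [Finset.card_erase_of_mem hz, h𝒯.card_eq T hT, hFc]; omega
      refine ⟨h𝒯.exists_isTrace hΩ (by omega) hT hv hg hw hz, fun τ hτ => ?_⟩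
      refine (h𝒯.eLpNorm_trace_sub_interp_le hΩ hd hγ1 hγ hT hr hv hg hw hz hτ).trans ?_
      gcongr
      rw [localConst]
      exact le_add_self

/-- The local estimates hold on all meshes with a given shape parameter, with one constant. -/
theorem exists_localEstimates (hd : 2 ≤ d) (γ : ℝ) : ∃ c : ℝ≥0, ∀ (Ω : Set (E d))
    (𝒯 : Finset (Finset (E d))), IsPolyhedralDomain Ω → IsTriangulation Ω 𝒯 → IsShapeRegular γ 𝒯 →
      LocalEstimates Ω 𝒯 c :=
  ⟨_, fun _ _ hΩ h𝒯 hγ => localEstimates_of_one_le hd hΩ h𝒯 (le_max_left 1 γ) fun T hT =>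
    (hγ T hT).trans (mul_le_mul_of_nonneg_right (le_max_right _ _) (h𝒯.isSimplex hT).hElem_pos.le)⟩

/-! ### Continuous piecewise affine functions are Sobolev functions -/

namespace IsTriangulation

variable {Ω : Set (E d)} {𝒯 : Finset (Finset (E d))} (h𝒯 : IsTriangulation Ω 𝒯)
include h𝒯

theorem exists_mem_hull {y : E d} (hy : y ∈ closure Ω) : ∃ T ∈ 𝒯, y ∈ hull T := by
  rw [← h𝒯.iUnion_eq, Set.mem_iUnion₂] at hy
  simpa using hy

theorem interp_mem_feSpace (v : E d → ℝ) : interp 𝒯 v ∈ feSpace Ω 𝒯 := by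
  refine ⟨?_, fun T hT => ⟨h𝒯.interpAffine hT v, h𝒯.eqOn_interpAffine hT v⟩⟩
  have h : closure Ω = ⋃ T : {T // T ∈ 𝒯}, hull T.1 := by rw [← h𝒯.iUnion_eq, Set.iUnion_subtype]
  rw [h]
  refine (locallyFinite_of_finite _).continuousOn_iUnion (fun T => isClosed_hull _) fun T => ?_
  exact (h𝒯.continuous_interpAffine T.2 v).continuousOn.congr (h𝒯.eqOn_interpAffine T.2 v)

theorem interp_mem_Icc (hΩ : IsPolyhedralDomain Ω) {v : E d → ℝ} (hv : IntegrableOn v Ω) {c₀ c₁ : ℝ}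
    (hc : ∀ᵐ x ∂volume.restrict Ω, c₀ ≤ v x ∧ v x ≤ c₁) {y : E d} (hy : y ∈ closure Ω) :
    interp 𝒯 v y ∈ Set.Icc c₀ c₁ := by
  obtain ⟨T, hT, hyT⟩ := h𝒯.exists_mem_hull hy
  have hS := h𝒯.isSimplex hT
  have ha : ∀ x ∈ T, (⨍ z in patch 𝒯 {x}, v z) ∈ Set.Icc c₀ c₁ := fun x hx =>
    (convex_Icc c₀ c₁).set_average_mem isClosed_Icc
      (hS.volume_pos.trans_le (measure_mono (h𝒯.hull_subset_patch_singleton hT hx))).ne'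
      (volume_patch_lt_top _).ne (ae_mono (h𝒯.restrict_patch_le hΩ _) hc)
      (h𝒯.integrableOn_patch hΩ hv _)
  rw [h𝒯.interp_eq hT v hyT]
  have := (convex_Icc c₀ c₁).sum_mem (fun x _ => hS.coord_nonneg hyT x) (hS.sum_coord y) ha
  simpa [smul_eq_mul, mul_comm] using this

/-- On segments in the domain, a continuous piecewise affine function is Lipschitz continuous with
the largest slope on an element as its constant. -/
theorem sub_le_of_segment_subset {f : E d → ℝ} (hf : ContinuousOn f (closure Ω))
    {A : Finset (E d) → E d →ᵃ[ℝ] ℝ} (hA : ∀ T ∈ 𝒯, Set.EqOn f (A T) (hull T)) {L : ℝ}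
    (hL : ∀ T ∈ 𝒯, ‖affGrad (A T)‖ ≤ L) {a b : E d} (hab : segment ℝ a b ⊆ closure Ω) :
    f b - f a ≤ L * dist a b := by
  set γ : ℝ → E d := fun t => a + t • (b - a) with hγ
  have hγc : Continuous γ := by fun_prop
  have hγΩ : ∀ t ∈ Set.Icc (0 : ℝ) 1, γ t ∈ closure Ω := fun t ht => hab (by
    rw [segment_eq_image']; exact ⟨t, ht, rfl⟩)
  have key := image_le_of_liminf_slope_right_le_deriv_boundary (f := fun t => f (γ t)) (a := 0)
    (b := 1) (B := fun t => f a + t * (L * dist a b)) (B' := fun _ => L * dist a b)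
    (hf.comp hγc.continuousOn hγΩ) (by simp [hγ]) (by fun_prop)
    (fun t _ => by
      simpa using (((hasDerivAt_id t).mul_const (L * dist a b)).const_add (f a)).hasDerivWithinAt)
    ?_ (Set.right_mem_Icc.2 zero_le_one)
  · simp only [hγ, one_smul, add_sub_cancel] at key
    linarith
  intro t ht s hs
  have hev : ∀ᶠ z in 𝓝[>] t, ∃ T ∈ 𝒯, γ z ∈ hull T := by
    filter_upwards [Ioo_mem_nhdsGT ht.2] with z hz
    exact h𝒯.exists_mem_hull (hγΩ z ⟨ht.1.trans hz.1.le, hz.2.le⟩)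
  -- one of the finitely many elements is met at times arbitrarily close to `t`
  obtain ⟨T, hT, hfreq⟩ := (frequently_exists_finset 𝒯).1 hev.frequently
  have hγt : γ t ∈ hull T := (isClosed_hull T).mem_of_frequently_of_tendsto hfreq
    (hγc.continuousAt.tendsto.mono_left nhdsWithin_le_nhds)
  refine (hfreq.and_eventually self_mem_nhdsWithin).mono fun z hz => lt_of_le_of_lt ?_ hs
  obtain ⟨hzT, hzt : t < z⟩ := hz
  rw [slope_def_field, div_le_iff₀ (by linarith)]
  rw [hA T hT hzT, hA T hT hγt, affine_sub_eq_inner]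
  refine (real_inner_le_norm _ _).trans ?_
  have h1 : γ z - γ t = (z - t) • (b - a) := by simp only [hγ, sub_smul]; abel
  rw [h1, norm_smul, Real.norm_of_nonneg (sub_nonneg.2 hzt.le), dist_comm, dist_eq_norm]
  calc _ ≤ L * ((z - t) * ‖b - a‖) := mul_le_mul_of_nonneg_right (hL T hT)
        (mul_nonneg (sub_nonneg.2 hzt.le) (norm_nonneg _))
    _ = _ := by ring

omit h𝒯 in
theorem exists_norm_affGrad_le (A : Finset (E d) → E d →ᵃ[ℝ] ℝ) :
    ∃ L : ℝ≥0, ∀ T ∈ 𝒯, ‖affGrad (A T)‖ ≤ L :=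
  ⟨∑ T ∈ 𝒯, ‖affGrad (A T)‖₊, fun T hT => by
    exact_mod_cast Finset.single_le_sum (f := fun T => ‖affGrad (A T)‖₊) (fun _ _ => zero_le) hT⟩

theorem locallyLipschitzOn_of_mem_feSpace (hΩ : IsPolyhedralDomain Ω) {f : E d → ℝ}
    (hf : f ∈ feSpace Ω 𝒯) : LocallyLipschitzOn Ω f := by
  obtain ⟨hfc, hfA⟩ := hf
  choose! A hA using hfA
  obtain ⟨L, hL⟩ := exists_norm_affGrad_le (𝒯 := 𝒯) A
  intro x hx
  obtain ⟨ε, hε, hεΩ⟩ := Metric.isOpen_iff.1 hΩ.isOpen x hx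
  refine ⟨L, Metric.ball x ε, mem_nhdsWithin_of_mem_nhds (Metric.ball_mem_nhds x hε), ?_⟩
  refine LipschitzOnWith.of_le_add_mul L fun a ha b hb => ?_
  have := h𝒯.sub_le_of_segment_subset hfc hA hL (a := b) (b := a)
    (((convex_ball x ε).segment_subset hb ha).trans (hεΩ.trans subset_closure))
  rw [dist_comm] at this
  linarith

theorem ae_mem_interior_hull (hΩ : IsPolyhedralDomain Ω) :
    ∀ᵐ y ∂volume.restrict Ω, ∃ T ∈ 𝒯, y ∈ interior (hull T) := by
  rw [ae_restrict_iff' hΩ.isOpen.measurableSet]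
  have h : ∀ᵐ y, ∀ T ∈ 𝒯, y ∉ hull T \ interior (hull T) :=
    (ae_ball_iff 𝒯.countable_toSet).2 fun T _ =>
      measure_eq_zero_iff_ae_notMem.1 (volume_hull_sdiff_interior T)
  filter_upwards [h] with y hy hyΩ
  obtain ⟨T, hT, hyT⟩ := h𝒯.exists_mem_hull (subset_closure hyΩ)
  exact ⟨T, hT, by by_contra hn; exact hy T hT ⟨hyT, hn⟩⟩

omit h𝒯 in
theorem eventuallyEq_of_mem_interior {f : E d → ℝ} {T : Finset (E d)} {A : E d →ᵃ[ℝ] ℝ}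
    (hA : Set.EqOn f A (hull T)) {y : E d} (hy : y ∈ interior (hull T)) : f =ᶠ[𝓝 y] A := by
  filter_upwards [mem_interior_iff_mem_nhds.1 hy] with z hz using hA hz

theorem hasWeakGradient_of_mem_feSpace (hΩ : IsPolyhedralDomain Ω) {f : E d → ℝ}
    (hf : f ∈ feSpace Ω 𝒯) : HasWeakGradient Ω f (gradient f) := by
  intro φ hφ hφc hφs i
  set e : E d := EuclideanSpace.single i 1
  obtain ⟨K, hK, hφK, hKΩ⟩ := exists_compact_between hφc hΩ.isOpen hφs
  obtain ⟨C, hC⟩ := ((h𝒯.locallyLipschitzOn_of_mem_feSpace hΩ hf).mono hKΩ)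
    |>.exists_lipschitzOnWith_of_compact hK
  obtain ⟨F, hF, hFf⟩ := hC.extend_real
  obtain ⟨D, hD⟩ := (hφ.of_le (by exact_mod_cast le_top : (1 : WithTop ℕ∞) ≤ _)).lipschitzWith_of_hasCompactSupport hφc one_ne_zero
  have h := LipschitzWith.integral_lineDeriv_mul_eq (μ := volume) hF hD hφc e
  have hzero : ∀ x ∉ Ω, φ x = 0 := fun x hx => image_eq_zero_of_notMem_tsupport fun h' => hx (hφs h')
  have hzero' : ∀ x ∉ tsupport φ, fderiv ℝ φ x = 0 := fun x hx => by
    have := tsupport_fderiv_subset ℝ (f := φ)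
    exact image_eq_zero_of_notMem_tsupport fun h' => hx (this h')
  have h1 : ∫ x in Ω, f x * fderiv ℝ φ x e = -∫ x, lineDeriv ℝ φ x (-e) * F x := by
    rw [setIntegral_eq_integral_of_forall_compl_eq_zero fun x hx => by
      rw [hzero' x fun h' => hx (hφs h')]; simp, ← integral_neg]
    refine integral_congr_ae (Eventually.of_forall fun x => ?_)
    simp only
    rw [((hφ.differentiable (by simp)) x).lineDeriv_eq_fderiv, map_neg]
    by_cases hx : x ∈ tsupport φ
    · rw [hFf (interior_subset (hφK hx))]; ring
    · rw [hzero' x hx]; simp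
  have h2 : ∫ x in Ω, gradient f x i * φ x = ∫ x, lineDeriv ℝ F x e * φ x := by
    rw [← setIntegral_eq_integral_of_forall_compl_eq_zero (s := Ω) (f := fun x => lineDeriv ℝ F x e * φ x)
      fun x hx => by rw [hzero x hx, mul_zero]]
    refine integral_congr_ae ?_
    filter_upwards [h𝒯.ae_mem_interior_hull hΩ] with x ⟨T, hT, hxT⟩
    by_cases hx : x ∈ tsupport φ
    · obtain ⟨A, hA⟩ := hf.2 T hT
      have hfx : DifferentiableAt ℝ f x := (hasFDerivAt_affine A x).differentiableAt.congr_of_eventuallyEq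
        (eventuallyEq_of_mem_interior hA hxT)
      have hFx : F =ᶠ[𝓝 x] f := by
        filter_upwards [mem_interior_iff_mem_nhds.1 (hφK hx)] with z hz using (hFf hz).symm
      rw [hFx.lineDeriv_eq, hfx.lineDeriv_eq_fderiv, ← gradient_apply_eq_fderiv]
    · rw [image_eq_zero_of_notMem_tsupport hx, mul_zero, mul_zero]
  rw [h1, ← h, h2]

theorem isSobolev_of_mem_feSpace (hΩ : IsPolyhedralDomain Ω) {f : E d → ℝ} (hf : f ∈ feSpace Ω 𝒯)
    (r : ℝ≥0∞) : IsSobolev Ω r f (gradient f) := by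
  have hfin : IsFiniteMeasure (volume.restrict Ω) := ⟨by
    simpa using hΩ.isBounded.measure_lt_top⟩
  refine ⟨?_, ?_, h𝒯.hasWeakGradient_of_mem_feSpace hΩ hf⟩
  · obtain ⟨C, hC⟩ := hΩ.isBounded.isCompact_closure.exists_bound_of_continuousOn hf.1
    exact MemLp.of_bound ((hf.1.mono subset_closure).aestronglyMeasurable hΩ.isOpen.measurableSet) C
      (ae_restrict_of_forall_mem hΩ.isOpen.measurableSet fun x hx => hC x (subset_closure hx))
  · choose! A hA using hf.2
    obtain ⟨L, hL⟩ := exists_norm_affGrad_le (𝒯 := 𝒯) A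
    refine MemLp.of_bound (measurable_gradient f).aestronglyMeasurable L ?_
    filter_upwards [h𝒯.ae_mem_interior_hull hΩ] with x ⟨T, hT, hxT⟩
    rw [gradient, (eventuallyEq_of_mem_interior (hA T hT) hxT).fderiv_eq, ← gradient,
      gradient_affine]
    exact hL T hT

end IsTriangulation

/-! ### Bisection preserves shape regularity -/

theorem isSimplex_of_volume_ne_zero {T : Finset (E d)} (hc : T.card ≤ d + 1)
    (hv : volume (hull T) ≠ 0) : IsSimplex T := by
  have hcard : T.card = d + 1 := by
    by_contra hne
    exact hv (volume_hull_eq_zero_of_card_le (by omega))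
  refine ⟨hcard, ?_⟩
  have hspan : affineSpan ℝ (T : Set (E d)) = ⊤ := by
    by_contra hne
    exact hv (measure_mono_null (convexHull_subset_affineSpan _) (Measure.addHaar_affineSubspace _ _ hne))
  rw [affineIndependent_iff_finrank_vectorSpan_eq (n := d) ℝ _ (by simp [hcard])]
  have h : Set.range ((↑) : T → E d) = (T : Set (E d)) := by ext; simp
  rw [h, ← direction_affineSpan, hspan, AffineSubspace.direction_top]
  simp

open scoped Classical in
/-- Replacing an endpoint of an edge by the midpoint of the edge halves the volume. -/
theorem IsSimplex.volume_bisect {T : Finset (E d)} (hT : IsSimplex T) {a b : E d} (ha : a ∈ T)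
    (hb : b ∈ T) (hab : a ≠ b) :
    volume (hull (insert (midpoint ℝ a b) (T.erase b))) = ENNReal.ofReal (1 / 2) * volume (hull T) := by
  set w : E d := (1 / 2 : ℝ) • (a - b) with hw
  set f : Module.Dual ℝ (E d) := (hT.coord b).linear with hf
  set c : E d := hT.coord b 0 • w with hc
  set φ : E d →ᵃ[ℝ] E d := (LinearMap.transvection f w).toAffineMap + AffineMap.const ℝ (E d) c
    with hφ
  have hφx : ∀ x, φ x = x + hT.coord b x • w := by
    intro x
    have h1 : hT.coord b x = f x + hT.coord b 0 := by simpa using (hT.coord b).map_vadd 0 x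
    simp only [hφ, AffineMap.coe_add, Pi.add_apply, LinearMap.coe_toAffineMap, AffineMap.const_apply,
      LinearMap.transvection.apply, hc]
    rw [h1, add_smul, add_assoc]
  have himg : φ '' (T : Set (E d)) = (insert (midpoint ℝ a b) (T.erase b) : Finset (E d)) := by
    have hmid : φ b = midpoint ℝ a b := by
      rw [hφx, hT.coord_self hb, one_smul, hw, midpoint_eq_smul_add, invOf_eq_inv]
      module
    have hfix : ∀ x ∈ T, x ≠ b → φ x = x := fun x hx hne => by
      rw [hφx, hT.coord_ne hx hne.symm, zero_smul, add_zero]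
    ext y
    simp only [Set.mem_image, Finset.mem_coe, Finset.mem_insert, Finset.mem_erase]
    constructor
    · rintro ⟨x, hx, rfl⟩
      by_cases hne : x = b
      · left; rw [hne, hmid]
      · right; rw [hfix x hx hne]; exact ⟨hne, hx⟩
    · rintro (rfl | ⟨hne, hy⟩)
      · exact ⟨b, hb, hmid⟩
      · exact ⟨y, hy, hfix y hy hne⟩
  have hdet : LinearMap.det (LinearMap.transvection f w) = 1 / 2 := by
    rw [LinearMap.transvection.det]
    have h1 : f (a - b) = -1 := by
      have := (hT.coord b).linearMap_vsub a b
      rw [vsub_eq_sub, vsub_eq_sub, hT.coord_self hb, hT.coord_ne ha hab.symm] at this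
      rw [hf, this]; norm_num
    rw [hw, map_smul, h1]; norm_num
  have himage : φ '' hull T = (fun x => x + c) '' (LinearMap.transvection f w '' hull T) := by
    rw [Set.image_image]; rfl
  rw [hull, ← himg, ← AffineMap.image_convexHull]
  change volume (φ '' hull T) = _
  rw [himage, Set.image_add_right, measure_preimage_add_right, Measure.addHaar_image_linearMap, hdet,
    abs_of_pos (by norm_num)]

namespace TaggedSimplex

/-- The vertices, indexed by natural numbers (`≤ d`). -/
def z (K : TaggedSimplex d) (i : ℕ) : E d := K.vert (Fin.ofNat (d + 1) i)

theorem vert_eq_z (K : TaggedSimplex d) (i : Fin (d + 1)) : K.vert i = K.z i := by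
  rw [z, Fin.ofNat_val_eq_self]

theorem mem_vertices {K : TaggedSimplex d} {y : E d} : y ∈ K.vertices ↔ ∃ i ≤ d, K.z i = y := by
  simp only [vertices, Finset.mem_image, Finset.mem_univ, true_and]
  constructor
  · rintro ⟨i, rfl⟩; exact ⟨i, by omega, (K.vert_eq_z i).symm⟩
  · rintro ⟨i, -, rfl⟩; exact ⟨_, rfl⟩

theorem card_vertices_le (K : TaggedSimplex d) : K.vertices.card ≤ d + 1 := by
  rw [vertices]
  exact Finset.card_image_le.trans (by simp)

theorem mid_eq (K : TaggedSimplex d) : K.mid = midpoint ℝ (K.z 0) (K.z d) := by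
  rw [mid, K.vert_eq_z, K.vert_eq_z]; simp

theorem z_child₁ (K : TaggedSimplex d) {i : ℕ} (hi : i ≤ d) :
    K.child₁.z i = if i = 0 then K.z 0 else if i = 1 then K.mid else K.z (i - 1) := by
  have h : i % (d + 1) = i := Nat.mod_eq_of_lt (by omega)
  simp only [z, child₁, Fin.val_ofNat, h]
  rfl

theorem z_child₂ (K : TaggedSimplex d) {i : ℕ} (hi : i ≤ d) :
    K.child₂.z i = if i = 0 then K.z d else if i = 1 then K.mid else
      if i ≤ K.tag + 1 then K.z (i - 1) else K.z (d + K.tag + 1 - i) := by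
  have h : i % (d + 1) = i := Nat.mod_eq_of_lt (by omega)
  have h' : K.vert (Fin.last d) = K.z d := by rw [K.vert_eq_z]; simp
  simp only [z, child₂, Fin.val_ofNat, h] at h' ⊢
  rw [h']

theorem z_injOn {K : TaggedSimplex d} (hK : IsSimplex K.vertices) {i j : ℕ} (hi : i ≤ d) (hj : j ≤ d)
    (hij : K.z i = K.z j) : i = j := by
  classical
  have hinj : Function.Injective K.vert := by
    have h : (Finset.univ.image K.vert).card = (Finset.univ : Finset (Fin (d + 1))).card := by
      have := hK.1
      rw [vertices] at this
      rw [this]; simp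
    exact fun a b hab => Finset.card_image_iff.1 h (by simp) (by simp) hab
  have := congrArg Fin.val (hinj hij)
  simpa [Nat.mod_eq_of_lt (show i < d + 1 by omega), Nat.mod_eq_of_lt (show j < d + 1 by omega)]
    using this

theorem pos (K : TaggedSimplex d) : 0 < d := Nat.zero_lt_of_lt K.tag.isLt

open scoped Classical in
theorem vertices_child₁ {K : TaggedSimplex d} (hK : IsSimplex K.vertices) :
    K.child₁.vertices = insert (midpoint ℝ (K.z 0) (K.z d)) (K.vertices.erase (K.z d)) := by
  have hd := K.pos
  ext y
  rw [Finset.mem_insert, Finset.mem_erase, mem_vertices, mem_vertices, ← K.mid_eq]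
  constructor
  · rintro ⟨i, hi, rfl⟩
    rw [K.z_child₁ hi]
    split_ifs with h0 h1
    · exact Or.inr ⟨fun h => by have := z_injOn hK (Nat.zero_le d) le_rfl h; omega, 0, by omega, rfl⟩
    · exact Or.inl rfl
    · exact Or.inr ⟨fun h => by have := z_injOn hK (by omega) le_rfl h; omega, i - 1, by omega, rfl⟩
  · rintro (rfl | ⟨hne, i, hi, rfl⟩)
    · exact ⟨1, hd, by rw [K.z_child₁ hd]; simp⟩
    · have hid : i ≠ d := fun h => hne (by rw [h])
      rcases Nat.eq_zero_or_pos i with rfl | hi0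
      · exact ⟨0, by omega, by rw [K.z_child₁ (by omega)]; simp⟩
      · refine ⟨i + 1, by omega, ?_⟩
        rw [K.z_child₁ (by omega), if_neg (by omega), if_neg (by omega), Nat.add_sub_cancel]

open scoped Classical in
theorem vertices_child₂ {K : TaggedSimplex d} (hK : IsSimplex K.vertices) :
    K.child₂.vertices = insert (midpoint ℝ (K.z d) (K.z 0)) (K.vertices.erase (K.z 0)) := by
  have hd := K.pos
  have ht := K.tag.isLt
  ext y
  rw [Finset.mem_insert, Finset.mem_erase, mem_vertices, mem_vertices, midpoint_comm, ← K.mid_eq]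
  constructor
  · rintro ⟨i, hi, rfl⟩
    rw [K.z_child₂ hi]
    split_ifs with h0 h1 h2
    · exact Or.inr ⟨fun h => by have := z_injOn hK le_rfl (Nat.zero_le d) h; omega, d, le_rfl, rfl⟩
    · exact Or.inl rfl
    · exact Or.inr ⟨fun h => by have := z_injOn hK (by omega) (by omega) h; omega, i - 1, by omega, rfl⟩
    · exact Or.inr ⟨fun h => by have := z_injOn hK (by omega) (by omega) h; omega, _, by omega, rfl⟩
  · rintro (rfl | ⟨hne, i, hi, rfl⟩)
    · exact ⟨1, hd, by rw [K.z_child₂ hd]; simp⟩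
    · have hi0 : i ≠ 0 := fun h => hne (by rw [h])
      rcases eq_or_ne i d with rfl | hid
      · exact ⟨0, by omega, by rw [K.z_child₂ (by omega)]; simp⟩
      · by_cases hit : i ≤ K.tag
        · refine ⟨i + 1, by omega, ?_⟩
          rw [K.z_child₂ (by omega), if_neg (by omega), if_neg (by omega), if_pos (by omega),
            Nat.add_sub_cancel]
        · refine ⟨d + K.tag + 1 - i, by omega, ?_⟩
          rw [K.z_child₂ (by omega), if_neg (by omega), if_neg (by omega), if_neg (by omega)]
          congr 1; omega

theorem volume_child {K : TaggedSimplex d} (hK : IsSimplex K.vertices) :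
    (volume (hull K.child₁.vertices)).toReal = (volume (hull K.vertices)).toReal / 2 ∧
    (volume (hull K.child₂.vertices)).toReal = (volume (hull K.vertices)).toReal / 2 := by
  have hd := K.pos
  have hne : K.z 0 ≠ K.z d := fun h => by have := z_injOn hK (Nat.zero_le d) le_rfl h; omega
  have h0 : K.z 0 ∈ K.vertices := mem_vertices.2 ⟨0, by omega, rfl⟩
  have h1 : K.z d ∈ K.vertices := mem_vertices.2 ⟨d, le_rfl, rfl⟩
  rw [vertices_child₁ hK, vertices_child₂ hK, hK.volume_bisect h0 h1 hne,
    hK.volume_bisect h1 h0 hne.symm, ENNReal.toReal_mul, ENNReal.toReal_ofReal (by norm_num)]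
  constructor <;> ring

/-- The vertices of `K`, relative to `z_0`, are the points `p_1, …, p_{d-t}` and
`p_{d-t+1}/2, …, p_d/2` in the order `p_{d-t+1}/2, …, p_d/2, p_1, …, p_{d-t}`. All simplices obtained
from `K` by bisection that have not been halved in all directions come from the same points, up to
the operation `(p_i) ↦ (p_{d-t-i} - p_{d-t})_{i ≤ d-t}, (p_i - 2 p_{d-t})_{i ≥ d-t}`, which
preserves the lengths of the edges `p_{i+1} - p_i`. -/
structure HasFrame (K : TaggedSimplex d) (p : ℕ → E d) : Prop where
  zero : p 0 = 0
  full : ∀ i : ℕ, 1 ≤ i → i ≤ d - K.tag → K.z (K.tag + i) = K.z 0 + p i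
  half : ∀ i : ℕ, 1 ≤ i → i ≤ K.tag → K.z i = K.z 0 + (1 / 2 : ℝ) • p (d - K.tag + i)

/-- The frame of `K` has edges of length at most `M s`, and the volume of the parallelepiped that it
spans is at least of the order `(W s)^d`. -/
def IsControlled (M W : ℝ) (K : TaggedSimplex d) : Prop :=
  ∃ (p : ℕ → E d) (s : ℝ), 0 < s ∧ K.HasFrame p ∧ (∀ i < d, ‖p (i + 1) - p i‖ ≤ M * s) ∧
    (W * s) ^ d ≤ 2 ^ (K.tag : ℕ) * (volume (hull K.vertices)).toReal

theorem IsControlled.isSimplex {M W : ℝ} (hW : 0 < W) {K : TaggedSimplex d}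
    (h : K.IsControlled M W) : IsSimplex K.vertices := by
  obtain ⟨p, s, hs, -, -, hV⟩ := h
  refine isSimplex_of_volume_ne_zero K.card_vertices_le fun h0 => ?_
  rw [h0, ENNReal.toReal_zero, mul_zero] at hV
  exact absurd hV (not_le.2 (by positivity))

/-- In a child, the tag is advanced; after `d` bisections the frame is halved. -/
theorem isControlled_child {M W s : ℝ} (hs : 0 < s) {K K' : TaggedSimplex d}
    (htag : K'.tag = K.nextTag) {q : ℕ → E d} (hq0 : q 0 = 0)
    (hq : ∀ i < d, ‖q (i + 1) - q i‖ ≤ M * s)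
    (hfull : ∀ i : ℕ, 1 ≤ i → i + K.tag + 1 ≤ d → K'.z (K.tag + 1 + i) = K'.z 0 + q i)
    (hhalf : ∀ i : ℕ, 1 ≤ i → i ≤ K.tag + 1 →
      K'.z i = K'.z 0 + (1 / 2 : ℝ) • q (d - K.tag - 1 + i))
    (hV : (W * s) ^ d ≤ 2 ^ (K.tag : ℕ) * (volume (hull K.vertices)).toReal)
    (hvol : (volume (hull K'.vertices)).toReal = (volume (hull K.vertices)).toReal / 2) :
    K'.IsControlled M W := by
  have ht := K.tag.isLt
  have htag' : (K'.tag : ℕ) = (K.tag + 1) % d := by rw [htag]; rfl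
  rcases (show (K.tag : ℕ) + 1 ≤ d by omega).lt_or_eq with hlt | heq
  · rw [Nat.mod_eq_of_lt hlt] at htag'
    refine ⟨q, s, hs, ⟨hq0, fun i h1 h2 => ?_, fun i h1 h2 => ?_⟩, hq, ?_⟩
    · rw [htag'] at h2 ⊢; exact hfull i h1 (by omega)
    · rw [htag'] at h2 ⊢; exact hhalf i h1 h2
    · rw [htag', hvol, pow_succ]; linarith
  · rw [heq, Nat.mod_self] at htag'
    refine ⟨fun i => (1 / 2 : ℝ) • q i, s / 2, by positivity, ⟨by simp [hq0], fun i h1 h2 => ?_,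
      fun i h1 h2 => by omega⟩, fun i hi => ?_, ?_⟩
    · rw [htag'] at h2 ⊢
      rw [Nat.zero_add, hhalf i h1 (by omega), show d - K.tag - 1 + i = i by omega]
    · rw [← smul_sub, norm_smul, Real.norm_of_nonneg (by norm_num)]
      have := hq i hi
      linarith
    · rw [htag', hvol, pow_zero, one_mul, ← mul_div_assoc, div_pow, div_le_iff₀ (by positivity)]
      have h2 : (2 : ℝ) ^ d = 2 ^ (K.tag : ℕ) * 2 := by rw [← pow_succ, heq]
      rw [h2]; linarith

theorem IsControlled.child₁ {M W : ℝ} (hW : 0 < W) {K : TaggedSimplex d} (h : K.IsControlled M W) :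
    K.child₁.IsControlled M W := by
  have hvol := (volume_child (h.isSimplex hW)).1
  obtain ⟨p, s, hs, hp, hM, hV⟩ := h
  have ht := K.tag.isLt
  have hz0 : K.child₁.z 0 = K.z 0 := by rw [K.z_child₁ (by omega)]; simp
  have hzd : K.z d = K.z 0 + p (d - K.tag) := by
    rw [← hp.full (d - K.tag) (by omega) le_rfl]; congr 1; omega
  refine isControlled_child hs rfl hp.zero hM (fun i h1 h2 => ?_) (fun i h1 h2 => ?_) hV hvol
  · rw [hz0, K.z_child₁ (by omega), if_neg (by omega), if_neg (by omega),
      ← hp.full i h1 (by omega)]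
    congr 1; omega
  · rw [hz0, K.z_child₁ (by omega), if_neg (by omega)]
    split_ifs with hi
    · subst hi
      rw [K.mid_eq, hzd, show d - K.tag - 1 + 1 = d - K.tag by omega, midpoint_eq_smul_add, invOf_eq_inv]
      module
    · rw [hp.half (i - 1) (by omega) (by omega)]
      congr 3; omega

theorem IsControlled.child₂ {M W : ℝ} (hW : 0 < W) {K : TaggedSimplex d} (h : K.IsControlled M W) :
    K.child₂.IsControlled M W := by
  have hvol := (volume_child (h.isSimplex hW)).2
  obtain ⟨p, s, hs, hp, hM, hV⟩ := h
  have ht := K.tag.isLt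
  set k := d - (K.tag : ℕ) with hk
  have hz0 : K.child₂.z 0 = K.z d := by rw [K.z_child₂ (by omega)]; simp
  have hzd : K.z d = K.z 0 + p k := by
    rw [← hp.full k (by omega) le_rfl]; congr 1; omega
  set q : ℕ → E d := fun i => if i ≤ k then p (k - i) - p k else p i - (2 : ℝ) • p k with hq
  have hq1 : ∀ i, i ≤ k → q i = p (k - i) - p k := fun i hi => by simp only [hq, if_pos hi]
  have hq2 : ∀ i, k ≤ i → q i = p i - (2 : ℝ) • p k := fun i hi => by
    rcases hi.lt_or_eq with h | h
    · simp only [hq, if_neg (not_le.2 h)]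
    · subst h
      rw [hq1 k le_rfl, Nat.sub_self, hp.zero]; module
  refine isControlled_child (q := q) hs rfl (by rw [hq1 0 (by omega)]; simp) (fun i hi => ?_)
    (fun i h1 h2 => ?_) (fun i h1 h2 => ?_) hV hvol
  · rcases lt_or_ge i k with hik | hik
    · rw [hq1 i hik.le, hq1 (i + 1) hik, sub_sub_sub_cancel_right, norm_sub_rev]
      have := hM (k - (i + 1)) (by omega)
      rwa [show k - (i + 1) + 1 = k - i by omega] at this
    · rw [hq2 i hik, hq2 (i + 1) (by omega), sub_sub_sub_cancel_right]
      exact hM i hi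
  · rw [hz0, K.z_child₂ (by omega), if_neg (by omega), if_neg (by omega), if_neg (by omega),
      hq1 i (by omega), hzd, show d + K.tag + 1 - (K.tag + 1 + i) = K.tag + (k - i) by omega,
      hp.full (k - i) (by omega) (by omega)]
    abel
  · rw [hz0, K.z_child₂ (by omega), if_neg (by omega), hzd, hq2 _ (by omega)]
    split_ifs with hi
    · subst hi
      rw [K.mid_eq, hzd, show k - 1 + 1 = k by omega, midpoint_eq_smul_add, invOf_eq_inv]
      module
    · rw [hp.half (i - 1) (by omega) (by omega), ← hk, show k - 1 + i = k + (i - 1) by omega]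
      module

/-- Every simplex is controlled, in terms of its diameter and its volume. -/
theorem isControlled_of_le {M W : ℝ} {K : TaggedSimplex d} (hM : 4 * Metric.diam (hull K.vertices) ≤ M)
    (hW : 0 ≤ W) (hWV : W ≤ hElem K.vertices) : K.IsControlled M W := by
  have ht := K.tag.isLt
  have hd : d ≠ 0 := by omega
  set k := d - (K.tag : ℕ) with hk
  set D := Metric.diam (hull K.vertices)
  have hD : ∀ i ≤ d, ‖K.z i - K.z 0‖ ≤ D := fun i hi => by
    rw [← dist_eq_norm]
    exact dist_le_diam_hull (subset_hull _ (mem_vertices.2 ⟨i, hi, rfl⟩))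
      (subset_hull _ (mem_vertices.2 ⟨0, by omega, rfl⟩))
  have hD0 : 0 ≤ D := Metric.diam_nonneg
  set p : ℕ → E d := fun i => if i = 0 then 0 else if i ≤ k then K.z (K.tag + i) - K.z 0 else
    (2 : ℝ) • (K.z (i - k) - K.z 0) with hp
  have hpD : ∀ i ≤ d, ‖p i‖ ≤ 2 * D := by
    intro i hi
    simp only [hp]
    split_ifs with h0 h1
    · simpa using hD0
    · linarith [hD (K.tag + i) (by omega)]
    · rw [norm_smul, Real.norm_of_nonneg (by norm_num)]
      linarith [hD (i - k) (by omega)]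
  refine ⟨p, 1, one_pos, ⟨by simp [hp], fun i h1 h2 => ?_, fun i h1 h2 => ?_⟩, fun i hi => ?_, ?_⟩
  · simp only [hp, if_neg (show i ≠ 0 by omega), if_pos (show i ≤ k from h2)]; abel
  · simp only [← hk, hp, if_neg (show k + i ≠ 0 by omega), if_neg (show ¬k + i ≤ k by omega),
      Nat.add_sub_cancel_left]
    module
  · refine (norm_sub_le _ _).trans ?_
    linarith [hpD i hi.le, hpD (i + 1) hi]
  · rw [mul_one, ← hElem_pow hd]
    refine (pow_le_pow_left₀ hW hWV d).trans ?_
    exact le_mul_of_one_le_left (pow_nonneg (hW.trans hWV) _) (one_le_pow₀ (by norm_num))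

/-- Controlled simplices are shape regular. -/
theorem IsControlled.diam_le {M W : ℝ} (hM : 0 ≤ M) (hW : 0 < W) {K : TaggedSimplex d}
    (h : K.IsControlled M W) :
    Metric.diam (hull K.vertices) ≤ 4 * d * M / W * hElem K.vertices := by
  have hK := h.isSimplex hW
  obtain ⟨p, s, hs, hp, hMp, hV⟩ := h
  have ht := K.tag.isLt
  have hd : d ≠ 0 := by omega
  have hpi : ∀ i ≤ d, ‖p i‖ ≤ i * (M * s) := by
    intro i
    induction i with
    | zero => intro _; simp [hp.zero]
    | succ i ih =>
      intro hi
      calc ‖p (i + 1)‖ = ‖p i + (p (i + 1) - p i)‖ := by congr 1; abel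
        _ ≤ _ := norm_add_le _ _
        _ ≤ i * (M * s) + M * s := add_le_add (ih (by omega)) (hMp i hi)
        _ = _ := by push_cast; ring
  have hpd : ∀ i ≤ d, ‖p i‖ ≤ d * (M * s) := fun i hi =>
    (hpi i hi).trans (mul_le_mul_of_nonneg_right (by exact_mod_cast hi) (by positivity))
  have hz : ∀ i ≤ d, dist (K.z i) (K.z 0) ≤ d * (M * s) := by
    intro i hi
    rw [dist_eq_norm]
    rcases Nat.eq_zero_or_pos i with rfl | hi0
    · simp only [sub_self, norm_zero]; positivity
    by_cases hit : i ≤ K.tag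
    · rw [hp.half i hi0 hit, add_sub_cancel_left, norm_smul, Real.norm_of_nonneg (by norm_num)]
      have := hpd (d - K.tag + i) (by omega)
      linarith [norm_nonneg (p (d - K.tag + i))]
    · have := hp.full (i - K.tag) (by omega) (by omega)
      rw [show (K.tag : ℕ) + (i - K.tag) = i by omega] at this
      rw [this, add_sub_cancel_left]
      exact hpd _ (by omega)
  have hdiam : Metric.diam (hull K.vertices) ≤ 2 * (d * (M * s)) := by
    refine Metric.diam_le_of_subset_closedBall (x := K.z 0) (by positivity) ?_
    refine convexHull_min (fun y hy => ?_) (convex_closedBall _ _)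
    obtain ⟨i, hi, rfl⟩ := mem_vertices.1 hy
    exact hz i hi
  have hWs : W * s ≤ 2 * hElem K.vertices := by
    refine le_of_pow_le_pow_left₀ hd (by have := hK.hElem_pos; positivity) (hV.trans ?_)
    rw [mul_pow, hElem_pow hd]
    refine mul_le_mul_of_nonneg_right ?_ ENNReal.toReal_nonneg
    exact pow_le_pow_right₀ (by norm_num) (by omega)
  refine hdiam.trans ?_
  rw [div_mul_eq_mul_div, le_div_iff₀ hW]
  calc 2 * (d * (M * s)) * W = 2 * d * M * (W * s) := by ring
    _ ≤ 2 * d * M * (2 * hElem K.vertices) := by gcongr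
    _ = _ := by ring

end TaggedSimplex

theorem isControlled_of_bisected {M W : ℝ} (hW : 0 < W) {𝒮₀ 𝒮 : Finset (TaggedSimplex d)}
    (h0 : ∀ K ∈ 𝒮₀, K.IsControlled M W) (h : Bisected 𝒮₀ 𝒮) : ∀ K ∈ 𝒮, K.IsControlled M W := by
  induction h with
  | refl => exact h0
  | bisect K _ hK ih =>
    classical
    intro K' hK'
    rw [Finset.mem_insert, Finset.mem_insert] at hK'
    rcases hK' with rfl | rfl | hK'
    · exact (ih K hK).child₁ hW
    · exact (ih K hK).child₂ hW
    · exact ih K' (Finset.mem_of_mem_erase hK')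

/-- All meshes obtained from an initial mesh by bisection are uniformly shape regular. -/
theorem exists_isShapeRegular_bisectionMeshes {Ω : Set (E d)} {𝒯₀ : Finset (Finset (E d))}
    (h𝒯₀ : IsTriangulation Ω 𝒯₀) : ∃ γ : ℝ, ∀ 𝒯 ∈ bisectionMeshes Ω 𝒯₀, IsShapeRegular γ 𝒯 := by
  classical
  obtain ⟨M, hM0, hM⟩ : ∃ M : ℝ, 0 ≤ M ∧ ∀ T ∈ 𝒯₀, 4 * Metric.diam (hull T) ≤ M := by
    obtain ⟨M, hM⟩ := (𝒯₀.image fun T => 4 * Metric.diam (hull T)).exists_le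
    exact ⟨max 0 M, le_max_left _ _, fun T hT =>
      (hM _ (Finset.mem_image_of_mem _ hT)).trans (le_max_right _ _)⟩
  obtain ⟨W, hW0, hW⟩ : ∃ W : ℝ, 0 < W ∧ ∀ T ∈ 𝒯₀, W ≤ hElem T := by
    rcases 𝒯₀.eq_empty_or_nonempty with rfl | hne
    · exact ⟨1, one_pos, by simp⟩
    · obtain ⟨S, hS, hmin⟩ := 𝒯₀.exists_min_image hElem hne
      exact ⟨hElem S, (h𝒯₀.isSimplex hS).hElem_pos, hmin⟩
  refine ⟨4 * d * M / W, ?_⟩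
  rintro 𝒯 ⟨-, label, hlabel, 𝒮, hb, rfl⟩ T hT
  obtain ⟨K, hK, rfl⟩ := Finset.mem_image.1 hT
  refine (isControlled_of_bisected hW0 (fun K hK => ?_) hb K hK).diam_le hM0 hW0
  obtain ⟨S, hS, rfl⟩ := Finset.mem_image.1 hK
  refine TaggedSimplex.isControlled_of_le ?_ hW0.le ?_
  · rw [hlabel S hS]; exact hM S hS
  · rw [hlabel S hS]; exact hW S hS

end Clement

end

theorem mainTheorem9 (d : ℕ) (hd : d = 2 ∨ d = 3) :
    -- the operator maps into the finite element space and preserves box constraints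
    (∀ (Ω : Set (Clement.E d)) (𝒯 : Finset (Finset (Clement.E d))),
      Clement.IsPolyhedralDomain Ω → Clement.IsTriangulation Ω 𝒯 →
      ∀ v : Clement.E d → ℝ, IntegrableOn v Ω →
        Clement.interp 𝒯 v ∈ Clement.feSpace Ω 𝒯 ∧
        ∀ c₀ c₁ : ℝ, (∀ᵐ x ∂volume.restrict Ω, c₀ ≤ v x ∧ v x ≤ c₁) →
          Clement.interp 𝒯 v ∈ Clement.feSpace Ω 𝒯 ∩ Clement.admissible Ω c₀ c₁) ∧
    -- estimates with a constant depending only on the dimension and the shape regularity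
    (∀ γ : ℝ, ∃ c : ℝ≥0, ∀ (Ω : Set (Clement.E d)) (𝒯 : Finset (Finset (Clement.E d))),
      Clement.IsPolyhedralDomain Ω → Clement.IsTriangulation Ω 𝒯 → Clement.IsShapeRegular γ 𝒯 →
      Clement.LocalEstimates Ω 𝒯 c) ∧
    -- estimates uniform over all meshes obtained from an initial mesh by bisection
    (∀ (Ω : Set (Clement.E d)) (𝒯₀ : Finset (Finset (Clement.E d))),
      Clement.IsPolyhedralDomain Ω → Clement.IsTriangulation Ω 𝒯₀ →
      ∃ c : ℝ≥0, ∀ 𝒯 ∈ Clement.bisectionMeshes Ω 𝒯₀, Clement.LocalEstimates Ω 𝒯 c) := by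
  have hd2 : 2 ≤ d := by omega
  refine ⟨fun Ω 𝒯 hΩ h𝒯 v hv => ⟨h𝒯.interp_mem_feSpace v, fun c₀ c₁ hc =>
    ⟨h𝒯.interp_mem_feSpace v, ⟨_, h𝒯.isSobolev_of_mem_feSpace hΩ (h𝒯.interp_mem_feSpace v) 2⟩, ?_⟩⟩,
    Clement.exists_localEstimates hd2, fun Ω 𝒯₀ hΩ h𝒯₀ => ?_⟩
  · exact ae_restrict_of_forall_mem hΩ.isOpen.measurableSet fun x hx =>
      h𝒯.interp_mem_Icc hΩ hv hc (subset_closure hx)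
  · obtain ⟨γ, hγ⟩ := Clement.exists_isShapeRegular_bisectionMeshes h𝒯₀
    obtain ⟨c, hc⟩ := Clement.exists_localEstimates hd2 γ
    exact ⟨c, fun 𝒯 h𝒯 => hc Ω 𝒯 hΩ h𝒯.1 (hγ 𝒯 h𝒯)⟩
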